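/- **Conventions.** Vectors are in $\mathbb R^3$; $\hat{\mathbf x}=\mathbf x/|\mathbf x|$. $Y_l^m$ ($l\ge 0$, $|m|\le l$) are the orthonormal complex spherical harmonics with Condon–Shortley phase ($Y_l^m:=0$ for $|m|>l$), and the real ones are $Y_{lm}=\frac1{\sqrt2}(Y_l^{-m}+(-1)^mY_l^m)$ for $m>0$, $Y_{l0}=Y_l^0$, $Y_{lm}=\frac{i}{\sqrt2}(Y_l^m-(-1)^mY_l^{-m})$ for $m<0$. With $\nabla_S$ the surface gradient of the unit sphere, the vector harmonics are $$V_l^m=\nabla_SY_l^m-(l+1)Y_l^m\hat{\mathbf r},\quad W_l^m=\nabla_SY_l^m+lY_l^m\hat{\mathbf r},\quad X_l^m=\hat{\mathbf r}\times\nabla_SY_l^m,$$ and $V_{lm},W_{lm},X_{lm}$ are defined in the same way from $Y_{lm}$. Put $I_l^m(\mathbf x)=\sqrt{\tfrac{4\pi}{2l+1}}\,Y_l^m(\hat{\mathbf x})/|\mathbf x|^{l+1}$. Let $\langle j_1,m_1;j_2,m_2\mid j,m\rangle$ be the Clebsch–Gordan coefficients, $\chi_{1,\pm1}=\frac1{\sqrt2}(\mp1,-i,0)^\top$,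 $\chi_{1,0}=(0,0,1)^\top$, and $$\vec Y_{j,k,M}=\sum_{s=-1}^{1}\langle k,M-s;1,s\mid j,M\rangle\,Y_k^{M-s}\,\chi_{1,s}.$$ For $\mathbf a=(a_x,a_y,a_z)$ let $a_{\pm1}=\mp\frac1{\sqrt2}(a_x\pm ia_y)$, $a_0=a_z$, $a=|\mathbf a|$, and define $$H_{l,\lambda}^{m,\mu}=H_{l,\lambda}^{m,\mu}(\mathbf a)=(-1)^{\lambda+\mu}\sqrt{\tfrac{2l+1}{2\lambda+1}}\;I_{l+\lambda}^{m-\mu}(\mathbf a)\sqrt{\tbinom{l+\lambda+\mu-m}{\lambda+\mu}\tbinom{l+\lambda+m-\mu}{\lambda-\mu}},$$ $$\begin{aligned}K_{k,j,\lambda}^{m_1,\mu,q}=&\sqrt{\tfrac{\lambda(2\lambda+1)(2\lambda-1)}{2k+1}}\,(-1)^q\langle\lambda-1,\mu-m_1;1,m_1\mid\lambda,\mu\rangle\langle1,q;\lambda-1,\mu-m_1\mid k,q+\mu-m_1\rangle\\&\times\langle1,0;\lambda-1,0\mid k,0\rangle\langle k,q+\mu-m_1;1,m_1\mid j,q+\mu\rangle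 .\end{aligned}$$ For a family $c=(c_{\lambda,\mu})$ of complex numbers and $\mathbf r\neq0$, $r=|\mathbf r|$, write $$\begin{aligned} \mathcal V[c]=&\sum_{\lambda=1}^\infty\sum_{\mu=-\lambda}^{\lambda}c_{\lambda,\mu}\,(r^{\lambda+1}+a^2r^{\lambda-1})\,W_\lambda^\mu(\hat{\mathbf r})\\ &+\sum_{\lambda=1}^\infty\sum_{\mu=-\lambda}^{\lambda}\sum_{q=-1}^{1}\sum_{m_1=-1}^{1}\sum_{\substack{|\lambda-2|\le k\le\lambda\\k\ne\lambda-1}}\ \sum_{|k-1|\le j\le k+1}c_{\lambda,\mu}\,2r^\lambda K_{k,j,\lambda}^{m_1,\mu,q}\,a_{-q}\,\vec Y_{j,k,q+\mu}(\hat{\mathbf r}),\\ \mathcal W_l[c]=&\ \mathcal V[c]+(2l+1)\sum_{\lambda=0}^\infty\sum_{\mu=-\lambda}^{\lambda}\frac{r^{\lambda+1}}{2\lambda+1}c_{\lambda,\mu}\bigl(W_\lambda^\mu(\hat{\mathbf r})-V_\lambda^\mu(\hat{\mathbf r})\bigr)\\ &+(2l+1)\sum_{\lambda=0}^\infty\sum_{\mu=-\lambda}^{\lambda}\sum_{q=-1}^{1}\sum_{|\lambda-1|\le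 j\le\lambda+1}(-1)^qa_{-q}\,r^\lambda c_{\lambda,\mu}\langle\lambda,\mu;1,q\mid j,\mu+q\rangle\,\vec Y_{j,\lambda,q+\mu}(\hat{\mathbf r}). \end{aligned}$$ **Theorem.** (1) On the unit sphere, for all integers $M$, $$\vec Y_{k-1,k,M}=\tfrac{1}{\sqrt{k(2k-1)}}V_{k-1}^{M},\quad \vec Y_{k,k,M}=\tfrac{-i}{\sqrt{k(k+1)}}X_k^{M}\quad(k\ge1),\qquad \vec Y_{k+1,k,M}=\tfrac1{\sqrt{(k+1)(2k+3)}}W_{k+1}^{M}\quad(k\ge0).$$ (2) For $k\ge0$ one has $W_k^M=\frac{(-1)^M}{\sqrt2}(W_{kM}+iW_{k,-M})$ for $M>0$, $W_k^0=W_{k0}$, and $W_k^M=\frac1{\sqrt2}(W_{k,-M}-iW_{kM})$ for $M<0$, and the same relations with $V$ in place of $W$. The formulas in (1) likewise hold with $V_{k-1}^M$, $X_k^M$, $W_{k+1}^M$ replaced by the corresponding combinations of real vector harmonics. (3) Let $l\ge0$, $|m|\le l$, $\mathbf r\ne0$, $|\mathbf r|<|\mathbf a|$, $\mathbf r'=\mathbf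 r+\mathbf a$, $r'=|\mathbf r'|$. Then, with every one of the series over $\lambda$ absolutely convergent, $$r'^{-l}V_l^m(\hat{\mathbf r}')=\mathcal V[c],\qquad r'^{-l}W_l^m(\hat{\mathbf r}')=\mathcal W_l[c],\qquad c_{\lambda,\mu}=H_{l,\lambda}^{m,\mu}(\mathbf a).$$ (4) Under the same hypotheses, with every series absolutely convergent, the real vector harmonics satisfy $$r'^{-l}V_{lm}(\hat{\mathbf r}')=\mathcal V[c],\qquad r'^{-l}W_{lm}(\hat{\mathbf r}')=\mathcal W_l[c],$$ where $c_{\lambda,\mu}=\frac1{\sqrt2}\bigl(H_{l,\lambda}^{-m,\mu}+(-1)^mH_{l,\lambda}^{m,\mu}\bigr)$ if $m>0$, $c_{\lambda,\mu}=\frac{i}{\sqrt2}\bigl(H_{l,\lambda}^{m,\mu}-(-1)^mH_{l,\lambda}^{-m,\mu}\bigr)$ if $m<0$, and $c_{\lambda,\mu}=H_{l,\lambda}^{0,\mu}$ if $m=0$. -/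

import Mathlib

open scoped Matrix

namespace VectorHarmonics

noncomputable section

/-- Physical space `ℝ³` with the Euclidean norm. -/
abbrev Space : Type := EuclideanSpace ℝ (Fin 3)

/-- The unit vector `x̂ = x / |x|` (used only for `x ≠ 0`). -/
def unitVec (x : Space) : Space := ‖x‖⁻¹ • x

/-- A real vector regarded as a vector of `ℂ³`. -/
def toComplex (x : Space) : Fin 3 → ℂ := fun k => ((x k : ℝ) : ℂ)

/-- The Legendre polynomial `P_l`, by the Rodrigues formula. -/
def legendre (l : ℕ) : Polynomial ℝ :=
  Polynomial.C (1 / (2 ^ l * (l.factorial : ℝ))) *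
    Polynomial.derivative^[l] ((Polynomial.X ^ 2 - 1) ^ l)

/-- The complex spherical harmonic `Y_l^m` of non-negative order `m`, orthonormal and with the
Condon-Shortley phase. At the unit vector `u` with polar angles `θ, φ` one has `u 2 = cos θ` and
`u 0 + i u 1 = sin θ e^{iφ}`, so that this is
`(-1)^m √((2l+1)/(4π) (l-m)!/(l+m)!) (sin θ)^m P_l⁽ᵐ⁾(cos θ) e^{imφ}`. It vanishes for `m > l`. -/
def sphHarmNat (l m : ℕ) (u : Space) : ℂ :=
  (-1) ^ m *
    ((Real.sqrt ((2 * l + 1) / (4 * Real.pi) *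
        (((l - m).factorial : ℝ) / ((l + m).factorial : ℝ))) : ℝ) : ℂ) *
    (((Polynomial.derivative^[m] (legendre l)).eval (u 2) : ℝ) : ℂ) *
    (((u 0 : ℝ) : ℂ) + Complex.I * ((u 1 : ℝ) : ℂ)) ^ m

/-- The complex spherical harmonic `Y_l^m`, with `Y_l^{-m} = (-1)^m conj (Y_l^m)`;
it is zero for `|m| > l`. -/
def sphHarm (l : ℕ) (m : ℤ) (u : Space) : ℂ :=
  if 0 ≤ m then sphHarmNat l m.toNat u
  else (-1) ^ m * (starRingEnd ℂ) (sphHarmNat l (-m).toNat u)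

/-- The real spherical harmonic `Y_{lm}` (as a function with values in `ℂ`). -/
def realSphHarm (l : ℕ) (m : ℤ) (u : Space) : ℂ :=
  if 0 < m then
    1 / ((Real.sqrt 2 : ℝ) : ℂ) * (sphHarm l (-m) u + (-1) ^ m * sphHarm l m u)
  else if m = 0 then sphHarm l 0 u
  else Complex.I / ((Real.sqrt 2 : ℝ) : ℂ) * (sphHarm l m u - (-1) ^ m * sphHarm l (-m) u)

/-- The surface gradient `∇_S f` at a point `u` of the unit sphere: the gradient at `u` of the
extension `x ↦ f (x / |x|)` of `f` that is constant along rays. Away from the poles this is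
`θ̂ ∂f/∂θ + φ̂ (1 / sin θ) ∂f/∂φ`. -/
def surfGrad (f : Space → ℂ) (u : Space) : Fin 3 → ℂ :=
  fun k => fderiv ℝ (fun x : Space => f (unitVec x)) u (EuclideanSpace.single k 1)

/-- The harmonic `V` attached to a scalar harmonic `f` of degree `l`. -/
def vecV (l : ℕ) (f : Space → ℂ) (u : Space) : Fin 3 → ℂ :=
  surfGrad f u - (((l : ℂ) + 1) * f u) • toComplex u

/-- The harmonic `W` attached to a scalar harmonic `f` of degree `l`. -/
def vecW (l : ℕ) (f : Space → ℂ) (u : Space) : Fin 3 → ℂ :=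
  surfGrad f u + ((l : ℂ) * f u) • toComplex u

/-- The harmonic `X` attached to a scalar harmonic `f`. -/
def vecX (f : Space → ℂ) (u : Space) : Fin 3 → ℂ :=
  crossProduct (toComplex u) (surfGrad f u)

/-- Complex vector spherical harmonic `V_l^m`. -/
def cV (l : ℕ) (m : ℤ) (u : Space) : Fin 3 → ℂ := vecV l (sphHarm l m) u

/-- Complex vector spherical harmonic `W_l^m`. -/
def cW (l : ℕ) (m : ℤ) (u : Space) : Fin 3 → ℂ := vecW l (sphHarm l m) u

/-- Complex vector spherical harmonic `X_l^m`. -/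
def cX (l : ℕ) (m : ℤ) (u : Space) : Fin 3 → ℂ := vecX (sphHarm l m) u

/-- Real vector spherical harmonic `V_{lm}`. -/
def rV (l : ℕ) (m : ℤ) (u : Space) : Fin 3 → ℂ := vecV l (realSphHarm l m) u

/-- Real vector spherical harmonic `W_{lm}`. -/
def rW (l : ℕ) (m : ℤ) (u : Space) : Fin 3 → ℂ := vecW l (realSphHarm l m) u

/-- Real vector spherical harmonic `X_{lm}`. -/
def rX (l : ℕ) (m : ℤ) (u : Space) : Fin 3 → ℂ := vecX (realSphHarm l m) u

/-- The irregular solid harmonic `I_l^m(x) = √(4π/(2l+1)) Y_l^m(x̂) / |x|^{l+1}`. -/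
def irregSolid (l : ℕ) (m : ℤ) (x : Space) : ℂ :=
  ((Real.sqrt (4 * Real.pi / (2 * l + 1)) : ℝ) : ℂ) *
    (sphHarm l m (unitVec x) / ((‖x‖ : ℝ) : ℂ) ^ (l + 1))

/-- Factorial of an integer that is known to be non-negative. -/
def factZ (n : ℤ) : ℝ := (n.toNat.factorial : ℝ)

/-- `1 / n!`, read as `0` for negative `n`. -/
def invFactZ (n : ℤ) : ℝ := if n < 0 then 0 else 1 / (n.toNat.factorial : ℝ)

/-- The Clebsch-Gordan coefficient `⟨j₁, m₁; j₂, m₂ | J, M⟩` for integral angular momenta, with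
the Condon-Shortley phase, by Racah's formula. It is zero unless `|m₁| ≤ j₁`, `|m₂| ≤ j₂`,
`|M| ≤ J`, `|j₁ - j₂| ≤ J ≤ j₁ + j₂` and `M = m₁ + m₂`. -/
def clebschGordan (j₁ : ℕ) (m₁ : ℤ) (j₂ : ℕ) (m₂ : ℤ) (J : ℕ) (M : ℤ) : ℝ :=
  if |m₁| ≤ j₁ ∧ |m₂| ≤ j₂ ∧ |M| ≤ J ∧ |(j₁ : ℤ) - j₂| ≤ J ∧ J ≤ j₁ + j₂ ∧ M = m₁ + m₂ then
    Real.sqrt ((2 * J + 1) * factZ (J + j₁ - j₂) * factZ (J - j₁ + j₂) * factZ (j₁ + j₂ - J) /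
        factZ (j₁ + j₂ + J + 1)) *
      Real.sqrt (factZ (J + M) * factZ (J - M) * factZ (j₁ - m₁) * factZ (j₁ + m₁) *
        factZ (j₂ - m₂) * factZ (j₂ + m₂)) *
      ∑ k ∈ Finset.range (j₁ + j₂ - J + 1),
        (-1) ^ k * (invFactZ k * invFactZ (j₁ + j₂ - J - k) * invFactZ (j₁ - m₁ - k) *
          invFactZ (j₂ + m₂ - k) * invFactZ (J - j₂ + m₁ + k) * invFactZ (J - j₁ - m₂ + k))
  else 0

/-- The spherical basis `χ_{1,q}`, `q = -1, 0, 1`, of `ℂ³`. -/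
def sphBasis (q : ℤ) : Fin 3 → ℂ :=
  if q = 1 then (1 / ((Real.sqrt 2 : ℝ) : ℂ)) • ![-1, -Complex.I, 0]
  else if q = -1 then (1 / ((Real.sqrt 2 : ℝ) : ℂ)) • ![1, -Complex.I, 0]
  else ![0, 0, 1]

/-- The spherical components `a_q`, `q = -1, 0, 1`, of a real vector `a`. -/
def sphComp (a : Space) (q : ℤ) : ℂ :=
  if q = 1 then
    -(1 / ((Real.sqrt 2 : ℝ) : ℂ)) * (((a 0 : ℝ) : ℂ) + Complex.I * ((a 1 : ℝ) : ℂ))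
  else if q = -1 then
    1 / ((Real.sqrt 2 : ℝ) : ℂ) * (((a 0 : ℝ) : ℂ) - Complex.I * ((a 1 : ℝ) : ℂ))
  else ((a 2 : ℝ) : ℂ)

/-- The coupled vector spherical harmonic
`Y⃗_{j,k,M} = ∑_s ⟨k, M - s; 1, s | j, M⟩ Y_k^{M-s} χ_{1,s}`. -/
def vecY (j k : ℕ) (M : ℤ) (u : Space) : Fin 3 → ℂ :=
  ∑ s ∈ Finset.Icc (-1 : ℤ) 1,
    (((clebschGordan k (M - s) 1 s j M : ℝ) : ℂ) * sphHarm k (M - s) u) • sphBasis s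

/-- The coefficient `H_{l,λ}^{m,μ}(a)`, for `|m| ≤ l` and `|μ| ≤ λ` (here `n` is `λ`). -/
def coeffH (l n : ℕ) (m μ : ℤ) (a : Space) : ℂ :=
  (-1) ^ ((n : ℤ) + μ) *
    ((Real.sqrt ((2 * l + 1) / (2 * n + 1)) : ℝ) : ℂ) *
    irregSolid (l + n) (m - μ) a *
    ((Real.sqrt (((((l : ℤ) + n + μ - m).toNat.choose ((n : ℤ) + μ).toNat : ℕ) : ℝ) *
      ((((l : ℤ) + n + m - μ).toNat.choose ((n : ℤ) - μ).toNat : ℕ) : ℝ)) : ℝ) : ℂ)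

/-- The coefficient `K_{k,j,λ}^{m₁,μ,q}`, for `λ ≥ 1` (here `n` is `λ`). -/
def coeffK (k j n : ℕ) (m₁ μ q : ℤ) : ℝ :=
  Real.sqrt ((n * (2 * n + 1) * (2 * n - 1) : ℝ) / (2 * k + 1)) * (-1) ^ q *
    clebschGordan (n - 1) (μ - m₁) 1 m₁ n μ *
    clebschGordan 1 q (n - 1) (μ - m₁) k (q + μ - m₁) *
    clebschGordan 1 0 (n - 1) 0 k 0 *
    clebschGordan k (q + μ - m₁) 1 m₁ j (q + μ)

/-- Coefficient of the real expansions for `m > 0`: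
`(H_{l,λ}^{-m,μ} + (-1)^m H_{l,λ}^{m,μ}) / √2`. -/
def coeffPos (l : ℕ) (m : ℤ) (a : Space) (n : ℕ) (μ : ℤ) : ℂ :=
  1 / ((Real.sqrt 2 : ℝ) : ℂ) * (coeffH l n (-m) μ a + (-1) ^ m * coeffH l n m μ a)

/-- Coefficient of the real expansions for `m < 0`:
`i (H_{l,λ}^{m,μ} - (-1)^m H_{l,λ}^{-m,μ}) / √2`. -/
def coeffNeg (l : ℕ) (m : ℤ) (a : Space) (n : ℕ) (μ : ℤ) : ℂ :=
  Complex.I / ((Real.sqrt 2 : ℝ) : ℂ) * (coeffH l n m μ a - (-1) ^ m * coeffH l n (-m) μ a)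

/-- The term of index `λ = n ≥ 1` of the first series, with coefficients `c λ μ`:
`∑_μ c (r^{λ+1} + |a|² r^{λ-1}) W_λ^μ(r̂)`. -/
def termW (c : ℕ → ℤ → ℂ) (r a : Space) (n : ℕ) : Fin 3 → ℂ :=
  ∑ μ ∈ Finset.Icc (-(n : ℤ)) n,
    (c n μ * ((‖r‖ ^ (n + 1) + ‖a‖ ^ 2 * ‖r‖ ^ (n - 1) : ℝ) : ℂ)) • cW n μ (unitVec r)

/-- The term of index `λ = n ≥ 1` of the second series, with coefficients `c λ μ`:
`∑_μ ∑_q ∑_{m₁} ∑_k ∑_j c 2 r^λ K_{k,j,λ}^{m₁,μ,q} a_{-q} Y⃗_{j,k,q+μ}(r̂)`, where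
`|λ - 2| ≤ k ≤ λ`, `k ≠ λ - 1` and `|k - 1| ≤ j ≤ k + 1`. -/
def termK (c : ℕ → ℤ → ℂ) (r a : Space) (n : ℕ) : Fin 3 → ℂ :=
  ∑ μ ∈ Finset.Icc (-(n : ℤ)) n, ∑ q ∈ Finset.Icc (-1 : ℤ) 1, ∑ m₁ ∈ Finset.Icc (-1 : ℤ) 1,
    ∑ k ∈ (Finset.Icc ((n : ℤ) - 2).natAbs n).filter (fun k : ℕ => (k : ℤ) ≠ (n : ℤ) - 1),
      ∑ j ∈ Finset.Icc ((k : ℤ) - 1).natAbs (k + 1),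
        (c n μ * (2 * ((‖r‖ : ℝ) : ℂ) ^ n) * ((coeffK k j n m₁ μ q : ℝ) : ℂ) *
          sphComp a (-q)) • vecY j k (q + μ) (unitVec r)

/-- The term of index `λ = n ≥ 0` of the third series, with coefficients `c λ μ`:
`∑_μ r^{λ+1} / (2λ+1) c (W_λ^μ(r̂) - V_λ^μ(r̂))`. -/
def termWV (c : ℕ → ℤ → ℂ) (r : Space) (n : ℕ) : Fin 3 → ℂ :=
  ∑ μ ∈ Finset.Icc (-(n : ℤ)) n,
    (((‖r‖ : ℝ) : ℂ) ^ (n + 1) / (2 * (n : ℂ) + 1) * c n μ) •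
      (cW n μ (unitVec r) - cV n μ (unitVec r))

/-- The term of index `λ = n ≥ 0` of the fourth series, with coefficients `c λ μ`:
`∑_μ ∑_q ∑_j (-1)^q a_{-q} r^λ c ⟨λ, μ; 1, q | j, μ+q⟩ Y⃗_{j,λ,q+μ}(r̂)`, where
`|λ - 1| ≤ j ≤ λ + 1`. -/
def termY (c : ℕ → ℤ → ℂ) (r a : Space) (n : ℕ) : Fin 3 → ℂ :=
  ∑ μ ∈ Finset.Icc (-(n : ℤ)) n, ∑ q ∈ Finset.Icc (-1 : ℤ) 1,
    ∑ j ∈ Finset.Icc ((n : ℤ) - 1).natAbs (n + 1),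
      ((-1) ^ q * sphComp a (-q) * ((‖r‖ : ℝ) : ℂ) ^ n * c n μ *
        ((clebschGordan n μ 1 q j (μ + q) : ℝ) : ℂ)) • vecY j n (q + μ) (unitVec r)

/-- `v` is the sum of the first two series (over `λ ≥ 1`), each of which converges absolutely. -/
def ExpandsV (c : ℕ → ℤ → ℂ) (r a : Space) (v : Fin 3 → ℂ) : Prop :=
  Summable (fun n : ℕ => termW c r a (n + 1)) ∧
  Summable (fun n : ℕ => termK c r a (n + 1)) ∧
  v = ∑' n : ℕ, termW c r a (n + 1) + ∑' n : ℕ, termK c r a (n + 1)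

/-- `v` is the sum of the first two series (over `λ ≥ 1`) and of `2l+1` times the last two (over
`λ ≥ 0`), each of which converges absolutely. -/
def ExpandsW (l : ℕ) (c : ℕ → ℤ → ℂ) (r a : Space) (v : Fin 3 → ℂ) : Prop :=
  Summable (fun n : ℕ => termW c r a (n + 1)) ∧
  Summable (fun n : ℕ => termK c r a (n + 1)) ∧
  Summable (fun n : ℕ => termWV c r n) ∧
  Summable (fun n : ℕ => termY c r a n) ∧
  v = ∑' n : ℕ, termW c r a (n + 1) + ∑' n : ℕ, termK c r a (n + 1) +
    (2 * (l : ℂ) + 1) • ∑' n : ℕ, termWV c r n + (2 * (l : ℂ) + 1) • ∑' n : ℕ, termY c r a n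

/-- The complex harmonic of order `M` in terms of the real harmonics `g` of orders `± M`. -/
def fromReal (g : ℤ → Fin 3 → ℂ) (M : ℤ) : Fin 3 → ℂ :=
  if 0 < M then ((-1) ^ M / ((Real.sqrt 2 : ℝ) : ℂ)) • (g M + Complex.I • g (-M))
  else if M = 0 then g 0
  else (1 / ((Real.sqrt 2 : ℝ) : ℂ)) • (g (-M) - Complex.I • g M)

end

end VectorHarmonics

open VectorHarmonics

/-!
The whole theorem rests on one fact: up to constants, `W_l^m` is the gradient on the unit sphere
of a regular solid harmonic and `V_l^m` the gradient of an irregular one (`cW_eq`,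
`cV_eq_gradIrreg`).

In the coordinates `ξ = (x + i y) / 2`, `η = (x - i y) / 2`, `z` the regular solid harmonics are
the coefficients of `(ξ w + z - η w⁻¹) ^ n / n!` (`solid`). This generating function gives all
their recurrences and their derivatives, which are harmonics of degree `n - 1` with coefficients
`±1`, and by the Rodrigues formula it gives the spherical harmonics (`sphHarm_eq`). The irregular
harmonics are the regular ones divided by an odd power of the radius, and their derivatives are
again irregular harmonics, of degree `l + 1` (`hasDerivAt_irregC`).

*Translation.* For `|r| < |a|` the distance `|a + t r|` is holomorphic and without zeros in a disc
of radius greater than `1` (`exists_sqrt_quadratic`). So the Taylor series at `t = 0` of an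
irregular harmonic along `t ↦ a + t r` converges at `t = 1`, and its terms are computed from the
derivatives (`hasSum_irregM`, and `hasSum_gradIrreg` for the gradients). The coefficients `H` are
those of this series in the normalisation of the spherical harmonics, so that the series is
`∑ H_{l,λ}^{m,μ} |r| ^ (λ - 1) W_λ^μ`, and `|r'| ^ (-l) V_l^m` is `|r'| ^ 2` times its sum. Now
`|r'| ^ 2 = |r| ^ 2 + |a| ^ 2 + 2 a · r`: the first two summands give the first series, and the last
one the second series, once the multiplication of `W_λ^μ` by `a · r̂` has been recognised in the
coefficients `K`. The form for `W` adds `(2 l + 1) Y_l^m r̂'`, where `r' r̂' = r + a` gives one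
series for each of `r` and `a`. The real forms follow by linearity.

*Coupling.* The Clebsch-Gordan coefficients with one angular momentum equal to `1` have a closed
form (`clebschGordan_mul_sqrt`), whose square roots are absorbed by the norms of the solid
harmonics. What remains are identities between solid harmonics with rational coefficients. They
give the coupled harmonics as multiples of `V`, `X` and `W` (`vecY_pred`, `vecY_self`,
`vecY_succ`), the inversion of the coupling (`sum_clebschGordan_smul_vecY`) and the product of a
spherical harmonic with a component of the unit vector (`sphComp_mul_sphHarm`); the last two
together explain `K` (`sum_coeffK`).
-/

namespace VectorHarmonics

noncomputable section

/-! ### Solid harmonics as polynomials -/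

/-- The coefficient of `w ^ μ` in `(ξ w + z - η w⁻¹) ^ n / n!`, through the recursion in `n`. For
`ξ = (x + i y) / 2` and `η = (x - i y) / 2` these are the regular solid harmonics of degree `n` and
order `μ`, in the normalisation in which their partial derivatives have coefficients `±1`. -/
def solid (ξ z η : ℂ) : ℕ → ℤ → ℂ
  | 0, μ => if μ = 0 then 1 else 0
  | n + 1, μ => (ξ * solid ξ z η n (μ - 1) + z * solid ξ z η n μ - η * solid ξ z η n (μ +
      1)) / (n + 1)

/-- `solid` of degree `n - 1`, read as `0` for `n = 0`: the polynomials that occur as the partial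
derivatives of `solid` of degree `n`. -/
def solidPred (ξ z η : ℂ) : ℕ → ℤ → ℂ
  | 0, _ => 0
  | n + 1, μ => solid ξ z η n μ

section
variable (ξ z η : ℂ)

theorem succ_mul_solid (n : ℕ) (μ : ℤ) : ((n : ℂ) + 1) * solid ξ z η (n + 1) μ =
    ξ * solid ξ z η n (μ - 1) + z * solid ξ z η n μ - η * solid ξ z η n (μ + 1) := by
  have : (n : ℂ) + 1 ≠ 0 := by exact_mod_cast n.succ_ne_zero
  rw [solid]; field_simp

/-- Euler's identity for the homogeneous polynomial `solid` of degree `n`. -/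
theorem natCast_mul_solid (n : ℕ) (μ : ℤ) : (n : ℂ) * solid ξ z η n μ =
    ξ * solidPred ξ z η n (μ - 1) + z * solidPred ξ z η n μ - η * solidPred ξ z η n (μ + 1) := by
  cases n with
  | zero => simp [solidPred]
  | succ n => simpa [solidPred] using succ_mul_solid ξ z η n μ

theorem solid_eq_zero {n : ℕ} {μ : ℤ} (h : (n : ℤ) < |μ|) : solid ξ z η n μ = 0 := by
  induction n generalizing μ with
  | zero =>
    have : μ ≠ 0 := by rintro rfl; simp at h
    simp [solid, this]
  | succ n ih =>
    push_cast at h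
    have h1 : (n : ℤ) < |μ - 1| := by rw [lt_abs] at *; omega
    have h2 : (n : ℤ) < |μ| := by omega
    have h3 : (n : ℤ) < |μ + 1| := by rw [lt_abs] at *; omega
    rw [solid, ih h1, ih h2, ih h3]; simp

/-- The action of the angular momentum about the `z`-axis, `ξ ∂/∂ξ - η ∂/∂η`. -/
theorem intCast_mul_solid (n : ℕ) (μ : ℤ) : (μ : ℂ) * solid ξ z η n μ =
    ξ * solidPred ξ z η n (μ - 1) + η * solidPred ξ z η n (μ + 1) := by
  induction n generalizing μ with
  | zero => by_cases h : μ = 0 <;> simp [solid, solidPred, h]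
  | succ n ih =>
    have hn : (n : ℂ) + 1 ≠ 0 := by exact_mod_cast n.succ_ne_zero
    apply mul_left_cancel₀ hn
    have e := succ_mul_solid ξ z η n μ
    have i1 := ih (μ - 1)
    have i2 := ih μ
    have i3 := ih (μ + 1)
    have n1 := natCast_mul_solid ξ z η n (μ - 1)
    have n2 := natCast_mul_solid ξ z η n (μ + 1)
    simp only [solidPred, sub_add_cancel, add_sub_cancel_right] at *
    push_cast at *
    linear_combination (μ : ℂ) * e + ξ * i1 + z * i2 - η * i3 - ξ * n1 - η * n2

theorem add_mul_solid (n : ℕ) (μ : ℤ) : ((n : ℂ) + 1 + μ) * solid ξ z η (n + 1) μ =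
    2 * ξ * solid ξ z η n (μ - 1) + z * solid ξ z η n μ := by
  have h1 := succ_mul_solid ξ z η n μ
  have h2 := intCast_mul_solid ξ z η (n + 1) μ
  simp only [solidPred] at h2
  linear_combination h1 + h2

theorem sub_mul_solid (n : ℕ) (μ : ℤ) : ((n : ℂ) + 1 - μ) * solid ξ z η (n + 1) μ =
    z * solid ξ z η n μ - 2 * η * solid ξ z η n (μ + 1) := by
  have h1 := succ_mul_solid ξ z η n μ
  have h2 := intCast_mul_solid ξ z η (n + 1) μ
  simp only [solidPred] at h2
  linear_combination h1 - h2

/-- Multiplication by `z`: the product is a combination of the harmonic of degree `n + 1` and of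
`z ^ 2 + 4 ξ η` (the square of the radius) times the harmonic of degree `n - 1`. -/
theorem z_mul_solid (n : ℕ) (μ : ℤ) : (2 * (n : ℂ) + 1) * (z * solid ξ z η n μ) =
    (((n : ℂ) + 1) ^ 2 - (μ : ℂ) ^ 2) * solid ξ z η (n + 1) μ +
      (z ^ 2 + 4 * ξ * η) * solidPred ξ z η n μ := by
  have h1 := add_mul_solid ξ z η n μ
  have h2 := natCast_mul_solid ξ z η n (μ - 1)
  have h3 := intCast_mul_solid ξ z η n (μ - 1)
  have h4 := natCast_mul_solid ξ z η n μ
  have h5 := intCast_mul_solid ξ z η n μ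
  simp only [sub_add_cancel] at *
  push_cast at *
  linear_combination (-(n : ℂ) - 1 + μ) * h1 - 2 * ξ * (h2 - h3) + z * (h4 + h5)

theorem xi_mul_solid (n : ℕ) (μ : ℤ) : (2 * (n : ℂ) + 1) * (2 * ξ * solid ξ z η n μ) =
    ((n : ℂ) + 2 + μ) * (n + 1 + μ) * solid ξ z η (n + 1) (μ + 1) -
      (z ^ 2 + 4 * ξ * η) * solidPred ξ z η n (μ + 1) := by
  have h1 := add_mul_solid ξ z η n (μ + 1)
  have h2 := z_mul_solid ξ z η n (μ + 1)
  simp only [add_sub_cancel_right] at *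
  push_cast at *
  linear_combination -(2 * (n : ℂ) + 1) * h1 - h2

theorem eta_mul_solid (n : ℕ) (μ : ℤ) : (2 * (n : ℂ) + 1) * (2 * η * solid ξ z η n μ) =
    (z ^ 2 + 4 * ξ * η) * solidPred ξ z η n (μ - 1) -
    ((n : ℂ) + 2 - μ) * (n + 1 - μ) * solid ξ z η (n + 1) (μ - 1) := by
  have h1 := sub_mul_solid ξ z η n (μ - 1)
  have h2 := z_mul_solid ξ z η n (μ - 1)
  simp only [sub_add_cancel] at *
  push_cast at *
  linear_combination (2 * (n : ℂ) + 1) * h1 + h2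

theorem solid_smul (c : ℂ) (n : ℕ) (μ : ℤ) :
    solid (c * ξ) (c * z) (c * η) n μ = c ^ n * solid ξ z η n μ := by
  induction n generalizing μ with
  | zero => simp [solid]
  | succ n ih => simp only [solid, ih]; ring

theorem solid_conj (n : ℕ) (μ : ℤ) :
    (starRingEnd ℂ) (solid ξ z η n μ) =
      solid ((starRingEnd ℂ) ξ) ((starRingEnd ℂ) z) ((starRingEnd ℂ) η) n μ := by
  induction n generalizing μ with
  | zero => simp only [solid]; split_ifs <;> simp
  | succ n ih => simp [solid, ih]

theorem solid_neg_swap (n : ℕ) (μ : ℤ) :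
    solid η z ξ n (-μ) = (-1) ^ μ * solid ξ z η n μ := by
  induction n generalizing μ with
  | zero => by_cases h : μ = 0 <;> simp [solid, h]
  | succ n ih =>
    have e1 := ih (μ + 1)
    have e2 := ih μ
    have e3 := ih (μ - 1)
    have hne : (-1 : ℂ) ≠ 0 := by norm_num
    rw [show -(μ + 1) = -μ - 1 by ring, zpow_add₀ hne] at e1
    rw [show -(μ - 1) = -μ + 1 by ring, zpow_sub₀ hne] at e3
    simp only [solid, e1, e2, e3]
    simp
    ring

end

/-- The partial derivatives of `solid` of degree `n` and order `μ` are those of degree `n - 1` and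
orders `μ - 1`, `μ` and `μ + 1`. -/
theorem hasDerivAt_solid {𝕜 : Type*} [NontriviallyNormedField 𝕜] [NormedAlgebra 𝕜 ℂ]
    {ξ z η : 𝕜 → ℂ} {ξ' z' η' : ℂ} {t : 𝕜} (hξ : HasDerivAt ξ ξ' t) (hz : HasDerivAt z z' t)
    (hη : HasDerivAt η η' t) (n : ℕ) (μ : ℤ) :
    HasDerivAt (fun s => solid (ξ s) (z s) (η s) n μ)
      (ξ' * solidPred (ξ t) (z t) (η t) n (μ - 1) + z' * solidPred (ξ t) (z t) (η t) n μ -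
        η' * solidPred (ξ t) (z t) (η t) n (μ + 1)) t := by
  induction n generalizing μ with
  | zero => simpa [solid, solidPred] using hasDerivAt_const t (if μ = 0 then (1 : ℂ) else 0)
  | succ n ih =>
    have hn : (n : ℂ) + 1 ≠ 0 := by exact_mod_cast n.succ_ne_zero
    have := ((((hξ.mul (ih (μ - 1))).add (hz.mul (ih μ))).sub (hη.mul (ih (μ + 1)))).div_const
      ((n : ℂ) + 1))
    refine this.congr_deriv ?_
    have n1 := natCast_mul_solid (ξ t) (z t) (η t) n (μ - 1)
    have n2 := natCast_mul_solid (ξ t) (z t) (η t) n μ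
    have n3 := natCast_mul_solid (ξ t) (z t) (η t) n (μ + 1)
    simp only [solidPred, sub_add_cancel, add_sub_cancel_right] at *
    field_simp
    linear_combination -ξ' * n1 - z' * n2 + η' * n3

theorem differentiableAt_solid {E : Type*} [NormedAddCommGroup E] [NormedSpace ℝ E]
    {ξ z η : E → ℂ} {x : E} (hξ : DifferentiableAt ℝ ξ x) (hz : DifferentiableAt ℝ z x)
    (hη : DifferentiableAt ℝ η x) (n : ℕ) (μ : ℤ) :
    DifferentiableAt ℝ (fun y => solid (ξ y) (z y) (η y) n μ) x := by
  induction n generalizing μ with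
  | zero => simp [solid]
  | succ n ih =>
    simp only [solid, div_eq_mul_inv]
    exact ((((hξ.mul (ih (μ - 1))).add (hz.mul (ih μ))).sub (hη.mul (ih (μ + 1))))).mul_const _

section
variable (ξ z η : ℂ)

open Polynomial in
/-- The generating function of `solid`, multiplied by `w ^ n` to make it a polynomial. -/
theorem factorial_mul_solid (n k : ℕ) :
    (n.factorial : ℂ) * solid ξ z η n ((k : ℤ) - n) =
      ((C ξ * X ^ 2 + C z * X - C η) ^ n).coeff k := by
  induction n generalizing k with
  | zero => simp [solid, coeff_one]
  | succ n ih =>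
    have e := succ_mul_solid ξ z η n ((k : ℤ) - (n + 1))
    have hp : (C ξ * X ^ 2 + C z * X - C η) ^ (n + 1) =
        C ξ * ((C ξ * X ^ 2 + C z * X - C η) ^ n * X ^ 2) +
          C z * ((C ξ * X ^ 2 + C z * X - C η) ^ n * X ^ 1) -
          C η * (C ξ * X ^ 2 + C z * X - C η) ^ n := by ring
    rw [hp, coeff_sub, coeff_add, coeff_C_mul, coeff_C_mul, coeff_C_mul, coeff_mul_X_pow',
      coeff_mul_X_pow', Nat.factorial_succ]
    push_cast
    have h0 : (k : ℤ) - (n + 1) + 1 = k - n := by ring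
    rw [h0] at e
    have h1 : (if 2 ≤ k then ((C ξ * X ^ 2 + C z * X - C η) ^ n).coeff (k - 2) else 0) =
        n.factorial * solid ξ z η n ((k : ℤ) - (n + 1) - 1) := by
      split_ifs with h
      · rw [← ih, Nat.cast_sub h]; congr 2; push_cast; ring
      · rw [solid_eq_zero, mul_zero]
        rw [lt_abs]; omega
    have h2 : (if 1 ≤ k then ((C ξ * X ^ 2 + C z * X - C η) ^ n).coeff (k - 1) else 0) =
        n.factorial * solid ξ z η n ((k : ℤ) - (n + 1)) := by
      split_ifs with h
      · rw [← ih, Nat.cast_sub h]; congr 2; push_cast; ring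
      · rw [solid_eq_zero, mul_zero]
        rw [lt_abs]; omega
    rw [h1, h2, ← ih]
    linear_combination (n.factorial : ℂ) * e

/-- Apart from a factor `ξ ^ m` (for order `m`) or `η ^ m` (for order `-m`), `solid` depends on `ξ`
and `η` through their product only. -/
theorem solid_scale (w c : ℂ) (n m : ℕ) :
    c ^ m * solid w z (c * η) n m = solid (c * w) z η n m ∧
      solid w z (c * η) n (-m) = c ^ m * solid (c * w) z η n (-m) := by
  induction n generalizing m with
  | zero =>
    rcases m with _ | m
    · simp [solid]
    · have h1 : ((m + 1 : ℕ) : ℤ) ≠ 0 := by omega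
      have h2 : -((m + 1 : ℕ) : ℤ) ≠ 0 := by omega
      simp only [solid, h1, h2, if_false, mul_zero, and_self]
  | succ n ih =>
    rcases m with _ | m
    · have a := (ih 1).1
      have b := (ih 1).2
      have d := (ih 0).1
      simp at a b d
      simp [solid, b, d, ← a]; ring
    · have a1 := (ih m).1
      have a2 := (ih (m + 1)).1
      have a3 := (ih (m + 1 + 1)).1
      have b1 := (ih m).2
      have b2 := (ih (m + 1)).2
      have b3 := (ih (m + 1 + 1)).2
      push_cast at *
      rw [show -((m : ℤ) + 1 + 1) = -(m + 1) - 1 by ring] at b3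
      rw [show -(m : ℤ) = -(m + 1) + 1 by ring] at b1
      rw [solid, solid, solid, solid, b1, b2, b3, add_sub_cancel_right, ← a1, ← a2, ← a3]
      constructor <;> ring

end

/-! ### Spherical harmonics as solid harmonics -/

/-- The coordinate `ξ = (x + i y) / 2` of a point of space. -/
def xiC (x : Space) : ℂ := (((x 0 : ℝ) : ℂ) + Complex.I * ((x 1 : ℝ) : ℂ)) / 2

/-- The coordinate `η = (x - i y) / 2` of a point of space. -/
def etaC (x : Space) : ℂ := (((x 0 : ℝ) : ℂ) - Complex.I * ((x 1 : ℝ) : ℂ)) / 2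

/-- The coordinate `z` of a point of space, as a complex number. -/
def zC (x : Space) : ℂ := ((x 2 : ℝ) : ℂ)

/-- The regular solid harmonic of degree `n` and order `μ` on space. It is zero for `|μ| > n`. -/
def regSolid (n : ℕ) (μ : ℤ) (x : Space) : ℂ := solid (xiC x) (zC x) (etaC x) n μ

/-- The regular solid harmonic of degree `n - 1` and order `μ`, read as `0` for `n = 0`. -/
def regSolidPred (n : ℕ) (μ : ℤ) (x : Space) : ℂ := solidPred (xiC x) (zC x) (etaC x) n μ

/-- The factor by which `Y_l^m` and `regSolid l m` differ on the unit sphere, up to `(-1) ^ m`.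
It has a meaning for `|m| ≤ l` only. -/
def harmNorm (l : ℕ) (m : ℤ) : ℝ :=
  Real.sqrt ((2 * l + 1) / (4 * Real.pi) * (factZ (l - m) * factZ (l + m)))

theorem zC_sq_add (x : Space) : zC x ^ 2 + 4 * xiC x * etaC x = ((‖x‖ : ℝ) : ℂ) ^ 2 := by
  rw [← Complex.ofReal_pow, EuclideanSpace.norm_sq_eq, Fin.sum_univ_three]
  simp only [zC, xiC, etaC, Real.norm_eq_abs, sq_abs]
  push_cast
  linear_combination (-((x 1 : ℝ) : ℂ) ^ 2) * Complex.I_sq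

theorem two_mul_inner (a r : Space) :
    2 * zC a * zC r + 4 * xiC a * etaC r + 4 * xiC r * etaC a = 2 * ((inner ℝ a r : ℝ) : ℂ) := by
  simp only [zC, xiC, etaC, PiLp.inner_apply, Fin.sum_univ_three]
  simp
  ring_nf
  rw [Complex.I_sq]; ring

theorem conj_xiC (x : Space) : (starRingEnd ℂ) (xiC x) = etaC x := by
  simp [xiC, etaC, sub_eq_add_neg, map_ofNat]

theorem conj_etaC (x : Space) : (starRingEnd ℂ) (etaC x) = xiC x := by
  simp [xiC, etaC, map_ofNat]

theorem conj_zC (x : Space) : (starRingEnd ℂ) (zC x) = zC x := by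
  simp [zC]

theorem regSolid_neg (n : ℕ) (μ : ℤ) (x : Space) :
    regSolid n (-μ) x = (-1) ^ μ * (starRingEnd ℂ) (regSolid n μ x) := by
  rw [regSolid, regSolid, solid_conj, conj_xiC, conj_etaC, conj_zC, ← solid_neg_swap]

theorem regSolid_smul (c : ℝ) (n : ℕ) (μ : ℤ) (x : Space) :
    regSolid n μ (c • x) = (c : ℂ) ^ n * regSolid n μ x := by
  rw [regSolid, regSolid, ← solid_smul]
  congr 1 <;> simp [xiC, etaC, zC] <;> ring

open Polynomial in
/-- By the Rodrigues formula `P_l⁽ᵐ⁾(t)` is a coefficient of the Taylor expansion of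
`(X ^ 2 - 1) ^ l` at `t`, that is, of the polynomial `(X ^ 2 + 2 t X - (1 - t ^ 2)) ^ l`. -/
theorem derivative_legendre_eval (l m : ℕ) (t : ℝ) :
    (((derivative^[m] (legendre l)).eval t : ℝ) : ℂ) =
      ((l + m).factorial : ℂ) / 2 ^ l * solid 1 (2 * t) (1 - (t : ℂ) ^ 2) l m := by
  have h1 : derivative^[m] (legendre l) =
      C (1 / (2 ^ l * (l.factorial : ℝ))) * derivative^[l + m] ((X ^ 2 - 1) ^ l) := by
    rw [legendre, iterate_derivative_C_mul, add_comm, Function.iterate_add_apply]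
  have h2 : (taylor t ((X ^ 2 - 1 : ℝ[X]) ^ l)).map (algebraMap ℝ ℂ) =
      (C (1 : ℂ) * X ^ 2 + C (2 * (t : ℂ)) * X - C (1 - (t : ℂ) ^ 2)) ^ l := by
    rw [taylor_pow, Polynomial.map_pow]
    congr 1
    have hC : (C (2 : ℂ) : ℂ[X]) = 2 := map_ofNat C 2
    simp [taylor_apply, hC]
    ring
  have h3 := factorial_mul_solid 1 (2 * (t : ℂ)) (1 - (t : ℂ) ^ 2) l (l + m)
  rw [← h2, coeff_map, taylor_coeff] at h3
  have h4 : (derivative^[l + m] ((X ^ 2 - 1 : ℝ[X]) ^ l)).eval t =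
      (l + m).factorial * (hasseDeriv (l + m) ((X ^ 2 - 1 : ℝ[X]) ^ l)).eval t := by
    rw [← factorial_smul_hasseDeriv]; simp
  rw [h1, eval_mul, eval_C, h4]
  push_cast
  have h5 : ((l : ℤ) + m) - l = m := by ring
  push_cast at h3
  rw [h5] at h3
  have h6 : (algebraMap ℝ ℂ) (eval t ((hasseDeriv (l + m)) ((X ^ 2 - 1) ^ l))) =
    ((eval t ((hasseDeriv (l + m)) ((X ^ 2 - 1) ^ l)) : ℝ) : ℂ) := rfl
  rw [h6] at h3
  rw [← h3]
  have : (l.factorial : ℂ) ≠ 0 := by exact_mod_cast l.factorial_ne_zero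
  field_simp

theorem sphHarmNat_eq (l m : ℕ) (u : Space) (hu : ‖u‖ = 1) :
    sphHarmNat l m u = (-1) ^ m * (harmNorm l m : ℂ) * regSolid l m u := by
  rcases lt_or_ge l m with h | h
  · rw [regSolid, solid_eq_zero _ _ _ (by simpa using h), sphHarmNat, derivative_legendre_eval,
      solid_eq_zero _ _ _ (by simpa using h)]
    simp
  -- `solid_scale` moves the factor `(x + i y) ^ m` inside, where `1 - z ^ 2 = (x + i y) (x - i y)`
  have key : ((u 0 : ℂ) + Complex.I * (u 1 : ℂ)) ^ m *
      solid 1 (2 * (u 2 : ℝ)) (1 - ((u 2 : ℝ) : ℂ) ^ 2) l m = 2 ^ l * regSolid l m u := by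
    have e := zC_sq_add u
    have s := (solid_scale (zC u) (etaC u) (1/2) (2 * xiC u) l m).1
    have h1 : 2 * xiC u = (u 0 : ℂ) + Complex.I * (u 1 : ℂ) := by simp [xiC]; ring
    rw [show 2 * xiC u * (1 / 2) = xiC u by ring] at s
    rw [regSolid, ← s, h1, mul_left_comm, ← solid_smul, ← h1]
    rw [hu] at e
    congr 2
    · norm_num
    · simp only [zC] at *; push_cast at *; linear_combination -e
  rw [sphHarmNat, derivative_legendre_eval]
  have hs : ((Real.sqrt ((2 * l + 1) / (4 * Real.pi) *
        (((l - m).factorial : ℝ) / ((l + m).factorial : ℝ))) : ℝ) : ℂ) * ((l + m).factorial : ℂ) =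
            harmNorm l m := by
    have hf : (0 : ℝ) < (l + m).factorial := by positivity
    rw [harmNorm]
    have h1 : factZ ((l : ℤ) - ((m : ℕ) : ℤ)) = (l - m).factorial := by
      rw [factZ]; congr 2; omega
    have h2 : factZ ((l : ℤ) + ((m : ℕ) : ℤ)) = (l + m).factorial := by
      rw [factZ]; congr 2
    rw [h1, h2]
    norm_cast
    rw [← Real.sqrt_sq hf.le, ← Real.sqrt_mul (by positivity)]
    congr 1
    rw [Real.sqrt_sq hf.le]
    push_cast
    field_simp
  rw [← hs]
  generalize ((Real.sqrt ((2 * l + 1) / (4 * Real.pi) *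
    (((l - m).factorial : ℝ) / ((l + m).factorial : ℝ))) : ℝ) : ℂ) = S
  have h2 : (2 : ℂ) ^ l ≠ 0 := pow_ne_zero _ two_ne_zero
  calc _ = (-1) ^ m * S * ((l + m).factorial : ℂ) / 2 ^ l * (((u 0 : ℂ) + Complex.I *
      (u 1 : ℂ)) ^ m *
      solid 1 (2 * (u 2 : ℝ)) (1 - ((u 2 : ℝ) : ℂ) ^ 2) l m) := by ring
    _ = _ := by rw [key]; field_simp

theorem harmNorm_neg (l : ℕ) (m : ℤ) : harmNorm l (-m) = harmNorm l m := by
  rw [harmNorm, harmNorm, sub_neg_eq_add, ← sub_eq_add_neg, mul_comm (factZ _)]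

theorem sphHarm_eq (l : ℕ) (m : ℤ) (u : Space) (hu : ‖u‖ = 1) :
    sphHarm l m u = (-1) ^ m * (harmNorm l m : ℂ) * regSolid l m u := by
  rw [sphHarm]
  split_ifs with h
  · lift m to ℕ using h
    simp [sphHarmNat_eq l _ u hu]
  · obtain ⟨k, hk⟩ : ∃ k : ℕ, m = -(k : ℤ) := ⟨(-m).toNat, by omega⟩
    subst hk
    have : (-1 : ℂ) ^ k * (-1) ^ k = 1 := by rw [← mul_pow]; simp
    rw [neg_neg, Int.toNat_natCast, sphHarmNat_eq l _ u hu, regSolid_neg, harmNorm_neg]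
    simp
    ring

/-! ### Vector harmonics and the surface gradient -/

/-- The gradient of the coordinate `ξ`. -/
def vecXi : Fin 3 → ℂ := ![1 / 2, Complex.I / 2, 0]

/-- The gradient of the coordinate `η`. -/
def vecEta : Fin 3 → ℂ := ![1 / 2, -Complex.I / 2, 0]

/-- The gradient of the coordinate `z`. -/
def vecZ : Fin 3 → ℂ := ![0, 0, 1]

theorem toComplex_eq (x : Space) :
    toComplex x = (2 * etaC x) • vecXi + zC x • vecZ + (2 * xiC x) • vecEta := by
  ext k
  fin_cases k <;> simp [toComplex, vecXi, vecEta, vecZ, xiC, etaC, zC] <;> ring_nf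
  rw [Complex.I_sq]; ring

/-- The gradient of the regular solid harmonic of degree `n` and order `μ`. -/
def gradSolid (n : ℕ) (μ : ℤ) (x : Space) : Fin 3 → ℂ :=
  regSolidPred n (μ - 1) x • vecXi + regSolidPred n μ x • vecZ - regSolidPred n (μ + 1) x • vecEta

theorem hasDerivAt_regSolid (n : ℕ) (μ : ℤ) (x : Space) (k : Fin 3) :
    HasDerivAt (fun t : ℝ => regSolid n μ (x + t • EuclideanSpace.single k 1))
      (gradSolid n μ x k) 0 := by
  have hc : ∀ i : Fin 3, HasDerivAt
      (fun t : ℝ => (((x + t • EuclideanSpace.single k (1 : ℝ) : Space) i : ℝ) : ℂ))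
      (if i = k then 1 else 0) 0 := by
    intro i
    have h : HasDerivAt (fun t : ℝ => (x + t • EuclideanSpace.single k (1 : ℝ) : Space) i)
        (if i = k then 1 else 0) 0 := by
      simp only [PiLp.add_apply, PiLp.smul_apply, PiLp.single_apply, smul_eq_mul]
      simpa using ((hasDerivAt_id (0 : ℝ)).mul_const (if i = k then (1 : ℝ) else 0)).const_add (x i)
    have := h.ofReal_comp
    refine this.congr_deriv ?_
    split_ifs <;> simp
  have h1 : HasDerivAt (fun t : ℝ => xiC (x + t • EuclideanSpace.single k 1)) (vecXi k) 0 := by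
    refine (((hc 0).add ((hc 1).const_mul Complex.I)).div_const 2).congr_deriv ?_
    fin_cases k <;> simp [vecXi]
  have h2 : HasDerivAt (fun t : ℝ => etaC (x + t • EuclideanSpace.single k 1)) (vecEta k) 0 := by
    refine (((hc 0).sub ((hc 1).const_mul Complex.I)).div_const 2).congr_deriv ?_
    fin_cases k <;> simp [vecEta]
  have h3 : HasDerivAt (fun t : ℝ => zC (x + t • EuclideanSpace.single k 1)) (vecZ k) 0 := by
    refine (hc 2).congr_deriv ?_
    fin_cases k <;> simp [vecZ]
  have := hasDerivAt_solid h1 h3 h2 n μ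
  refine this.congr_deriv ?_
  simp [gradSolid, regSolidPred, mul_comm]

theorem differentiable_regSolid (n : ℕ) (μ : ℤ) : Differentiable ℝ (regSolid n μ) := by
  intro x
  have hc : ∀ i : Fin 3, DifferentiableAt ℝ (fun y : Space => ((y i : ℝ) : ℂ)) x := by
    intro i
    exact Complex.ofRealCLM.differentiableAt.comp x
      (f := fun y : Space => y i) (by fun_prop)
  refine differentiableAt_solid ?_ ?_ ?_ n μ
  · unfold xiC; simp only [div_eq_mul_inv]
    exact ((hc 0).add ((hc 1).const_mul _)).mul_const _
  · exact hc 2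
  · unfold etaC; simp only [div_eq_mul_inv]
    exact ((hc 0).sub ((hc 1).const_mul _)).mul_const _

theorem norm_unitVec {x : Space} (hx : x ≠ 0) : ‖unitVec x‖ = 1 := by
  rw [unitVec, norm_smul, norm_inv, norm_norm, inv_mul_cancel₀ (norm_ne_zero_iff.2 hx)]

theorem sphHarm_unitVec (l : ℕ) (m : ℤ) {x : Space} (hx : x ≠ 0) :
    sphHarm l m (unitVec x) =
      (-1) ^ m * (harmNorm l m : ℂ) * (regSolid l m x * (((‖x‖ ^ l)⁻¹ : ℝ) : ℂ)) := by
  rw [sphHarm_eq l m _ (norm_unitVec hx), unitVec, regSolid_smul]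
  push_cast
  rw [inv_pow]
  ring

theorem differentiableAt_sphHarm (l : ℕ) (m : ℤ) {u : Space} (hu : ‖u‖ = 1) :
    DifferentiableAt ℝ (fun x => sphHarm l m (unitVec x)) u := by
  have h0 : u ≠ 0 := by rintro rfl; simp at hu
  have he : (fun x => sphHarm l m (unitVec x)) =ᶠ[nhds u] fun x =>
      (-1) ^ m * (harmNorm l m : ℂ) * (regSolid l m x * (((‖x‖ ^ l)⁻¹ : ℝ) : ℂ)) := by
    filter_upwards [isOpen_ne.mem_nhds h0] with x hx using sphHarm_unitVec l m hx
  refine DifferentiableAt.congr_of_eventuallyEq ?_ he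
  have h1 : DifferentiableAt ℝ (fun x : Space => (‖x‖ ^ l)⁻¹) u :=
    ((differentiableAt_id.norm ℝ h0).pow l).inv (pow_ne_zero _ (norm_ne_zero_iff.2 h0))
  exact (((differentiable_regSolid l m) u).mul
    (Complex.ofRealCLM.differentiableAt.comp u h1)).const_mul _

theorem hasDerivAt_norm_line {u : Space} (hu : ‖u‖ = 1) (k : Fin 3) :
    HasDerivAt (fun t : ℝ => ‖u + t • EuclideanSpace.single k (1 : ℝ)‖) (u k) 0 := by
  have h1 : HasDerivAt (fun t : ℝ => u + t • EuclideanSpace.single k (1 : ℝ))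
      (EuclideanSpace.single k (1 : ℝ)) 0 := by
    simpa using ((hasDerivAt_id (0 : ℝ)).smul_const (EuclideanSpace.single k (1 : ℝ))).const_add u
  have h2 := h1.norm_sq.sqrt (by simp [hu])
  simp only [Real.sqrt_sq (norm_nonneg _)] at h2
  refine h2.congr_deriv ?_
  simp [hu, EuclideanSpace.inner_single_right]

theorem surfGrad_sphHarm (l : ℕ) (m : ℤ) {u : Space} (hu : ‖u‖ = 1) :
    surfGrad (sphHarm l m) u = ((-1) ^ m * (harmNorm l m : ℂ)) •
      (gradSolid l m u - ((l : ℂ) * regSolid l m u) • toComplex u) := by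
  have h0 : u ≠ 0 := by rintro rfl; simp at hu
  ext k
  rw [surfGrad, ← (differentiableAt_sphHarm l m hu).lineDeriv_eq_fderiv]
  apply HasLineDerivAt.lineDeriv
  have hn := hasDerivAt_norm_line hu k
  have hc : ContinuousAt (fun t : ℝ => u + t • EuclideanSpace.single k (1 : ℝ)) 0 := by fun_prop
  have he : (fun t : ℝ => sphHarm l m (unitVec (u + t • EuclideanSpace.single k (1 : ℝ))))
      =ᶠ[nhds 0] fun t : ℝ => (-1) ^ m * (harmNorm l m : ℂ) *
        (regSolid l m (u + t • EuclideanSpace.single k (1 : ℝ)) *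
          (((‖u + t • EuclideanSpace.single k (1 : ℝ)‖ ^ l)⁻¹ : ℝ) : ℂ)) := by
    have : ∀ᶠ t : ℝ in nhds 0, u + t • EuclideanSpace.single k (1 : ℝ) ≠ 0 :=
      hc.eventually_ne (by simpa using h0)
    filter_upwards [this] with t ht using sphHarm_unitVec l m ht
  refine HasDerivAt.congr_of_eventuallyEq ?_ he
  have h1 := ((hn.pow l).inv (by simp [hu])).ofReal_comp
  have h2 := ((hasDerivAt_regSolid l m u k).mul h1).const_mul ((-1) ^ m * (harmNorm l m : ℂ))
  refine h2.congr_deriv ?_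
  simp only [zero_smul, add_zero, hu, toComplex, Pi.inv_apply, Pi.pow_apply, one_pow, inv_one,
    Complex.ofReal_one, Pi.smul_apply, Pi.sub_apply, smul_eq_mul]
  push_cast
  ring

/-- On the unit sphere `W_l^m` is the gradient of a regular solid harmonic. -/
theorem cW_eq (l : ℕ) (m : ℤ) {u : Space} (hu : ‖u‖ = 1) :
    cW l m u = ((-1) ^ m * (harmNorm l m : ℂ)) • gradSolid l m u := by
  rw [cW, vecW, surfGrad_sphHarm l m hu, sphHarm_eq l m u hu]
  module

theorem cV_eq (l : ℕ) (m : ℤ) {u : Space} (hu : ‖u‖ = 1) :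
    cV l m u = ((-1) ^ m * (harmNorm l m : ℂ)) •
      (gradSolid l m u - ((2 * (l : ℂ) + 1) * regSolid l m u) • toComplex u) := by
  rw [cV, vecV, surfGrad_sphHarm l m hu, sphHarm_eq l m u hu]
  module

theorem cX_eq (l : ℕ) (m : ℤ) {u : Space} (hu : ‖u‖ = 1) :
    cX l m u = ((-1) ^ m * (harmNorm l m : ℂ)) •
      crossProduct (toComplex u) (gradSolid l m u) := by
  rw [cX, vecX, surfGrad_sphHarm l m hu]
  simp

/-- An operator `T` that is complex linear on the functions whose extension constant along rays is
differentiable, as the operators that define the vector harmonics `V`, `W` and `X` are. -/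
def IsSurfLinear (T : (Space → ℂ) → Space → Fin 3 → ℂ) : Prop :=
  ∀ (f g : Space → ℂ) (α β : ℂ) (u : Space),
    DifferentiableAt ℝ (fun x => f (unitVec x)) u →
    DifferentiableAt ℝ (fun x => g (unitVec x)) u →
    T (fun x => α * f x + β * g x) u = α • T f u + β • T g u

theorem isSurfLinear_surfGrad : IsSurfLinear surfGrad := by
  intro f g α β u hf hg
  ext k
  have := ((hf.hasFDerivAt.const_mul α).add (hg.hasFDerivAt.const_mul β)).fderiv
  change fderiv ℝ ((fun y => α * f (unitVec y)) + fun y => β * g (unitVec y)) u _ = _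
  rw [this]
  simp [surfGrad]

theorem isSurfLinear_vecV (l : ℕ) : IsSurfLinear (vecV l) := by
  intro f g α β u hf hg
  rw [vecV, isSurfLinear_surfGrad f g α β u hf hg, vecV, vecV]
  module

theorem isSurfLinear_vecW (l : ℕ) : IsSurfLinear (vecW l) := by
  intro f g α β u hf hg
  rw [vecW, isSurfLinear_surfGrad f g α β u hf hg, vecW, vecW]
  module

theorem isSurfLinear_vecX : IsSurfLinear vecX := by
  intro f g α β u hf hg
  rw [vecX, isSurfLinear_surfGrad f g α β u hf hg, vecX, vecX]
  simp

section
variable {T : (Space → ℂ) → Space → Fin 3 → ℂ} (l : ℕ) {m : ℤ} {u : Space}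

theorem IsSurfLinear.realSphHarm_pos (hT : IsSurfLinear T) (hu : ‖u‖ = 1) (hm : 0 < m) :
    T (realSphHarm l m) u = (1 / ((Real.sqrt 2 : ℝ) : ℂ)) •
      (T (sphHarm l (-m)) u + (-1 : ℂ) ^ m • T (sphHarm l m) u) := by
  have : realSphHarm l m = fun x => (1 / ((Real.sqrt 2 : ℝ) : ℂ)) * sphHarm l (-m) x +
      (1 / ((Real.sqrt 2 : ℝ) : ℂ) * (-1) ^ m) * sphHarm l m x := by
    ext x; rw [realSphHarm, if_pos hm]; ring
  rw [this, hT _ _ _ _ _ (differentiableAt_sphHarm l _ hu) (differentiableAt_sphHarm l _ hu)]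
  module

theorem IsSurfLinear.realSphHarm_neg (hT : IsSurfLinear T) (hu : ‖u‖ = 1) (hm : m < 0) :
    T (realSphHarm l m) u = (Complex.I / ((Real.sqrt 2 : ℝ) : ℂ)) •
      (T (sphHarm l m) u - (-1 : ℂ) ^ m • T (sphHarm l (-m)) u) := by
  have : realSphHarm l m = fun x => (Complex.I / ((Real.sqrt 2 : ℝ) : ℂ)) * sphHarm l m x +
      (-(Complex.I / ((Real.sqrt 2 : ℝ) : ℂ)) * (-1) ^ m) * sphHarm l (-m) x := by
    ext x; rw [realSphHarm, if_neg hm.le.not_gt, if_neg hm.ne]; ring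
  rw [this, hT _ _ _ _ _ (differentiableAt_sphHarm l _ hu) (differentiableAt_sphHarm l _ hu)]
  module

theorem realSphHarm_zero : realSphHarm l 0 = sphHarm l 0 := by
  ext x; simp [realSphHarm]

theorem IsSurfLinear.eq_fromReal (hT : IsSurfLinear T) (hu : ‖u‖ = 1) (m : ℤ) :
    T (sphHarm l m) u = fromReal (fun m' => T (realSphHarm l m') u) m := by
  have h2 : ((Real.sqrt 2 : ℝ) : ℂ) * ((Real.sqrt 2 : ℝ) : ℂ) = 2 := by
    norm_cast; norm_num
  have h2' : ((Real.sqrt 2 : ℝ) : ℂ) ≠ 0 := by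
    intro h; rw [h] at h2; norm_num at h2
  have hs : (-1 : ℂ) ^ m * (-1) ^ m = 1 := by
    rw [← mul_zpow]; simp
  have hi : (-1 : ℂ) ^ (-m) = (-1) ^ m := by
    rw [zpow_neg]; exact inv_eq_of_mul_eq_one_left hs
  rcases lt_trichotomy m 0 with hm | rfl | hm
  · rw [fromReal, if_neg hm.le.not_gt, if_neg hm.ne]
    rw [hT.realSphHarm_pos l hu (neg_pos.2 hm), hT.realSphHarm_neg l hu hm, neg_neg, hi]
    ext k
    simp
    field_simp
    rw [Complex.I_sq, pow_two, h2]
    ring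
  · simp [fromReal, realSphHarm_zero]
  · rw [fromReal, if_pos hm]
    rw [hT.realSphHarm_pos l hu hm, hT.realSphHarm_neg l hu (neg_lt_zero.2 hm), neg_neg, hi]
    ext k
    simp
    field_simp
    rw [Complex.I_sq, pow_two, h2]
    linear_combination (-2 * T (sphHarm l m) u k) * hs

end

/-! ### Translation of irregular solid harmonics -/

theorem sum_Icc_shift {M : Type*} [AddCommMonoid M] (n : ℕ) (d : ℤ) (hd : |d| ≤ 1) (G : ℤ → M)
    (hG : ∀ μ : ℤ, (n : ℤ) < |μ| → G μ = 0) :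
    ∑ μ ∈ Finset.Icc (-((n + 1 : ℕ) : ℤ)) ((n + 1 : ℕ) : ℤ), G (μ + d) =
      ∑ μ ∈ Finset.Icc (-(n : ℤ)) n, G μ := by
  rw [abs_le] at hd
  symm
  refine Finset.sum_of_injOn (fun μ => μ - d) (fun _ _ _ _ h => by simpa using h) ?_ ?_ ?_
  · intro μ hμ
    simp only [Finset.coe_Icc, Set.mem_Icc] at *
    push_cast
    omega
  · intro μ _ hμ
    apply hG
    by_contra hc
    rw [not_lt, abs_le] at hc
    exact hμ ⟨μ + d, by simpa using hc, by simp⟩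
  · intro μ _; simp

/-- Summation by parts: a combination of neighbouring orders is moved from the regular solid
harmonics to the coefficients. -/
theorem sum_solid_shift (ξ z η : ℂ) (n : ℕ) (F : ℤ → ℂ) (x y w : ℂ) :
    ∑ μ ∈ Finset.Icc (-((n + 1 : ℕ) : ℤ)) ((n + 1 : ℕ) : ℤ), (-1) ^ (((n + 1 : ℕ) : ℤ) + μ) * F μ *
      (x * solid ξ z η n (μ - 1) + y * solid ξ z η n μ - w * solid ξ z η n (μ + 1)) =
    ∑ μ ∈ Finset.Icc (-(n : ℤ)) n, (-1) ^ ((n : ℤ) + μ) * solid ξ z η n μ *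
      (x * F (μ + 1) - y * F μ - w * F (μ - 1)) := by
  have hne : (-1 : ℂ) ≠ 0 := by norm_num
  have h1 := sum_Icc_shift (M := ℂ) n (-1) (by norm_num)
    (fun μ => (-1) ^ ((n : ℤ) + μ) * solid ξ z η n μ * (x * F (μ + 1)))
    (fun μ hμ => by rw [solid_eq_zero _ _ _ hμ]; simp)
  have h2 := sum_Icc_shift (M := ℂ) n 0 (by norm_num)
    (fun μ => (-1) ^ ((n : ℤ) + μ) * solid ξ z η n μ * (y * F μ))
    (fun μ hμ => by rw [solid_eq_zero _ _ _ hμ]; simp)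
  have h3 := sum_Icc_shift (M := ℂ) n 1 (by norm_num)
    (fun μ => (-1) ^ ((n : ℤ) + μ) * solid ξ z η n μ * (w * F (μ - 1)))
    (fun μ hμ => by rw [solid_eq_zero _ _ _ hμ]; simp)
  have hR : ∑ μ ∈ Finset.Icc (-(n : ℤ)) n, (-1) ^ ((n : ℤ) + μ) * solid ξ z η n μ *
      (x * F (μ + 1) - y * F μ - w * F (μ - 1)) =
      ∑ μ ∈ Finset.Icc (-(n : ℤ)) n, (-1) ^ ((n : ℤ) + μ) * solid ξ z η n μ * (x * F (μ + 1)) -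
      ∑ μ ∈ Finset.Icc (-(n : ℤ)) n, (-1) ^ ((n : ℤ) + μ) * solid ξ z η n μ * (y * F μ) -
      ∑ μ ∈ Finset.Icc (-(n : ℤ)) n, (-1) ^ ((n : ℤ) + μ) * solid ξ z η n μ * (w * F (μ - 1)) := by
    rw [← Finset.sum_sub_distrib, ← Finset.sum_sub_distrib]
    exact Finset.sum_congr rfl fun μ _ => by ring
  rw [hR, ← h1, ← h2, ← h3, ← Finset.sum_sub_distrib, ← Finset.sum_sub_distrib]
  refine Finset.sum_congr rfl fun μ _ => ?_
  simp only [add_zero, add_sub_cancel_right, ← sub_eq_add_neg]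
  have e1 : (-1 : ℂ) ^ (((n + 1 : ℕ) : ℤ) + μ) = - (-1) ^ ((n : ℤ) + μ) := by
    push_cast
    rw [show (n : ℤ) + 1 + μ = n + μ + 1 by ring, zpow_add_one₀ hne]; ring
  have e2 : (-1 : ℂ) ^ ((n : ℤ) + (μ - 1)) = - (-1) ^ ((n : ℤ) + μ) := by
    rw [← add_sub_assoc, zpow_sub_one₀ hne]; ring
  have e3 : (-1 : ℂ) ^ ((n : ℤ) + (μ + 1)) = - (-1) ^ ((n : ℤ) + μ) := by
    rw [← add_assoc, zpow_add_one₀ hne]; ring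
  rw [e1, e2, e3]
  ring_nf

/-- The irregular solid harmonic of degree `l` and order `m` at the complex point `(ξ, z, η)`. The
value `ρ` of the radius is an argument of its own, since over `ℂ` it has to be chosen as a square
root of `z ^ 2 + 4 ξ η`. The factorials make the coefficients of the derivatives `±1`. -/
def irregC (ξ z η ρ : ℂ) (l : ℕ) (m : ℤ) : ℂ :=
  ((factZ (l - m) * factZ (l + m) : ℝ) : ℂ) * solid ξ z η l m / ρ ^ (2 * l + 1)

theorem factZ_succ {n : ℤ} (hn : 0 ≤ n) : factZ (n + 1) = (n + 1) * factZ n := by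
  lift n to ℕ using hn
  have : ((n : ℤ) + 1).toNat = n + 1 := by omega
  rw [factZ, factZ, this, Nat.factorial_succ]
  simp

theorem factZ_pos (n : ℤ) : 0 < factZ n := by
  rw [factZ]; exact_mod_cast Nat.factorial_pos _

/-- The irregular solid harmonics of degree `l + 1` in terms of the regular ones of degrees `l` and
`l - 1`, in the form in which they occur in the derivative of the irregular one of degree `l`. -/
theorem irregC_succ {ξ z η ρ : ℂ} (h0 : ρ ≠ 0) (hsq : ρ ^ 2 = z ^ 2 + 4 * ξ * η)
    {l : ℕ} {m : ℤ} (hm : |m| ≤ l) :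
    irregC ξ z η ρ (l + 1) (m - 1) =
      ((factZ (l - m) * factZ (l + m) : ℝ) : ℂ) / ρ ^ (2 * l + 3) *
        (ρ ^ 2 * solidPred ξ z η l (m - 1) - (2 * (l : ℂ) + 1) * (2 * η * solid ξ z η l m)) ∧
    irregC ξ z η ρ (l + 1) m =
      ((factZ (l - m) * factZ (l + m) : ℝ) : ℂ) / ρ ^ (2 * l + 3) *
        ((2 * (l : ℂ) + 1) * (z * solid ξ z η l m) - ρ ^ 2 * solidPred ξ z η l m) ∧
    irregC ξ z η ρ (l + 1) (m + 1) =
      ((factZ (l - m) * factZ (l + m) : ℝ) : ℂ) / ρ ^ (2 * l + 3) *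
        (ρ ^ 2 * solidPred ξ z η l (m + 1) + (2 * (l : ℂ) + 1) * (2 * ξ * solid ξ z η l m)) := by
  rw [abs_le] at hm
  have f1 : factZ ((l + 1 : ℕ) - (m - 1)) = (l - m + 2) * ((l - m + 1) * factZ (l - m)) := by
    have := factZ_succ (n := l - m) (by omega)
    have h2 := factZ_succ (n := l - m + 1) (by omega)
    rw [show ((l + 1 : ℕ) : ℤ) - (m - 1) = l - m + 1 + 1 by push_cast; ring, h2, this]
    push_cast; ring
  have f2 : factZ ((l + 1 : ℕ) + (m - 1)) = factZ (l + m) := by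
    congr 1; push_cast; ring
  have f3 : factZ ((l + 1 : ℕ) - m) = (l - m + 1) * factZ (l - m) := by
    have := factZ_succ (n := l - m) (by omega)
    rw [show ((l + 1 : ℕ) : ℤ) - m = l - m + 1 by push_cast; ring, this]
    push_cast; ring
  have f4 : factZ ((l + 1 : ℕ) + m) = (l + m + 1) * factZ (l + m) := by
    have := factZ_succ (n := l + m) (by omega)
    rw [show ((l + 1 : ℕ) : ℤ) + m = l + m + 1 by push_cast; ring, this]
    push_cast; ring
  have f5 : factZ ((l + 1 : ℕ) - (m + 1)) = factZ (l - m) := by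
    congr 1; push_cast; ring
  have f6 : factZ ((l + 1 : ℕ) + (m + 1)) = (l + m + 2) * ((l + m + 1) * factZ (l + m)) := by
    have := factZ_succ (n := l + m) (by omega)
    have h2 := factZ_succ (n := l + m + 1) (by omega)
    rw [show ((l + 1 : ℕ) : ℤ) + (m + 1) = l + m + 1 + 1 by push_cast; ring, h2, this]
    push_cast; ring
  rw [z_mul_solid, xi_mul_solid, eta_mul_solid, ← hsq]
  simp only [irregC]
  rw [f1, f2, f3, f4, f5, f6, show 2 * (l + 1) + 1 = 2 * l + 3 by ring]
  push_cast
  have hp : ρ ^ (2 * l + 3) ≠ 0 := pow_ne_zero _ h0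
  refine ⟨?_, ?_, ?_⟩ <;> field_simp <;> ring

/-- The partial derivatives of the irregular solid harmonic of degree `l` and order `m` are those of
degree `l + 1` and orders `m - 1`, `m` and `m + 1`, up to sign. -/
theorem hasDerivAt_irregC {ξ z η ρ : ℂ → ℂ} {ξ' z' η' : ℂ} {t : ℂ} (hξ : HasDerivAt ξ ξ' t)
    (hz : HasDerivAt z z' t) (hη : HasDerivAt η η' t) (hρ : DifferentiableAt ℂ ρ t)
    (h0 : ρ t ≠ 0) (hsq : ∀ᶠ s in nhds t, ρ s ^ 2 = z s ^ 2 + 4 * ξ s * η s)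
    {l : ℕ} {m : ℤ} (hm : |m| ≤ l) :
    HasDerivAt (fun s => irregC (ξ s) (z s) (η s) (ρ s) l m)
      (ξ' * irregC (ξ t) (z t) (η t) (ρ t) (l + 1) (m - 1) -
        z' * irregC (ξ t) (z t) (η t) (ρ t) (l + 1) m -
        η' * irregC (ξ t) (z t) (η t) (ρ t) (l + 1) (m + 1)) t := by
  have hρ' := hρ.hasDerivAt
  set ρ' := deriv ρ t
  have e1 : ρ t * ρ' = z t * z' + 2 * (ξ' * η t + ξ t * η') := by
    have a := (hρ'.pow 2).congr_of_eventuallyEq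
      (f₁ := fun s => z s ^ 2 + 4 * ξ s * η s) (hsq.mono fun s hs => by simp [hs])
    have b := ((hz.pow 2).add ((hξ.const_mul 4).mul hη))
    have := a.unique b
    simp at this
    linear_combination this / 2
  have e0 := hsq.self_of_nhds
  have h := ((hasDerivAt_solid hξ hz hη l m).const_mul
    (((factZ (l - m) * factZ (l + m) : ℝ) : ℂ))).div (hρ'.pow (2 * l + 1)) (pow_ne_zero _ h0)
  refine h.congr_deriv ?_
  obtain ⟨l1, l2, l3⟩ := irregC_succ h0 e0 hm
  rw [l1, l2, l3]
  simp only [Pi.pow_apply]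
  rw [show 2 * l + 1 - 1 = 2 * l by omega]
  generalize ((factZ (l - m) * factZ (l + m) : ℝ) : ℂ) = F
  generalize ρ t = R at *
  push_cast
  have hp : R ^ l ≠ 0 := pow_ne_zero _ h0
  rw [show R ^ (2 * l + 1) = (R ^ l) ^ 2 * R by ring, show R ^ (2 * l) = (R ^ l) ^ 2 by ring,
    show R ^ (2 * l + 3) = (R ^ l) ^ 2 * R ^ 3 by ring]
  generalize R ^ l = P at *
  field_simp
  linear_combination (-(2 * (l : ℂ) + 1) * F * solid (ξ t) (z t) (η t) l m) * e1

/-- The distance `|a + t r|` extends holomorphically, without zeros, to complex `t` in a disc of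
radius greater than `1`. Indeed the quadratic polynomial `|a + t r| ^ 2` is
`|a| ^ 2 (1 + p t) (1 + q t)` with `q` conjugate to `p` and `|p| = |r| / |a| < 1`. -/
theorem exists_sqrt_quadratic (a r : Space) (h : ‖r‖ < ‖a‖) :
    ∃ (R : ℝ) (ρ : ℂ → ℂ), 1 < R ∧ ρ 0 = (‖a‖ : ℝ) ∧ ρ 1 = (‖r + a‖ : ℝ) ∧
      ∀ t ∈ Metric.ball (0 : ℂ) R, DifferentiableAt ℂ ρ t ∧ ρ t ≠ 0 ∧
        ρ t ^ 2 = (zC a + t * zC r) ^ 2 +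
          4 * (xiC a + t * xiC r) * (etaC a + t * etaC r) := by
  have ha : 0 < ‖a‖ := (norm_nonneg r).trans_lt h
  set k := ‖r‖ / ‖a‖ with hk
  have hk0 : 0 ≤ k := by positivity
  have hk1 : k < 1 := by rw [hk, div_lt_one ha]; exact h
  set c := inner ℝ a r / ‖a‖ ^ 2 with hc
  have hck : c ^ 2 ≤ k ^ 2 := by
    rw [sq_le_sq, hc, hk, abs_div, abs_of_pos (by positivity : 0 < ‖a‖ ^ 2),
      abs_of_nonneg (by positivity : 0 ≤ ‖r‖ / ‖a‖), div_le_div_iff₀ (by positivity) ha]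
    have := abs_real_inner_le_norm a r
    nlinarith [mul_le_mul_of_nonneg_right this ha.le]
  set p : ℂ := ⟨c, Real.sqrt (k ^ 2 - c ^ 2)⟩ with hp
  have hpn : p.re ^ 2 + p.im ^ 2 = k ^ 2 := by
    simp only [hp]; rw [Real.sq_sqrt (by linarith)]; ring
  have hpk : ‖p‖ = k := by
    rw [← Real.sqrt_sq hk0, ← hpn, Complex.norm_def, Complex.normSq_apply]
    congr 1; ring
  have hsum : p + (starRingEnd ℂ) p = 2 * (c : ℂ) := by
    rw [Complex.add_conj]
    simp [hp]
  have hprod : p * (starRingEnd ℂ) p = (k : ℂ) ^ 2 := by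
    rw [Complex.mul_conj, Complex.normSq_apply]
    norm_cast
    rw [← hpn]; ring
  have hQ : ∀ t : ℂ, (zC a + t * zC r) ^ 2 + 4 * (xiC a + t * xiC r) * (etaC a + t * etaC r) =
      (‖a‖ : ℂ) ^ 2 * ((1 + p * t) * (1 + (starRingEnd ℂ) p * t)) := by
    intro t
    have h1 := zC_sq_add a
    have h2 := zC_sq_add r
    have h3 := two_mul_inner a r
    have h4 : ((inner ℝ a r : ℝ) : ℂ) = (‖a‖ : ℂ) ^ 2 * (c : ℂ) := by
      norm_cast; rw [hc]; field_simp
    have h5 : ((‖r‖ : ℝ) : ℂ) ^ 2 = (‖a‖ : ℂ) ^ 2 * (k : ℂ) ^ 2 := by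
      norm_cast; rw [hk]; field_simp
    rw [h5] at h2
    rw [h4] at h3
    linear_combination h1 + t ^ 2 * h2 + t * h3 - (‖a‖ : ℂ) ^ 2 * t * hsum -
      (‖a‖ : ℂ) ^ 2 * t ^ 2 * hprod
  have hslit : ∀ q : ℂ, ‖q‖ = k → ∀ t ∈ Metric.ball (0 : ℂ) (2 / (1 + k)),
      1 + q * t ∈ Complex.slitPlane := by
    intro q hq t ht
    apply Complex.mem_slitPlane_of_norm_lt_one
    rw [mem_ball_zero_iff, lt_div_iff₀ (by positivity)] at ht
    rw [norm_mul, hq]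
    nlinarith [norm_nonneg t]
  set ρ : ℂ → ℂ := fun t => (‖a‖ : ℂ) *
    Complex.exp ((Complex.log (1 + p * t) + Complex.log (1 + (starRingEnd ℂ) p * t)) / 2) with hρ
  have hpk' : ‖(starRingEnd ℂ) p‖ = k := by rw [RCLike.norm_conj, hpk]
  have hsq : ∀ t ∈ Metric.ball (0 : ℂ) (2 / (1 + k)), ρ t ^ 2 =
      (‖a‖ : ℂ) ^ 2 * ((1 + p * t) * (1 + (starRingEnd ℂ) p * t)) := by
    intro t ht
    simp only [hρ]
    rw [mul_pow, ← Complex.exp_nat_mul, Nat.cast_two, mul_div_cancel₀ _ two_ne_zero,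
        Complex.exp_add,
      Complex.exp_log (Complex.slitPlane_ne_zero (hslit p hpk t ht)),
      Complex.exp_log (Complex.slitPlane_ne_zero (hslit _ hpk' t ht))]
  have hR : 1 < 2 / (1 + k) := by rw [lt_div_iff₀ (by positivity)]; linarith
  have h1mem : (1 : ℂ) ∈ Metric.ball (0 : ℂ) (2 / (1 + k)) := by simpa using hR
  refine ⟨2 / (1 + k), ρ, hR, by simp [hρ], ?_, fun t ht => ⟨?_, ?_, ?_⟩⟩
  -- at `t = 1` the two logarithms are conjugate, so that the root is positive
  · have hlog : Complex.log (1 + (starRingEnd ℂ) p * 1) =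
        (starRingEnd ℂ) (Complex.log (1 + p * 1)) := by
      rw [← Complex.log_conj _ (Complex.slitPlane_arg_ne_pi (hslit p hpk 1 h1mem))]; simp
    have hr1 : ρ 1 = ((‖a‖ * Real.exp (Complex.log (1 + p * 1)).re : ℝ) : ℂ) := by
      simp only [hρ]
      rw [hlog, Complex.add_conj]
      push_cast
      rw [mul_div_cancel_left₀ _ two_ne_zero]
    have hs := hsq 1 h1mem
    rw [← hQ, hr1] at hs
    have hadd := zC_sq_add (r + a)
    have e1 : zC (r + a) = zC a + 1 * zC r := by simp [zC]; ring
    have e2 : xiC (r + a) = xiC a + 1 * xiC r := by simp [xiC]; ring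
    have e3 : etaC (r + a) = etaC a + 1 * etaC r := by simp [etaC]; ring
    rw [e1, e2, e3, ← hs] at hadd
    rw [hr1]
    norm_cast at hadd ⊢
    exact (pow_left_inj₀ (by positivity) (norm_nonneg _) two_ne_zero).1 hadd
  · simp only [hρ]
    have d1 := hslit p hpk t ht
    have d2 := hslit _ hpk' t ht
    fun_prop (disch := assumption)
  · simp [hρ, ha.ne']
  · rw [hsq t ht, hQ]

/-- The irregular solid harmonic of degree `l` and order `m` on space. -/
def irregM (l : ℕ) (m : ℤ) (x : Space) : ℂ := irregC (xiC x) (zC x) (etaC x) (‖x‖ : ℝ) l m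

/-- The translation formula for the irregular solid harmonics: the Taylor series at `t = 0` of the
harmonic along `t ↦ a + t r`, evaluated at `t = 1`. -/
theorem hasSum_irregM (r a : Space) (h : ‖r‖ < ‖a‖) {l : ℕ} {m : ℤ} (hm : |m| ≤ l) :
    HasSum (fun n : ℕ => ∑ μ ∈ Finset.Icc (-(n : ℤ)) n,
      (-1) ^ ((n : ℤ) + μ) * regSolid n μ r * irregM (l + n) (m - μ) a)
      (irregM l m (r + a)) := by
  obtain ⟨R, ρ, hR, hρ0, hρ1, hρ⟩ := exists_sqrt_quadratic a r h
  set g : ℕ → ℤ → ℂ → ℂ := fun l m t =>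
    irregC (xiC a + t * xiC r) (zC a + t * zC r) (etaC a + t * etaC r) (ρ t) l m with hg
  have hd : ∀ (l : ℕ) (m : ℤ), |m| ≤ l → ∀ t ∈ Metric.ball (0 : ℂ) R, HasDerivAt (g l m)
      (xiC r * g (l + 1) (m - 1) t - zC r * g (l + 1) m t - etaC r * g (l + 1) (m + 1) t) t := by
    intro l m hm t ht
    have hl : ∀ u v : ℂ, HasDerivAt (fun t : ℂ => u + t * v) v t := fun u v => by
      simpa using ((hasDerivAt_id t).mul_const v).const_add u
    exact hasDerivAt_irregC (hl _ _) (hl _ _) (hl _ _) (hρ t ht).1 (hρ t ht).2.1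
      (Filter.eventually_of_mem (Metric.isOpen_ball.mem_nhds ht) fun s hs => (hρ s hs).2.2) hm
  -- the derivatives of all orders along the line, again by summation by parts
  have hit : ∀ n : ℕ, ∀ t ∈ Metric.ball (0 : ℂ) R, iteratedDeriv n (g l m) t =
      n.factorial * ∑ μ ∈ Finset.Icc (-(n : ℤ)) n,
        (-1) ^ ((n : ℤ) + μ) * regSolid n μ r * g (l + n) (m - μ) t := by
    intro n
    induction n with
    | zero => intro t ht; simp [regSolid, solid]
    | succ n ih =>
      intro t ht
      have he : iteratedDeriv n (g l m) =ᶠ[nhds t] fun t => n.factorial *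
          ∑ μ ∈ Finset.Icc (-(n : ℤ)) n,
            (-1) ^ ((n : ℤ) + μ) * regSolid n μ r * g (l + n) (m - μ) t :=
        Filter.eventually_of_mem (Metric.isOpen_ball.mem_nhds ht) ih
      rw [iteratedDeriv_succ, he.deriv_eq]
      have hs : HasDerivAt (fun t => (n.factorial : ℂ) * ∑ μ ∈ Finset.Icc (-(n : ℤ)) n,
          (-1) ^ ((n : ℤ) + μ) * regSolid n μ r * g (l + n) (m - μ) t)
          ((n.factorial : ℂ) * ∑ μ ∈ Finset.Icc (-(n : ℤ)) n,
          (-1) ^ ((n : ℤ) + μ) * regSolid n μ r * (xiC r * g (l + n + 1) (m - μ - 1) t -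
            zC r * g (l + n + 1) (m - μ) t - etaC r * g (l + n + 1) (m - μ + 1) t)) t := by
        refine HasDerivAt.const_mul _ (HasDerivAt.fun_sum fun μ hμ => ?_)
        refine (hd (l + n) (m - μ) ?_ t ht).const_mul _
        rw [Finset.mem_Icc] at hμ
        rw [abs_le] at *
        push_cast
        omega
      rw [hs.deriv]
      have hsh := sum_solid_shift (xiC r) (zC r) (etaC r) n (fun μ => g (l + n + 1) (m - μ) t)
        (xiC r) (zC r) (etaC r)
      simp only [sub_add_eq_sub_sub, ← sub_add] at hsh
      simp only [regSolid]
      rw [← hsh, Nat.factorial_succ]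
      push_cast
      rw [mul_comm ((n : ℂ) + 1), mul_assoc, Finset.mul_sum (a := (n : ℂ) + 1)]
      congr 1
      refine Finset.sum_congr rfl fun μ _ => ?_
      rw [← succ_mul_solid, ← add_assoc]
      ring
  have hdiff : DifferentiableOn ℂ (g l m) (Metric.ball 0 R) := fun t ht =>
    (hd l m hm t ht).differentiableAt.differentiableWithinAt
  have hs := Complex.hasSum_taylorSeries_on_ball hdiff (z := 1) (by simpa using hR)
  have e1 : g l m 1 = irregM l m (r + a) := by
    simp only [hg, irregM, hρ1]
    congr 1 <;> simp [xiC, zC, etaC] <;> ring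
  rw [e1] at hs
  have e0 : ∀ (l : ℕ) (m : ℤ), g l m 0 = irregM l m a := by
    intro l m
    simp [hg, irregM, hρ0]
  have he : (fun n : ℕ => ∑ μ ∈ Finset.Icc (-(n : ℤ)) n,
      (-1) ^ ((n : ℤ) + μ) * regSolid n μ r * irregM (l + n) (m - μ) a) =
      fun n : ℕ => (n.factorial : ℂ)⁻¹ • (1 - 0 : ℂ) ^ n • iteratedDeriv n (g l m) 0 := by
    funext n
    rw [hit n 0 (by simpa using one_pos.trans hR), sub_zero, one_pow, one_smul, smul_eq_mul,
      inv_mul_cancel_left₀ (by exact_mod_cast n.factorial_ne_zero)]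
    simp only [e0]
  rw [he]
  exact hs

/-- The gradient of the irregular solid harmonic of degree `l` and order `m`. -/
def gradIrreg (l : ℕ) (m : ℤ) (x : Space) : Fin 3 → ℂ :=
  irregM (l + 1) (m - 1) x • vecXi - irregM (l + 1) m x • vecZ - irregM (l + 1) (m + 1) x • vecEta

/-- The translation formula for the gradients: applied to the irregular harmonics of
degree `l + 1` that make up `gradIrreg`, `hasSum_irregM` gives regular harmonics of degree `n`, and
summation by parts collects them into `gradSolid` of degree `n + 1`. -/
theorem hasSum_gradIrreg (r a : Space) (h : ‖r‖ < ‖a‖) {l : ℕ} {m : ℤ} (hm : |m| ≤ l) :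
    HasSum (fun n : ℕ => ∑ μ ∈ Finset.Icc (-((n + 1 : ℕ) : ℤ)) ((n + 1 : ℕ) : ℤ),
      ((-1) ^ (((n + 1 : ℕ) : ℤ) + μ) * irregM (l + (n + 1)) (m - μ) a) • gradSolid (n + 1) μ r)
      (gradIrreg l m (r + a)) := by
  rw [abs_le] at hm
  have h1 := hasSum_irregM r a h (l := l + 1) (m := m - 1) (by rw [abs_le]; push_cast; omega)
  have h2 := hasSum_irregM r a h (l := l + 1) (m := m) (by rw [abs_le]; push_cast; omega)
  have h3 := hasSum_irregM r a h (l := l + 1) (m := m + 1) (by rw [abs_le]; push_cast; omega)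
  rw [Pi.hasSum]
  intro k
  have h4 := ((h1.mul_right (vecXi k)).sub (h2.mul_right (vecZ k))).sub (h3.mul_right (vecEta k))
  have he : (fun n : ℕ => (∑ μ ∈ Finset.Icc (-((n + 1 : ℕ) : ℤ)) ((n + 1 : ℕ) : ℤ),
      ((-1) ^ (((n + 1 : ℕ) : ℤ) + μ) * irregM (l + (n + 1)) (m - μ) a) • gradSolid (n +
          1) μ r) k) =
      fun n : ℕ => (∑ μ ∈ Finset.Icc (-(n : ℤ)) n,
        (-1) ^ ((n : ℤ) + μ) * regSolid n μ r * irregM (l + 1 + n) (m - 1 - μ) a) * vecXi k -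
      (∑ μ ∈ Finset.Icc (-(n : ℤ)) n,
        (-1) ^ ((n : ℤ) + μ) * regSolid n μ r * irregM (l + 1 + n) (m - μ) a) * vecZ k -
      (∑ μ ∈ Finset.Icc (-(n : ℤ)) n,
        (-1) ^ ((n : ℤ) + μ) * regSolid n μ r * irregM (l + 1 + n) (m + 1 - μ) a) * vecEta k := by
    funext n
    have hsh := sum_solid_shift (xiC r) (zC r) (etaC r) n
      (fun μ => irregM (l + (n + 1)) (m - μ) a) (vecXi k) (vecZ k) (vecEta k)
    rw [Finset.sum_mul, Finset.sum_mul, Finset.sum_mul, ← Finset.sum_sub_distrib,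
      ← Finset.sum_sub_distrib, Finset.sum_apply]
    refine Eq.trans (Finset.sum_congr rfl fun μ _ => ?_) (hsh.trans
      (Finset.sum_congr rfl fun μ _ => ?_))
    · simp only [gradSolid, regSolidPred, solidPred, Pi.smul_apply, Pi.sub_apply, Pi.add_apply,
        smul_eq_mul]
      ring
    · rw [show l + 1 + n = l + (n + 1) by ring, show m - (μ + 1) = m - 1 - μ by ring,
        show m - (μ - 1) = m + 1 - μ by ring, regSolid]
      ring
  rw [he]
  exact h4

/-! ### The coefficients `H` and the harmonic `V` as a gradient -/

/-- The factor with `Y_l^m(x̂) / |x| ^ (l + 1) = kappa l m * irregM l m x`. -/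
def kappa (l : ℕ) (m : ℤ) : ℂ :=
  (-1) ^ m * (harmNorm l m : ℂ) / ((factZ (l - m) * factZ (l + m) : ℝ) : ℂ)

theorem choose_toNat {b c : ℤ} (hb : 0 ≤ b) (hc : 0 ≤ c) :
    (((b + c).toNat.choose b.toNat : ℕ) : ℝ) = factZ (b + c) / (factZ b * factZ c) := by
  lift b to ℕ using hb
  lift c to ℕ using hc
  have : ((b : ℤ) + c).toNat = b + c := by omega
  simp only [factZ, this, Int.toNat_natCast]
  have h := Nat.add_choose_mul_factorial_mul_factorial b c
  have hb := b.factorial_pos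
  have hc := c.factorial_pos
  rw [eq_div_iff (by positivity), ← h, Nat.choose_symm_add]
  push_cast
  ring

theorem irregSolid_eq (l : ℕ) (m : ℤ) {x : Space} (hx : x ≠ 0) :
    irregSolid l m x = (-1) ^ m *
      ((Real.sqrt (factZ (l - m) * factZ (l + m)) / (factZ (l - m) * factZ (l + m)) : ℝ) : ℂ) *
        irregM l m x := by
  have hF : 0 < factZ (l - m) * factZ (l + m) := mul_pos (factZ_pos _) (factZ_pos _)
  rw [irregSolid, sphHarm_unitVec l m hx, irregM, irregC]
  have h1 : Real.sqrt (4 * Real.pi / (2 * l + 1)) * harmNorm l m =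
      Real.sqrt (factZ (l - m) * factZ (l + m)) := by
    rw [harmNorm, ← Real.sqrt_mul (by positivity)]
    congr 1
    have := Real.pi_pos
    field_simp
  rw [← h1]
  have hn : ((‖x‖ : ℝ) : ℂ) ≠ 0 := by exact_mod_cast norm_ne_zero_iff.2 hx
  generalize factZ (l - m) * factZ (l + m) = F at *
  have hF' : (F : ℂ) ≠ 0 := by exact_mod_cast hF.ne'
  rw [regSolid]
  push_cast
  field_simp
  ring

/-- The binomial coefficients and square roots of `H_{l,λ}^{m,μ}` do nothing but change between the
normalisations of the spherical and of the solid harmonics. -/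
theorem coeffH_mul_harmNorm {l n : ℕ} {m μ : ℤ} (hm : |m| ≤ l) (hμ : |μ| ≤ n) {a : Space}
    (ha : a ≠ 0) :
    coeffH l n m μ a * ((-1) ^ μ * (harmNorm n μ : ℂ)) =
      kappa l m * ((-1) ^ ((n : ℤ) + μ) * irregM (l + n) (m - μ) a) := by
  rw [abs_le] at hm hμ
  rw [coeffH, irregSolid_eq _ _ ha, kappa]
  have e1 := choose_toNat (b := n + μ) (c := l - m) (by omega) (by omega)
  have e2 := choose_toNat (b := n - μ) (c := l + m) (by omega) (by omega)
  rw [show (n : ℤ) + μ + (l - m) = l + n + μ - m by ring] at e1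
  rw [show (n : ℤ) - μ + (l + m) = l + n + m - μ by ring] at e2
  rw [e1, e2]
  have e3 : factZ (((l + n : ℕ) : ℤ) - (m - μ)) = factZ (l + n + μ - m) := by
    congr 1; push_cast; ring
  have e4 : factZ (((l + n : ℕ) : ℤ) + (m - μ)) = factZ (l + n + m - μ) := by
    congr 1; push_cast; ring
  rw [e3, e4, harmNorm, harmNorm]
  have p1 := factZ_pos (l + n + μ - m)
  have p2 := factZ_pos (l + n + m - μ)
  have p3 := factZ_pos (n + μ)
  have p4 := factZ_pos (n - μ)
  have p5 := factZ_pos (l + m)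
  have p6 := factZ_pos (l - m)
  generalize factZ (l + n + μ - m) = A at *
  generalize factZ (l + n + m - μ) = B at *
  generalize factZ (n + μ) = C at *
  generalize factZ (n - μ) = D at *
  generalize factZ (l + m) = E at *
  generalize factZ (l - m) = F at *
  have key : Real.sqrt ((2 * l + 1) / (2 * n + 1)) * (Real.sqrt (A * B) / (A * B)) *
      Real.sqrt (A / (C * F) * (B / (D * E))) *
      Real.sqrt ((2 * n + 1) / (4 * Real.pi) * (D * C)) =
      Real.sqrt ((2 * l + 1) / (4 * Real.pi) * (F * E)) / (F * E) := by
    have := Real.pi_pos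
    refine (pow_left_inj₀ (by positivity) (by positivity) two_ne_zero).1 ?_
    simp only [mul_pow, div_pow]
    rw [Real.sq_sqrt (by positivity), Real.sq_sqrt (by positivity), Real.sq_sqrt (by positivity),
      Real.sq_sqrt (by positivity), Real.sq_sqrt (by positivity)]
    field_simp
  have key' := congrArg (Complex.ofReal) key
  have hs : (-1 : ℂ) ^ m = (-1) ^ (m - μ) * (-1) ^ μ := by
    rw [← zpow_add₀ (by norm_num)]; congr 1; ring
  rw [hs]
  push_cast at key' ⊢
  linear_combination ((-1) ^ ((n : ℤ) + μ) * (-1) ^ (m - μ) * (-1) ^ μ *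
    irregM (l + n) (m - μ) a : ℂ) * key'

theorem gradSolid_smul (c : ℝ) (n : ℕ) (μ : ℤ) (x : Space) :
    gradSolid (n + 1) μ (c • x) = (c : ℂ) ^ n • gradSolid (n + 1) μ x := by
  have h : ∀ μ, regSolidPred (n + 1) μ (c • x) = (c : ℂ) ^ n * regSolidPred (n + 1) μ x :=
    fun μ => regSolid_smul c n μ x
  simp only [gradSolid, h]
  module

theorem norm_smul_unitVec {x : Space} (hx : x ≠ 0) : ‖x‖ • unitVec x = x := by
  rw [unitVec, smul_smul, mul_inv_cancel₀ (norm_ne_zero_iff.2 hx), one_smul]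

theorem coeffH_smul_cW {l n : ℕ} {m μ : ℤ} (hm : |m| ≤ l) (hμ : |μ| ≤ (n + 1 : ℕ)) {a r : Space}
    (ha : a ≠ 0) (hr : r ≠ 0) :
    (coeffH l (n + 1) m μ a * ((‖r‖ : ℝ) : ℂ) ^ n) • cW (n + 1) μ (unitVec r) =
      kappa l m • (((-1) ^ (((n + 1 : ℕ) : ℤ) + μ) * irregM (l + (n + 1)) (m - μ) a) •
        gradSolid (n + 1) μ r) := by
  conv_rhs => rw [← norm_smul_unitVec hr, gradSolid_smul]
  rw [cW_eq _ _ (norm_unitVec hr)]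
  have := coeffH_mul_harmNorm hm hμ ha
  rw [smul_smul, smul_smul, smul_smul, ← mul_assoc, ← this]
  congr 1
  ring

theorem coeffH_mul_sphHarm {l n : ℕ} {m μ : ℤ} (hm : |m| ≤ l) (hμ : |μ| ≤ n) {a r : Space}
    (ha : a ≠ 0) (hr : r ≠ 0) :
    coeffH l n m μ a * ((‖r‖ : ℝ) : ℂ) ^ n * sphHarm n μ (unitVec r) =
      kappa l m * ((-1) ^ ((n : ℤ) + μ) * regSolid n μ r * irregM (l + n) (m - μ) a) := by
  conv_rhs => rw [← norm_smul_unitVec hr, regSolid_smul]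
  rw [sphHarm_eq _ _ _ (norm_unitVec hr)]
  linear_combination (((‖r‖ : ℝ) : ℂ) ^ n * regSolid n μ (unitVec r)) * coeffH_mul_harmNorm hm hμ ha

theorem sphHarm_eq_irregM (l : ℕ) (m : ℤ) {x : Space} (hx : x ≠ 0) :
    ((‖x‖ : ℝ) : ℂ) ^ (-(l : ℤ)) * sphHarm l m (unitVec x) =
      ((‖x‖ : ℝ) : ℂ) * (kappa l m * irregM l m x) := by
  have hF : ((factZ (l - m) * factZ (l + m) : ℝ) : ℂ) ≠ 0 := by
    exact_mod_cast (mul_pos (factZ_pos _) (factZ_pos _)).ne'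
  have hn : ((‖x‖ : ℝ) : ℂ) ≠ 0 := by exact_mod_cast norm_ne_zero_iff.2 hx
  rw [sphHarm_unitVec l m hx, kappa, irregM, irregC, regSolid, zpow_neg, zpow_natCast]
  generalize ((factZ (l - m) * factZ (l + m) : ℝ) : ℂ) = F at *
  push_cast
  field_simp
  ring

theorem gradIrreg_eq {l : ℕ} {m : ℤ} (hm : |m| ≤ l) {x : Space} (hx : x ≠ 0) :
    gradIrreg l m x = (((factZ (l - m) * factZ (l + m) : ℝ) : ℂ) /
      ((‖x‖ : ℝ) : ℂ) ^ (2 * l + 3)) •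
        (((‖x‖ : ℝ) : ℂ) ^ 2 • gradSolid l m x - ((2 * (l : ℂ) + 1) * regSolid l m x) •
            toComplex x) := by
  have hn : ((‖x‖ : ℝ) : ℂ) ≠ 0 := by exact_mod_cast norm_ne_zero_iff.2 hx
  obtain ⟨l1, l2, l3⟩ := irregC_succ hn (zC_sq_add x).symm hm
  simp only [gradIrreg, irregM]
  rw [l1, l2, l3, toComplex_eq, gradSolid, regSolid, regSolidPred, regSolidPred, regSolidPred]
  module

theorem gradSolid_unitVec (l : ℕ) (m : ℤ) {x : Space} (hx : x ≠ 0) :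
    ((‖x‖ : ℝ) : ℂ) ^ l • gradSolid l m (unitVec x) = ((‖x‖ : ℝ) : ℂ) • gradSolid l m x := by
  cases l with
  | zero => simp [gradSolid, regSolidPred, solidPred]
  | succ l =>
    conv_rhs => rw [← norm_smul_unitVec hx, gradSolid_smul]
    rw [smul_smul, norm_smul_unitVec hx, pow_succ']

/-- `V_l^m` is the gradient of an irregular solid harmonic. -/
theorem cV_eq_gradIrreg {l : ℕ} {m : ℤ} (hm : |m| ≤ l) {x : Space} (hx : x ≠ 0) :
    (((‖x‖ : ℝ) : ℂ) ^ (-(l : ℤ))) • cV l m (unitVec x) =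
      (((‖x‖ : ℝ) : ℂ) ^ 2 * kappa l m) • gradIrreg l m x := by
  have hn : ((‖x‖ : ℝ) : ℂ) ≠ 0 := by exact_mod_cast norm_ne_zero_iff.2 hx
  have hF : ((factZ (l - m) * factZ (l + m) : ℝ) : ℂ) ≠ 0 := by
    exact_mod_cast (mul_pos (factZ_pos _) (factZ_pos _)).ne'
  rw [cV_eq l m (norm_unitVec hx), gradIrreg_eq hm hx, kappa]
  have h1 := gradSolid_unitVec l m hx
  have h2 : gradSolid l m (unitVec x) =
      (((‖x‖ : ℝ) : ℂ) / ((‖x‖ : ℝ) : ℂ) ^ l) • gradSolid l m x := by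
    rw [div_eq_inv_mul, mul_smul, ← h1, inv_smul_smul₀ (pow_ne_zero _ hn)]
  have h3 : regSolid l m x = ((‖x‖ : ℝ) : ℂ) ^ l * regSolid l m (unitVec x) := by
    conv_lhs => rw [← norm_smul_unitVec hx, regSolid_smul]
  have h4 : toComplex x = ((‖x‖ : ℝ) : ℂ) • toComplex (unitVec x) := by
    conv_lhs => rw [← norm_smul_unitVec hx]
    ext k
    simp [toComplex]
  rw [h2, h3, h4, zpow_neg, zpow_natCast]
  generalize ((factZ (l - m) * factZ (l + m) : ℝ) : ℂ) = F at *
  generalize ((‖x‖ : ℝ) : ℂ) = R at *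
  have hp : R ^ l ≠ 0 := pow_ne_zero _ hn
  ext k
  simp only [Pi.smul_apply, Pi.sub_apply, smul_eq_mul]
  rw [show R ^ (2 * l + 3) = (R ^ l) ^ 2 * R ^ 3 by ring]
  generalize R ^ l = P at *
  field_simp

/-! ### Clebsch-Gordan coefficients for coupling with spin one -/

/-- `(J - M)! (J + M)!`, read as `0` for `|M| > J`. -/
def cgF (J : ℕ) (M : ℤ) : ℝ := if |M| ≤ J then factZ (J - M) * factZ (J + M) else 0

/-- The factor of `⟨k, M - s; 1, s | J, M⟩ ^ 2` that depends on `k` and `J` only, where `J` is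
`k + 1`, `k` or `k - 1` (the last being the default case). See `clebschGordan_mul_sqrt`. -/
def cgA (k J : ℕ) : ℝ :=
  if J = k + 1 then 1 / ((k + 1) * (2 * k + 1))
  else if J = k then 1 / (4 * k * (k + 1))
  else 1 / (k * (2 * k + 1))

/-- The factor of `⟨k, M - s; 1, s | J, M⟩` that is rational in `k`, `M` and `s`, where `J` is
`k + 1`, `k` or `k - 1` (the last being the default case). See `clebschGordan_mul_sqrt`. -/
def cgP (k J : ℕ) (M s : ℤ) : ℝ :=
  if J = k + 1 then (if s = 0 then 1 else 1 / 2)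
  else if J = k then (if s = 1 then -(k - M + 1) else if s = 0 then 2 * M else k + M + 1)
  else
    (if s = 1 then (k - M + 1) * (k - M) / 2
      else if s = 0 then -((k - M) * (k + M)) else (k + M + 1) * (k + M) / 2)

/-- `cgP` multiplied by the factor `√((1 - s)! (1 + s)!)` of the Clebsch-Gordan coefficient. -/
def cgW (k J : ℕ) (M s : ℤ) : ℝ := (if s = 0 then 1 else Real.sqrt 2) * cgP k J M s

theorem cgA_self (k : ℕ) : cgA k k = 1 / (4 * k * (k + 1)) := by simp [cgA]

theorem cgA_pred (k : ℕ) : cgA (k + 1) k = 1 / ((k + 1) * (2 * k + 3)) := by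
  rw [cgA, if_neg (by omega), if_neg (by omega)]; push_cast; congr 1; ring

theorem cgP_succ (k : ℕ) (M s : ℤ) : cgP k (k + 1) M s = if s = 0 then 1 else 1 / 2 := by
  simp [cgP]

theorem cgP_self (k : ℕ) (M s : ℤ) : cgP k k M s =
    if s = 1 then -((k : ℝ) - M + 1) else if s = 0 then 2 * (M : ℝ) else (k : ℝ) + M + 1 := by
  simp [cgP]

theorem cgP_pred (k : ℕ) (M s : ℤ) : cgP (k + 1) k M s =
    if s = 1 then ((k : ℝ) - M + 2) * (k - M + 1) / 2
      else if s = 0 then -(((k : ℝ) - M + 1) * (k + M + 1))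
      else ((k : ℝ) + M + 2) * (k + M + 1) / 2 := by
  rw [cgP, if_neg (by omega), if_neg (by omega)]; push_cast; split_ifs <;> ring

theorem factZ_mul_invFactZ {n : ℤ} (hn : 0 ≤ n) : factZ n * invFactZ n = 1 := by
  have := (factZ_pos n).ne'
  rw [factZ] at *
  rw [invFactZ, if_neg hn.not_gt]
  field_simp

theorem factZ_mul_invFactZ_sub_one {n : ℤ} (hn : 0 ≤ n) : factZ n * invFactZ (n - 1) = n := by
  rcases hn.eq_or_lt with rfl | h
  · simp [invFactZ]
  · have h1 := factZ_succ (n := n - 1) (by omega)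
    have h2 := factZ_mul_invFactZ (n := n - 1) (by omega)
    rw [sub_add_cancel] at h1
    rw [h1, mul_assoc, h2]; push_cast; ring

theorem factZ_mul_invFactZ_sub_two {n : ℤ} (hn : 0 ≤ n) :
    factZ n * invFactZ (n - 2) = n * (n - 1) := by
  rcases hn.eq_or_lt with rfl | h
  · simp [invFactZ]
  · have h1 := factZ_succ (n := n - 1) (by omega)
    have h2 := factZ_mul_invFactZ_sub_one (n := n - 1) (by omega)
    rw [sub_add_cancel] at h1
    rw [show n - 1 - 1 = n - 2 by ring] at h2
    rw [h1, mul_assoc, h2]; push_cast; ring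

/-- Racah's formula for coupling with spin one, once the prefactor `A` and the alternating sum,
multiplied by the factorials that clear its denominators, have been computed. -/
theorem clebschGordan_mul_sqrt_of_sum {k J : ℕ} {M s : ℤ} (hm : |M - s| ≤ k) (hs : |s| ≤ 1)
    (hM : |M| ≤ J) (hJ1 : |(k : ℤ) - (1 : ℕ)| ≤ J) (hJ2 : J ≤ k + 1) {A P : ℝ}
    (hA : (2 * J + 1) * factZ (J + k - (1 : ℕ)) * factZ (J - k + (1 : ℕ)) *
      factZ (k + (1 : ℕ) - J) / factZ (k + (1 : ℕ) + J + 1) = A)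
    (hP : (∑ κ ∈ Finset.range (k + 1 - J + 1),
        (-1 : ℝ) ^ κ * (invFactZ κ * invFactZ (k + (1 : ℕ) - J - κ) * invFactZ (k - (M - s) - κ) *
          invFactZ ((1 : ℕ) + s - κ) * invFactZ (J - (1 : ℕ) + (M - s) + κ) *
          invFactZ (J - k - s + κ))) *
        (factZ (k - (M - s)) * factZ (k + (M - s))) = P) :
    clebschGordan k (M - s) 1 s J M * Real.sqrt (cgF k (M - s)) =
      Real.sqrt A * Real.sqrt (cgF J M) * (Real.sqrt (factZ (1 - s) * factZ (1 + s)) * P) := by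
  have p1 := factZ_pos (J + M)
  have p2 := factZ_pos (J - M)
  have p3 := factZ_pos (k - (M - s))
  have p4 := factZ_pos (k + (M - s))
  have p5 := factZ_pos (1 - s)
  have p6 := factZ_pos (1 + s)
  rw [clebschGordan, if_pos ⟨hm, by exact_mod_cast hs, hM, hJ1, hJ2, by ring⟩, hA, cgF, cgF,
    if_pos hm, if_pos hM]
  have h : Real.sqrt (factZ (J + M) * factZ (J - M) * factZ (k - (M - s)) * factZ (k + (M - s)) *
        factZ ((1 : ℕ) - s) * factZ ((1 : ℕ) + s)) =
      Real.sqrt (factZ (J - M) * factZ (J + M)) * Real.sqrt (factZ (1 - s) * factZ (1 + s)) *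
        Real.sqrt (factZ (k - (M - s)) * factZ (k + (M - s))) := by
    rw [← Real.sqrt_mul (by positivity), ← Real.sqrt_mul (by positivity)]
    congr 1
    push_cast
    ring
  rw [h]
  have hP' := hP.symm
  rw [← Real.mul_self_sqrt (mul_pos p3 p4).le] at hP'
  rw [hP']
  ring

theorem clebschGordan_eq_zero {j₁ j₂ J : ℕ} {m₁ m₂ M : ℤ}
    (h : (j₁ : ℤ) < |m₁| ∨ (J : ℤ) < |M|) : clebschGordan j₁ m₁ j₂ m₂ J M = 0 := by
  rw [clebschGordan, if_neg]
  rintro ⟨h1, _, h3, _⟩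
  omega

theorem factZ_numerals : factZ 0 = 1 ∧ factZ 1 = 1 ∧ factZ 2 = 2 := by
  refine ⟨?_, ?_, ?_⟩ <;> simp [factZ]

theorem invFactZ_numerals : invFactZ 0 = 1 ∧ invFactZ 1 = 1 ∧ invFactZ 2 = 1 / 2 ∧
    invFactZ (-1) = 0 ∧ invFactZ (-2) = 0 := by
  refine ⟨?_, ?_, ?_, ?_, ?_⟩ <;> simp [invFactZ]

theorem sqrt_factZ (s : ℤ) (hs : |s| ≤ 1) :
    Real.sqrt (factZ (1 - s) * factZ (1 + s)) = if s = 0 then 1 else Real.sqrt 2 := by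
  obtain ⟨f0, f1, f2⟩ := factZ_numerals
  rw [abs_le] at hs
  obtain rfl | rfl | rfl : s = -1 ∨ s = 0 ∨ s = 1 := by omega
  all_goals norm_num [f0, f1, f2]

theorem clebschGordan_succ {k : ℕ} {M s : ℤ} (hm : |M - s| ≤ k) (hs : |s| ≤ 1) :
    clebschGordan k (M - s) 1 s (k + 1) M * Real.sqrt (cgF k (M - s)) =
      Real.sqrt (cgA k (k + 1)) * Real.sqrt (cgF (k + 1) M) * cgW k (k + 1) M s := by
  obtain ⟨f0, f1, f2⟩ := factZ_numerals
  obtain ⟨i0, i1, i2, i3, i4⟩ := invFactZ_numerals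
  have hm' := abs_le.1 hm
  have hs' := abs_le.1 hs
  have e1 := factZ_mul_invFactZ (n := k - (M - s)) (by omega)
  have e2 := factZ_mul_invFactZ (n := k + (M - s)) (by omega)
  rw [clebschGordan_mul_sqrt_of_sum hm hs (by rw [abs_le]; push_cast; omega)
    (by rw [abs_le]; push_cast; omega) le_rfl (A := cgA k (k + 1))
    (P := (if s = 0 then 1 else 1 / 2)) ?_ ?_, sqrt_factZ s hs]
  · rw [cgW, cgP_succ]
  · have h1 : factZ ((k : ℤ) + (1 : ℕ) + (k + 1 : ℕ) + 1) =
        (2 * k + 3) * ((2 * k + 2) * ((2 * k + 1) * factZ (2 * k))) := by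
      have a1 := factZ_succ (n := 2 * (k : ℤ)) (by omega)
      have a2 := factZ_succ (n := 2 * (k : ℤ) + 1) (by omega)
      have a3 := factZ_succ (n := 2 * (k : ℤ) + 1 + 1) (by omega)
      rw [show (k : ℤ) + (1 : ℕ) + (k + 1 : ℕ) + 1 = 2 * (k : ℤ) + 1 + 1 + 1 by push_cast; ring,
        a3, a2, a1]
      push_cast; ring
    rw [h1, show ((k + 1 : ℕ) : ℤ) + k - (1 : ℕ) = 2 * k by push_cast; ring,
      show ((k + 1 : ℕ) : ℤ) - k + (1 : ℕ) = 2 by push_cast; ring,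
      show (k : ℤ) + (1 : ℕ) - (k + 1 : ℕ) = 0 by push_cast; ring, f2, f0, cgA, if_pos rfl]
    have := factZ_pos (2 * k)
    push_cast
    field_simp
    ring
  · rw [Nat.sub_self, zero_add, Finset.sum_range_one]
    rw [show (k : ℤ) + (1 : ℕ) - (k + 1 : ℕ) - (0 : ℕ) = 0 by push_cast; ring,
      show ((k + 1 : ℕ) : ℤ) - (1 : ℕ) + (M - s) + (0 : ℕ) = k + (M - s) by push_cast; ring,
      show ((k + 1 : ℕ) : ℤ) - k - s + (0 : ℕ) = 1 - s by push_cast; ring,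
      show (1 : ℕ) + s - ((0 : ℕ) : ℤ) = 1 + s by push_cast; ring,
      show (k : ℤ) - (M - s) - (0 : ℕ) = k - (M - s) by push_cast; ring]
    have e3 : invFactZ (1 + s) * invFactZ (1 - s) = if s = 0 then 1 else 1 / 2 := by
      obtain rfl | rfl | rfl : s = -1 ∨ s = 0 ∨ s = 1 := by omega
      all_goals norm_num [i0, i1, i2]
    rw [← e3, Nat.cast_zero, i0]
    linear_combination (invFactZ (1 + s) * invFactZ (1 - s)) * (e1 *
      (factZ (k + (M - s)) * invFactZ (k + (M - s))) + e2)

theorem clebschGordan_self {k : ℕ} (hk : 1 ≤ k) {M s : ℤ} (hm : |M - s| ≤ k) (hs : |s| ≤ 1) :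
    clebschGordan k (M - s) 1 s k M * Real.sqrt (cgF k (M - s)) =
      Real.sqrt (cgA k k) * Real.sqrt (cgF k M) * cgW k k M s := by
  by_cases hM : |M| ≤ k
  swap
  · rw [clebschGordan_eq_zero (Or.inr (not_le.1 hM)), cgF, cgF, if_neg hM]; simp
  obtain ⟨f0, f1, f2⟩ := factZ_numerals
  obtain ⟨i0, i1, i2, i3, i4⟩ := invFactZ_numerals
  have hm' := abs_le.1 hm
  have hs' := abs_le.1 hs
  have e1 := factZ_mul_invFactZ (n := k - (M - s)) (by omega)
  have e2 := factZ_mul_invFactZ (n := k + (M - s)) (by omega)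
  have e3 := factZ_mul_invFactZ_sub_one (n := k - (M - s)) (by omega)
  have e4 := factZ_mul_invFactZ_sub_one (n := k + (M - s)) (by omega)
  rw [clebschGordan_mul_sqrt_of_sum hm hs hM
    (by rw [abs_le]; push_cast; omega) (Nat.le_succ k) (A := cgA k k)
    (P := if s = 1 then -((k : ℝ) - M + 1) else if s = 0 then 2 * (M : ℝ) else (k : ℝ) + M +
        1) ?_ ?_,
    sqrt_factZ s hs]
  · rw [cgW, cgP_self]
  · have h1 : factZ ((k : ℤ) + (1 : ℕ) + k + 1) =
        (2 * k + 2) * ((2 * k + 1) * ((2 * k) * factZ (2 * k - 1))) := by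
      have a0 := factZ_succ (n := 2 * (k : ℤ) - 1) (by omega)
      have a1 := factZ_succ (n := 2 * (k : ℤ)) (by omega)
      have a2 := factZ_succ (n := 2 * (k : ℤ) + 1) (by omega)
      rw [sub_add_cancel] at a0
      rw [show (k : ℤ) + (1 : ℕ) + k + 1 = 2 * (k : ℤ) + 1 + 1 by push_cast; ring,
        a2, a1, a0]
      push_cast; ring
    rw [h1, show (k : ℤ) + k - (1 : ℕ) = 2 * k - 1 by push_cast; ring,
      show (k : ℤ) - k + (1 : ℕ) = 1 by push_cast; ring,
      show (k : ℤ) + (1 : ℕ) - k = 1 by push_cast; ring, f1, cgA_self]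
    have := factZ_pos (2 * k - 1)
    have hk' : (0 : ℝ) < k := by exact_mod_cast hk
    field_simp
    ring
  · rw [show k + 1 - k + 1 = 2 by omega, Finset.sum_range_succ, Finset.sum_range_one]
    rw [show (k : ℤ) + (1 : ℕ) - k - (0 : ℕ) = 1 by push_cast; ring,
      show (k : ℤ) + (1 : ℕ) - k - (1 : ℕ) = 0 by push_cast; ring,
      show (k : ℤ) - (1 : ℕ) + (M - s) + (0 : ℕ) = k + (M - s) - 1 by push_cast; ring,
      show (k : ℤ) - (1 : ℕ) + (M - s) + (1 : ℕ) = k + (M - s) by push_cast; ring,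
      show (k : ℤ) - k - s + (0 : ℕ) = - s by push_cast; ring,
      show (k : ℤ) - k - s + (1 : ℕ) = 1 - s by push_cast; ring,
      show (1 : ℕ) + s - ((0 : ℕ) : ℤ) = 1 + s by push_cast; ring,
      show (1 : ℕ) + s - ((1 : ℕ) : ℤ) = s by push_cast; ring,
      show (k : ℤ) - (M - s) - (0 : ℕ) = k - (M - s) by push_cast; ring,
      show (k : ℤ) - (M - s) - (1 : ℕ) = k - (M - s) - 1 by push_cast; ring]
    rw [Nat.cast_zero, Nat.cast_one, i0, i1]
    have e5 : (k + (M - s) : ℝ) * (invFactZ (1 + s) * invFactZ (-s)) -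
        (k - (M - s)) * (invFactZ s * invFactZ (1 - s)) =
        if s = 1 then -((k : ℝ) - M + 1) else if s = 0 then 2 * (M : ℝ) else ((k : ℝ) + M + 1) := by
      obtain rfl | rfl | rfl : s = -1 ∨ s = 0 ∨ s = 1 := by omega
      all_goals norm_num [i0, i1, i2, i3, i4]
      all_goals ring
    rw [← e5]
    push_cast at e3 e4
    linear_combination (invFactZ (1 + s) * invFactZ (-s)) * (e4 + e1 *
      (factZ (k + (M - s)) * invFactZ (k + (M - s) - 1))) -
      (invFactZ s * invFactZ (1 - s)) * (e3 + e2 *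
      (factZ (k - (M - s)) * invFactZ (k - (M - s) - 1)))

theorem clebschGordan_pred {k : ℕ} {M s : ℤ} (hm : |M - s| ≤ (k + 1 : ℕ)) (hs : |s| ≤ 1) :
    clebschGordan (k + 1) (M - s) 1 s k M * Real.sqrt (cgF (k + 1) (M - s)) =
      Real.sqrt (cgA (k + 1) k) * Real.sqrt (cgF k M) * cgW (k + 1) k M s := by
  by_cases hM : |M| ≤ k
  swap
  · rw [clebschGordan_eq_zero (Or.inr (not_le.1 hM)), cgF, cgF, if_neg hM]; simp
  obtain ⟨f0, f1, f2⟩ := factZ_numerals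
  obtain ⟨i0, i1, i2, i3, i4⟩ := invFactZ_numerals
  have hm' := abs_le.1 hm
  have hs' := abs_le.1 hs
  have e1 := factZ_mul_invFactZ (n := (k + 1 : ℕ) - (M - s)) (by omega)
  have e2 := factZ_mul_invFactZ (n := (k + 1 : ℕ) + (M - s)) (by omega)
  have e3 := factZ_mul_invFactZ_sub_one (n := (k + 1 : ℕ) - (M - s)) (by omega)
  have e4 := factZ_mul_invFactZ_sub_one (n := (k + 1 : ℕ) + (M - s)) (by omega)
  have e5 := factZ_mul_invFactZ_sub_two (n := (k + 1 : ℕ) - (M - s)) (by omega)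
  have e6 := factZ_mul_invFactZ_sub_two (n := (k + 1 : ℕ) + (M - s)) (by omega)
  rw [clebschGordan_mul_sqrt_of_sum hm hs hM
    (by rw [abs_le]; push_cast; omega) (by omega) (A := cgA (k + 1) k)
    (P := if s = 1 then ((k : ℝ) - M + 2) * (k - M + 1) / 2 else
      if s = 0 then -(((k : ℝ) - M + 1) * (k + M + 1)) else
      ((k : ℝ) + M + 2) * (k + M + 1) / 2) ?_ ?_,
    sqrt_factZ s hs]
  · rw [cgW, cgP_pred]
  · have h1 : factZ (((k + 1 : ℕ) : ℤ) + (1 : ℕ) + k + 1) =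
        (2 * k + 3) * ((2 * k + 2) * ((2 * k + 1) * factZ (2 * k))) := by
      have a1 := factZ_succ (n := 2 * (k : ℤ)) (by omega)
      have a2 := factZ_succ (n := 2 * (k : ℤ) + 1) (by omega)
      have a3 := factZ_succ (n := 2 * (k : ℤ) + 1 + 1) (by omega)
      rw [show ((k + 1 : ℕ) : ℤ) + (1 : ℕ) + k + 1 = 2 * (k : ℤ) + 1 + 1 + 1 by push_cast; ring,
        a3, a2, a1]
      push_cast; ring
    rw [h1, show (k : ℤ) + (k + 1 : ℕ) - (1 : ℕ) = 2 * k by push_cast; ring,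
      show (k : ℤ) - (k + 1 : ℕ) + (1 : ℕ) = 0 by push_cast; ring,
      show ((k + 1 : ℕ) : ℤ) + (1 : ℕ) - k = 2 by push_cast; ring, f2, f0, cgA_pred]
    have := factZ_pos (2 * k)
    field_simp
  · rw [show k + 1 + 1 - k + 1 = 3 by omega, Finset.sum_range_succ, Finset.sum_range_succ,
      Finset.sum_range_one]
    rw [show ((k + 1 : ℕ) : ℤ) + (1 : ℕ) - k - (0 : ℕ) = 2 by push_cast; ring,
      show ((k + 1 : ℕ) : ℤ) + (1 : ℕ) - k - (1 : ℕ) = 1 by push_cast; ring,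
      show ((k + 1 : ℕ) : ℤ) + (1 : ℕ) - k - (2 : ℕ) = 0 by push_cast; ring,
      show (k : ℤ) - (1 : ℕ) + (M - s) + (0 : ℕ) = (k + 1 : ℕ) + (M - s) - 2 by push_cast; ring,
      show (k : ℤ) - (1 : ℕ) + (M - s) + (1 : ℕ) = (k + 1 : ℕ) + (M - s) - 1 by push_cast; ring,
      show (k : ℤ) - (1 : ℕ) + (M - s) + (2 : ℕ) = (k + 1 : ℕ) + (M - s) by push_cast; ring,
      show (k : ℤ) - (k + 1 : ℕ) - s + (0 : ℕ) = -1 - s by push_cast; ring,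
      show (k : ℤ) - (k + 1 : ℕ) - s + (1 : ℕ) = -s by push_cast; ring,
      show (k : ℤ) - (k + 1 : ℕ) - s + (2 : ℕ) = 1 - s by push_cast; ring,
      show (1 : ℕ) + s - ((0 : ℕ) : ℤ) = 1 + s by push_cast; ring,
      show (1 : ℕ) + s - ((1 : ℕ) : ℤ) = s by push_cast; ring,
      show (1 : ℕ) + s - ((2 : ℕ) : ℤ) = s - 1 by push_cast; ring,
      show ((k + 1 : ℕ) : ℤ) - (M - s) - (0 : ℕ) = (k + 1 : ℕ) - (M - s) by push_cast; ring,
      show ((k + 1 : ℕ) : ℤ) - (M - s) - (1 : ℕ) = (k + 1 : ℕ) - (M - s) - 1 by push_cast; ring,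
      show ((k + 1 : ℕ) : ℤ) - (M - s) - (2 : ℕ) = (k + 1 : ℕ) - (M - s) - 2 by push_cast; ring]
    rw [Nat.cast_zero, Nat.cast_one, Nat.cast_two, i0, i1, i2]
    have e7 : (1 / 2 : ℝ) * ((k + 1 + (M - s)) * (k + 1 + (M - s) - 1)) *
          (invFactZ (1 + s) * invFactZ (-1 - s)) -
        (k + 1 - (M - s)) * (k + 1 + (M - s)) * (invFactZ s * invFactZ (-s)) +
        (1 / 2 : ℝ) * ((k + 1 - (M - s)) * (k + 1 - (M - s) - 1)) *
          (invFactZ (s - 1) * invFactZ (1 - s)) =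
        if s = 1 then ((k : ℝ) - M + 2) * (k - M + 1) / 2 else
          if s = 0 then -(((k : ℝ) - M + 1) * (k + M + 1)) else
          ((k : ℝ) + M + 2) * (k + M + 1) / 2 := by
      obtain rfl | rfl | rfl : s = -1 ∨ s = 0 ∨ s = 1 := by omega
      all_goals norm_num [i0, i1, i2, i3, i4]
      all_goals ring
    rw [← e7]
    push_cast at e1 e2 e3 e4 e5 e6 ⊢
    linear_combination (1 / 2 * (invFactZ (1 + s) * invFactZ (-1 - s))) * (e6 + e1 *
      (factZ ((k + 1 : ℤ) + (M - s)) * invFactZ ((k + 1 : ℤ) + (M - s) - 2))) -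
      (invFactZ s * invFactZ (-s)) * (e3 *
        (factZ ((k + 1 : ℤ) + (M - s)) * invFactZ ((k + 1 : ℤ) + (M - s) - 1)) +
        ((k : ℝ) + 1 - (M - s)) * e4) +
      (1 / 2 * (invFactZ (s - 1) * invFactZ (1 - s))) * (e5 + e2 *
      (factZ ((k + 1 : ℤ) - (M - s)) * invFactZ ((k + 1 : ℤ) - (M - s) - 2)))

/-- The table of the Clebsch-Gordan coefficients for coupling with spin one. -/
theorem clebschGordan_mul_sqrt {k J : ℕ} (hJ : J = k + 1 ∨ 1 ≤ k ∧ (J = k ∨ J + 1 = k)) {M s : ℤ}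
    (hm : |M - s| ≤ k) (hs : |s| ≤ 1) :
    clebschGordan k (M - s) 1 s J M * Real.sqrt (cgF k (M - s)) =
      Real.sqrt (cgA k J) * Real.sqrt (cgF J M) * cgW k J M s := by
  obtain rfl | ⟨hk, rfl | rfl⟩ := hJ
  · exact clebschGordan_succ hm hs
  · exact clebschGordan_self hk hm hs
  · exact clebschGordan_pred hm hs

/-! ### The coupled harmonics -/

theorem harmNorm_eq {l : ℕ} {m : ℤ} (hm : |m| ≤ l) :
    harmNorm l m = Real.sqrt ((2 * l + 1) / (4 * Real.pi)) * Real.sqrt (cgF l m) := by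
  rw [harmNorm, cgF, if_pos hm, ← Real.sqrt_mul (by positivity)]

theorem regSolid_eq_zero {n : ℕ} {μ : ℤ} (h : (n : ℤ) < |μ|) (x : Space) : regSolid n μ x = 0 :=
  solid_eq_zero _ _ _ h

theorem regSolidPred_eq_zero {n : ℕ} {μ : ℤ} (h : (n : ℤ) ≤ |μ|) (x : Space) :
    regSolidPred n μ x = 0 := by
  cases n with
  | zero => rfl
  | succ n => exact solid_eq_zero _ _ _ (by push_cast at h; omega)

theorem gradSolid_eq_zero {n : ℕ} {μ : ℤ} (h : (n : ℤ) < |μ|) (x : Space) :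
    gradSolid n μ x = 0 := by
  have h1 : (n : ℤ) ≤ |μ - 1| := by rw [lt_abs] at h; rw [le_abs]; omega
  have h2 : (n : ℤ) ≤ |μ + 1| := by rw [lt_abs] at h; rw [le_abs]; omega
  rw [gradSolid, regSolidPred_eq_zero h1, regSolidPred_eq_zero h.le, regSolidPred_eq_zero h2]
  simp

theorem sum_Icc_neg_one_one {M : Type*} [AddCommMonoid M] (f : ℤ → M) :
    ∑ s ∈ Finset.Icc (-1 : ℤ) 1, f s = f (-1) + f 0 + f 1 := by
  have : Finset.Icc (-1 : ℤ) 1 = {-1, 0, 1} := by decide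
  rw [this, Finset.sum_insert (by decide), Finset.sum_insert (by decide), Finset.sum_singleton,
    add_assoc]

theorem neg_one_zpow_sub (a b : ℤ) : (-1 : ℂ) ^ (a - b) = (-1) ^ a * (-1) ^ b := by
  have : (-1 : ℂ) ^ b * (-1) ^ b = 1 := by rw [← mul_zpow]; simp
  rw [zpow_sub₀ (by norm_num), div_eq_iff (zpow_ne_zero _ (by norm_num)), mul_assoc, this, mul_one]

theorem sqrt_two_mul_self : ((Real.sqrt 2 : ℝ) : ℂ) * ((Real.sqrt 2 : ℝ) : ℂ) = 2 := by
  norm_cast; norm_num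

theorem sqrt_two_ne_zero : ((Real.sqrt 2 : ℝ) : ℂ) ≠ 0 := by
  norm_cast; positivity

theorem sphBasis_one : sphBasis 1 = (-((Real.sqrt 2 : ℝ) : ℂ)) • vecXi := by
  have h := sqrt_two_mul_self
  have h0 := sqrt_two_ne_zero
  ext k
  fin_cases k <;> simp [sphBasis, vecXi] <;> field_simp <;> rw [pow_two, h]

theorem sphBasis_neg_one : sphBasis (-1) = ((Real.sqrt 2 : ℝ) : ℂ) • vecEta := by
  have h := sqrt_two_mul_self
  have h0 := sqrt_two_ne_zero
  ext k
  fin_cases k <;> simp [sphBasis, vecEta] <;> field_simp <;> rw [pow_two, h]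

theorem sphBasis_zero : sphBasis 0 = vecZ := by
  simp [sphBasis, vecZ]

/-- The coupled harmonic `Y⃗_{J,k,M}` without its normalisation, with the solid harmonics in place
of the spherical ones. -/
def coupledSolid (k J : ℕ) (M : ℤ) (x : Space) : Fin 3 → ℂ :=
  ∑ s ∈ Finset.Icc (-1 : ℤ) 1, ((-1) ^ s * (cgW k J M s : ℂ) * regSolid k (M - s) x) • sphBasis s

/-- The factor between `Y⃗_{J,k,M}` and `coupledSolid k J M`, up to `(-1) ^ M`. -/
def coupledNorm (k J : ℕ) (M : ℤ) : ℝ :=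
  Real.sqrt ((2 * k + 1) / (4 * Real.pi)) * (Real.sqrt (cgA k J) * Real.sqrt (cgF J M))

theorem clebschGordan_mul_sphHarm {k J : ℕ} (hJ : J = k + 1 ∨ 1 ≤ k ∧ (J = k ∨ J + 1 = k))
    (M : ℤ) {s : ℤ} (hs : |s| ≤ 1) {u : Space} (hu : ‖u‖ = 1) :
    (clebschGordan k (M - s) 1 s J M : ℂ) * sphHarm k (M - s) u =
      (-1) ^ M * (coupledNorm k J M : ℂ) * ((-1) ^ s * (cgW k J M s : ℂ) *
          regSolid k (M - s) u) := by
  rw [sphHarm_eq _ _ _ hu]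
  by_cases hm : |M - s| ≤ k
  · have h := congrArg Complex.ofReal (clebschGordan_mul_sqrt hJ hm hs)
    rw [harmNorm_eq hm, coupledNorm, neg_one_zpow_sub]
    push_cast at h ⊢
    linear_combination ((-1) ^ M * (-1) ^ s * (Real.sqrt ((2 * k + 1) / (4 * Real.pi)) : ℂ) *
      regSolid k (M - s) u) * h
  · rw [regSolid_eq_zero (not_le.1 hm)]; simp

theorem vecY_eq {k J : ℕ} (hJ : J = k + 1 ∨ 1 ≤ k ∧ (J = k ∨ J + 1 = k)) (M : ℤ) {u : Space}
    (hu : ‖u‖ = 1) :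
    vecY J k M u = ((-1) ^ M * (coupledNorm k J M : ℂ)) • coupledSolid k J M u := by
  rw [vecY, coupledSolid, Finset.smul_sum]
  refine Finset.sum_congr rfl fun s hs => ?_
  rw [clebschGordan_mul_sphHarm hJ M (by rw [Finset.mem_Icc] at hs; rw [abs_le]; exact hs) hu,
    smul_smul]

theorem coupledSolid_eq (k J : ℕ) (M : ℤ) (x : Space) :
    coupledSolid k J M x = (((Real.sqrt 2 : ℝ) : ℂ) * cgW k J M 1 * regSolid k (M - 1) x) • vecXi +
      ((cgW k J M 0 : ℂ) * regSolid k M x) • vecZ -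
      (((Real.sqrt 2 : ℝ) : ℂ) * cgW k J M (-1) * regSolid k (M + 1) x) • vecEta := by
  rw [coupledSolid, sum_Icc_neg_one_one, sphBasis_one, sphBasis_zero, sphBasis_neg_one, sub_zero,
    sub_neg_eq_add]
  simp only [zpow_zero, zpow_neg, zpow_one, inv_neg, inv_one]
  module

theorem coupledSolid_succ (k : ℕ) (M : ℤ) (x : Space) :
    coupledSolid k (k + 1) M x = gradSolid (k + 1) M x := by
  rw [coupledSolid_eq, cgW, cgW, cgW, cgP_succ, cgP_succ, cgP_succ, gradSolid]
  have h := sqrt_two_mul_self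
  simp only [regSolidPred, solidPred, regSolid]
  norm_num
  rw [← mul_assoc, h]
  norm_num

theorem coupledSolid_pred (k : ℕ) (M : ℤ) {u : Space} (hu : ‖u‖ = 1) :
    coupledSolid (k + 1) k M u =
      gradSolid k M u - ((2 * (k : ℂ) + 1) * regSolid k M u) • toComplex u := by
  have h := sqrt_two_mul_self
  have hQ := zC_sq_add u
  rw [hu] at hQ
  have h1 := z_mul_solid (xiC u) (zC u) (etaC u) k M
  have h2 := xi_mul_solid (xiC u) (zC u) (etaC u) k M
  have h3 := eta_mul_solid (xiC u) (zC u) (etaC u) k M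
  rw [hQ] at h1 h2 h3
  rw [coupledSolid_eq, cgW, cgW, cgW, cgP_pred, cgP_pred, cgP_pred, gradSolid, toComplex_eq]
  simp only [regSolid, regSolidPred]
  norm_num at h1 h2 h3 ⊢
  ext i
  simp only [Pi.add_apply, Pi.sub_apply, Pi.smul_apply, Pi.neg_apply, smul_eq_mul]
  linear_combination (vecXi i) * h3 + (vecZ i) * h1 + (vecEta i) * h2 +
    (vecXi i * ((k - M + 2) * (k - M + 1)) / 2 * solid (xiC u) (zC u) (etaC u) (k + 1) (M - 1) -
     vecEta i * ((k + M + 2) * (k + M + 1)) / 2 * solid (xiC u) (zC u) (etaC u) (k + 1) (M + 1)) * h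

theorem cross_basis : crossProduct vecXi vecXi = 0 ∧ crossProduct vecZ vecZ = 0 ∧
    crossProduct vecEta vecEta = 0 ∧
    crossProduct vecZ vecXi = (-Complex.I) • vecXi ∧ crossProduct vecXi vecZ = Complex.I • vecXi ∧
    crossProduct vecZ vecEta = Complex.I • vecEta ∧
    crossProduct vecEta vecZ = (-Complex.I) • vecEta ∧
    crossProduct vecXi vecEta = (-Complex.I / 2) • vecZ ∧
    crossProduct vecEta vecXi = (Complex.I / 2) • vecZ := by
  refine ⟨cross_self _, cross_self _, cross_self _, ?_, ?_, ?_, ?_, ?_, ?_⟩ <;>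
  · ext i
    fin_cases i <;> simp [cross_apply, vecXi, vecEta, vecZ] <;> ring_nf <;> simp <;> ring

theorem coupledSolid_self {k : ℕ} (M : ℤ) (u : Space) :
    coupledSolid k k M u = (-2 * Complex.I) • crossProduct (toComplex u) (gradSolid k M u) := by
  have h := sqrt_two_mul_self
  rw [coupledSolid_eq, cgW, cgW, cgW, cgP_self, cgP_self, cgP_self, gradSolid, toComplex_eq]
  obtain ⟨c1, c2, c3, c4, c5, c6, c7, c8, c9⟩ := cross_basis
  simp only [map_add, map_sub, map_smul, LinearMap.add_apply, LinearMap.smul_apply, c1, c2, c3, c4,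
    c5, c6, c7, c8, c9]
  have hp : ∀ μ, ((k : ℂ) - μ) * regSolid k μ u =
      zC u * regSolidPred k μ u - 2 * etaC u * regSolidPred k (μ + 1) u := by
    intro μ
    have a := natCast_mul_solid (xiC u) (zC u) (etaC u) k μ
    have b := intCast_mul_solid (xiC u) (zC u) (etaC u) k μ
    simp only [regSolid, regSolidPred]
    linear_combination a - b
  have hq : ∀ μ, ((k : ℂ) + μ) * regSolid k μ u =
      2 * xiC u * regSolidPred k (μ - 1) u + zC u * regSolidPred k μ u := by
    intro μ
    have a := natCast_mul_solid (xiC u) (zC u) (etaC u) k μ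
    have b := intCast_mul_solid (xiC u) (zC u) (etaC u) k μ
    simp only [regSolid, regSolidPred]
    linear_combination a + b
  have h1 := hp (M - 1)
  have h2 := hq (M + 1)
  have h3 := intCast_mul_solid (xiC u) (zC u) (etaC u) k M
  have hI := Complex.I_sq
  simp only [sub_add_cancel, add_sub_cancel_right] at h1 h2
  simp only [regSolid, regSolidPred] at *
  norm_num at h1 h2 h3 ⊢
  ext i
  simp only [Pi.add_apply, Pi.sub_apply, Pi.smul_apply, smul_eq_mul, Pi.neg_apply]
  linear_combination (-(vecXi i) * (k - M + 1) * solid (xiC u) (zC u) (etaC u) k (M - 1) -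
      vecEta i * (k + M + 1) * solid (xiC u) (zC u) (etaC u) k (M + 1)) * h -
    2 * vecXi i * h1 + 2 * vecZ i * h3 - 2 * vecEta i * h2 +
    2 * ((2 * etaC u * solidPred (xiC u) (zC u) (etaC u) k M -
        zC u * solidPred (xiC u) (zC u) (etaC u) k (M - 1)) * vecXi i +
      (etaC u * solidPred (xiC u) (zC u) (etaC u) k (M + 1) +
        xiC u * solidPred (xiC u) (zC u) (etaC u) k (M - 1)) * vecZ i -
      (zC u * solidPred (xiC u) (zC u) (etaC u) k (M + 1) +
        2 * xiC u * solidPred (xiC u) (zC u) (etaC u) k M) * vecEta i) * hI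

theorem vecY_succ (k : ℕ) (M : ℤ) {u : Space} (hu : ‖u‖ = 1) :
    vecY (k + 1) k M u =
      (1 / ((Real.sqrt ((k + 1) * (2 * k + 3)) : ℝ) : ℂ)) • cW (k + 1) M u := by
  rw [vecY_eq (Or.inl rfl) M hu, coupledSolid_succ, cW_eq _ _ hu]
  by_cases hM : |M| ≤ (k + 1 : ℕ)
  · have h : coupledNorm k (k + 1) M =
        1 / Real.sqrt ((k + 1) * (2 * k + 3)) * harmNorm (k + 1) M := by
      rw [harmNorm_eq hM, coupledNorm, ← mul_assoc, ← mul_assoc]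
      congr 1
      have := Real.pi_pos
      rw [← Real.sqrt_mul (by positivity), one_div, ← Real.sqrt_inv,
        ← Real.sqrt_mul (by positivity), cgA, if_pos rfl]
      congr 1
      push_cast
      field_simp
      ring
    rw [h, smul_smul]
    congr 1
    push_cast
    ring
  · rw [gradSolid_eq_zero (not_le.1 hM)]; simp

theorem vecY_pred (k : ℕ) (M : ℤ) {u : Space} (hu : ‖u‖ = 1) :
    vecY k (k + 1) M u =
      (1 / ((Real.sqrt ((k + 1) * (2 * k + 1)) : ℝ) : ℂ)) • cV k M u := by
  rw [vecY_eq (Or.inr ⟨by omega, Or.inr rfl⟩) M hu, coupledSolid_pred k M hu, cV_eq _ _ hu]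
  by_cases hM : |M| ≤ k
  · have h : coupledNorm (k + 1) k M =
        1 / Real.sqrt ((k + 1) * (2 * k + 1)) * harmNorm k M := by
      rw [harmNorm_eq hM, coupledNorm, ← mul_assoc, ← mul_assoc]
      congr 1
      have := Real.pi_pos
      rw [← Real.sqrt_mul (by positivity), one_div, ← Real.sqrt_inv,
        ← Real.sqrt_mul (by positivity), cgA_pred]
      congr 1
      push_cast
      field_simp
      ring
    rw [h, smul_smul]
    congr 1
    push_cast
    ring
  · rw [gradSolid_eq_zero (not_le.1 hM), regSolid_eq_zero (not_le.1 hM)]; simp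

theorem vecY_self {k : ℕ} (hk : 1 ≤ k) (M : ℤ) {u : Space} (hu : ‖u‖ = 1) :
    vecY k k M u = (-Complex.I / ((Real.sqrt (k * (k + 1)) : ℝ) : ℂ)) • cX k M u := by
  rw [vecY_eq (Or.inr ⟨hk, Or.inl rfl⟩) M hu, coupledSolid_self M u, cX_eq _ _ hu]
  by_cases hM : |M| ≤ k
  · have h : 2 * coupledNorm k k M = 1 / Real.sqrt (k * (k + 1)) * harmNorm k M := by
      rw [harmNorm_eq hM, coupledNorm, ← mul_assoc, ← mul_assoc, ← mul_assoc]
      congr 1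
      have := Real.pi_pos
      have hk' : (0 : ℝ) < k := by exact_mod_cast hk
      rw [mul_comm _ (Real.sqrt ((2 * k + 1) / (4 * Real.pi)))]
      rw [mul_comm (1 / _), mul_assoc]
      congr 1
      have h4 : Real.sqrt 4 = 2 := by
        rw [show (4 : ℝ) = 2 ^ 2 by norm_num, Real.sqrt_sq (by norm_num)]
      rw [cgA_self, one_div, Real.sqrt_inv, mul_assoc 4, Real.sqrt_mul (by norm_num), h4]
      field_simp
    have h' := congrArg Complex.ofReal h
    push_cast at h'
    rw [smul_smul, smul_smul]
    congr 1
    linear_combination (-(-1) ^ M * Complex.I) * h'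
  · rw [gradSolid_eq_zero (not_le.1 hM)]; simp

/-! ### Orthogonality of the Clebsch-Gordan coefficients -/

theorem cgF_nonneg (J : ℕ) (M : ℤ) : 0 ≤ cgF J M := by
  rw [cgF]; split_ifs
  · exact (mul_pos (factZ_pos _) (factZ_pos _)).le
  · exact le_rfl

theorem cgF_pos {J : ℕ} {M : ℤ} (h : |M| ≤ J) : 0 < cgF J M := by
  rw [cgF, if_pos h]; exact mul_pos (factZ_pos _) (factZ_pos _)

theorem cgF_neg (J : ℕ) (M : ℤ) : cgF J (-M) = cgF J M := by
  rw [cgF, cgF, abs_neg, sub_neg_eq_add, ← sub_eq_add_neg, mul_comm]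

theorem cgF_succ {J : ℕ} {M : ℤ} (h : |M| ≤ J) :
    cgF (J + 1) M = ((J + 1 : ℝ) - M) * (J + 1 + M) * cgF J M := by
  have h' := abs_le.1 h
  rw [cgF, cgF, if_pos h, if_pos (by push_cast; omega)]
  have h1 := factZ_succ (n := J - M) (by omega)
  have h2 := factZ_succ (n := J + M) (by omega)
  rw [show ((J + 1 : ℕ) : ℤ) - M = J - M + 1 by push_cast; ring,
    show ((J + 1 : ℕ) : ℤ) + M = J + M + 1 by push_cast; ring, h1, h2]
  push_cast; ring

theorem cgF_succ_sub_one {J : ℕ} {M : ℤ} (h : |M| ≤ J) :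
    cgF (J + 1) (M - 1) = ((J + 2 : ℝ) - M) * (J + 1 - M) * cgF J M := by
  have h' := abs_le.1 h
  rw [cgF, cgF, if_pos h, if_pos (by rw [abs_le]; push_cast; omega)]
  have h1 := factZ_succ (n := J - M) (by omega)
  have h2 := factZ_succ (n := J - M + 1) (by omega)
  rw [show ((J + 1 : ℕ) : ℤ) - (M - 1) = J - M + 1 + 1 by push_cast; ring,
    show ((J + 1 : ℕ) : ℤ) + (M - 1) = J + M by push_cast; ring, h2, h1]
  push_cast; ring

theorem cgF_succ_add_one {J : ℕ} {M : ℤ} (h : |M| ≤ J) :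
    cgF (J + 1) (M + 1) = ((J + 2 : ℝ) + M) * (J + 1 + M) * cgF J M := by
  have := cgF_succ_sub_one (J := J) (M := -M) (by rwa [abs_neg])
  rw [cgF_neg, show -M - 1 = -(M + 1) by ring, cgF_neg] at this
  rw [this]; push_cast; ring

theorem cgF_eq_zero {J : ℕ} {M : ℤ} (h : (J : ℤ) < |M|) : cgF J M = 0 := by
  rw [cgF, if_neg (not_le.2 h)]

/-- Orthogonality of the Clebsch-Gordan coefficients, cleared of square roots. The cases `|M| > k`
are separate because there one or two of the three total angular momenta do not occur. -/
theorem sum_cgP {k : ℕ} {M q s : ℤ} (hq : |q| ≤ 1) (hs : |s| ≤ 1)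
    (hMq : |M - q| ≤ (k + 1 : ℕ)) (hMs : |M - s| ≤ (k + 1 : ℕ)) :
    cgA (k + 1) k * cgF k M * (cgP (k + 1) k M q * cgP (k + 1) k M s) +
      cgA (k + 1) (k + 1) * cgF (k + 1) M * (cgP (k + 1) (k + 1) M q * cgP (k + 1) (k + 1) M s) +
      cgA (k + 1) (k + 2) * cgF (k + 2) M * (cgP (k + 1) (k + 2) M q * cgP (k + 1) (k + 2) M s) =
      if q = s then cgF (k + 1) (M - q) / (if q = 0 then 1 else 2) else 0 := by
  rw [cgP_pred, cgP_pred, cgP_self, cgP_self, cgP_succ, cgP_succ, cgA_pred, cgA_self, cgA,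
      if_pos rfl]
  rw [abs_le] at hq hs hMq hMs
  have hk : (0 : ℝ) ≤ k := k.cast_nonneg
  have hk1 : (k : ℝ) + 1 ≠ 0 := by positivity
  have hk2 : (k : ℝ) + 1 + 1 ≠ 0 := by positivity
  have hk3 : 2 * (k : ℝ) + 3 ≠ 0 := by positivity
  have hk4 : 2 * ((k : ℝ) + 1) + 1 ≠ 0 := by positivity
  push_cast at hMq hMs ⊢
  have hcases : |M| ≤ k ∨ M = k + 1 ∨ M = -(k + 1) ∨ M = k + 2 ∨ M = -(k + 2) := by
    rw [abs_le]; omega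
  rcases hcases with hM | rfl | rfl | rfl | rfl
  · have f1 := cgF_succ hM
    have f2 := cgF_succ (J := k + 1) (M := M) (by push_cast; omega)
    have f3 := cgF_succ_sub_one hM
    have f4 := cgF_succ_add_one hM
    rw [f1] at f2
    push_cast at f2
    rw [f2, f1]
    obtain rfl | rfl | rfl : q = -1 ∨ q = 0 ∨ q = 1 := by omega
    all_goals obtain rfl | rfl | rfl : s = -1 ∨ s = 0 ∨ s = 1 := by omega
    all_goals norm_num [f1, f3, f4]
    all_goals field_simp
    all_goals ring
  · have hz : |(k : ℤ)| ≤ k := by simp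
    have f0 := cgF_eq_zero (J := k) (M := k + 1) (by rw [lt_abs]; omega)
    have f1 := cgF_succ_add_one hz
    have f2 := cgF_succ (J := k + 1) (M := k + 1) (by rw [abs_le]; push_cast; omega)
    have f3 := cgF_succ hz
    rw [f1] at f2
    push_cast at f1 f2 f3
    rw [f0, f2, f1]
    obtain rfl | rfl : q = 0 ∨ q = 1 := by omega
    all_goals obtain rfl | rfl : s = 0 ∨ s = 1 := by omega
    all_goals norm_num [f1, f3]
    all_goals field_simp
    all_goals ring
  · have hz : |(-k : ℤ)| ≤ k := by simp
    have f0 := cgF_eq_zero (J := k) (M := -(k + 1)) (by rw [lt_abs]; omega)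
    have f1 := cgF_succ_sub_one hz
    have f2 := cgF_succ (J := k + 1) (M := -(k + 1)) (by rw [abs_le]; push_cast; omega)
    have f3 := cgF_succ hz
    rw [show (-k : ℤ) - 1 = -(k + 1) by ring] at f1
    rw [f1] at f2
    push_cast at f1 f2 f3
    rw [f0, f2, f1]
    have e : -((k : ℤ) + 1) + 1 = -k := by ring
    obtain rfl | rfl : q = 0 ∨ q = -1 := by omega
    all_goals obtain rfl | rfl : s = 0 ∨ s = -1 := by omega
    all_goals norm_num [f1, f3, e, -neg_add_rev, -neg_add_cancel_right]
    all_goals field_simp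
    all_goals ring
  · have f0 := cgF_eq_zero (J := k) (M := k + 2) (by rw [lt_abs]; omega)
    have f1 := cgF_eq_zero (J := k + 1) (M := k + 2) (by rw [lt_abs]; push_cast; omega)
    have f2 := cgF_succ_add_one (J := k + 1) (M := k + 1) (by rw [abs_le]; push_cast; omega)
    rw [show (k : ℤ) + 1 + 1 = k + 2 by ring] at f2
    push_cast at f2
    obtain rfl : q = 1 := by omega
    obtain rfl : s = 1 := by omega
    rw [f0, f1, f2, show (k : ℤ) + 2 - 1 = k + 1 by ring]
    norm_num
    field_simp
    ring
  · have f0 := cgF_eq_zero (J := k) (M := -(k + 2)) (by rw [lt_abs]; omega)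
    have f1 := cgF_eq_zero (J := k + 1) (M := -(k + 2)) (by rw [lt_abs]; push_cast; omega)
    have f2 := cgF_succ_sub_one (J := k + 1) (M := -(k + 1)) (by rw [abs_le]; push_cast; omega)
    rw [show -((k : ℤ) + 1) - 1 = -(k + 2) by ring] at f2
    push_cast at f2
    obtain rfl : q = -1 := by omega
    obtain rfl : s = -1 := by omega
    rw [f0, f1, f2, show -((k : ℤ) + 2) - -1 = -(k + 1) by ring]
    norm_num [-neg_add_rev]
    field_simp
    ring

theorem sum_cgW {k : ℕ} {M q s : ℤ} (hq : |q| ≤ 1) (hs : |s| ≤ 1)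
    (hMq : |M - q| ≤ (k + 1 : ℕ)) (hMs : |M - s| ≤ (k + 1 : ℕ)) :
    cgA (k + 1) k * cgF k M * (cgW (k + 1) k M q * cgW (k + 1) k M s) +
      cgA (k + 1) (k + 1) * cgF (k + 1) M * (cgW (k + 1) (k + 1) M q * cgW (k + 1) (k + 1) M s) +
      cgA (k + 1) (k + 2) * cgF (k + 2) M * (cgW (k + 1) (k + 2) M q * cgW (k + 1) (k + 2) M s) =
      if q = s then cgF (k + 1) (M - q) else 0 := by
  have h := sum_cgP hq hs hMq hMs
  simp only [cgW]
  have h2 : Real.sqrt 2 * Real.sqrt 2 = 2 := by norm_num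
  have hw : (if q = s then cgF (k + 1) (M - q) else 0) =
      (if q = 0 then 1 else Real.sqrt 2) * (if s = 0 then 1 else Real.sqrt 2) *
        (if q = s then cgF (k + 1) (M - q) / (if q = 0 then 1 else 2) else 0) := by
    by_cases hqs : q = s
    · subst hqs
      simp only [if_true]
      split_ifs
      · ring
      · rw [h2]; ring
    · simp [hqs]
  rw [hw, ← h]
  ring

theorem cgA_nonneg (k J : ℕ) : 0 ≤ cgA k J := by
  rw [cgA]; split_ifs <;> positivity

theorem clebschGordan_smul_vecY {k J : ℕ} (hJ : J = k + 1 ∨ 1 ≤ k ∧ (J = k ∨ J + 1 = k)) {M q : ℤ}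
    (hq : |q| ≤ 1) (hm : |M - q| ≤ k) {u : Space} (hu : ‖u‖ = 1) :
    ((Real.sqrt (cgF k (M - q)) : ℝ) : ℂ) • (clebschGordan k (M - q) 1 q J M : ℂ) • vecY J k M u =
      ((-1) ^ M * ((Real.sqrt ((2 * k + 1) / (4 * Real.pi)) : ℝ) : ℂ)) •
      ∑ s ∈ Finset.Icc (-1 : ℤ) 1, ((-1) ^ s * regSolid k (M - s) u *
        ((cgA k J * cgF J M * (cgW k J M q * cgW k J M s) : ℝ) : ℂ)) • sphBasis s := by
  rw [vecY_eq hJ M hu, coupledSolid]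
  have h := congrArg Complex.ofReal (clebschGordan_mul_sqrt hJ hm hq)
  have hA := congrArg Complex.ofReal (Real.mul_self_sqrt (cgA_nonneg k J))
  have hF := congrArg Complex.ofReal (Real.mul_self_sqrt (cgF_nonneg J M))
  rw [Finset.smul_sum, Finset.smul_sum, Finset.smul_sum, Finset.smul_sum]
  refine Finset.sum_congr rfl fun s _ => ?_
  rw [smul_smul, smul_smul, smul_smul, smul_smul, coupledNorm]
  congr 1
  push_cast at *
  rw [← hA, ← hF]
  linear_combination ((-1) ^ M * ((Real.sqrt ((2 * k + 1) / (4 * Real.pi)) : ℝ) : ℂ) *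
    (Real.sqrt (cgA k J) * Real.sqrt (cgF J M)) * ((-1) ^ s * cgW k J M s *
        regSolid k (M - s) u)) * h

/-- Uncoupling: the sum over `j` of the coupled harmonics gives back a product of a scalar harmonic
and a basis vector. -/
theorem sum_clebschGordan_smul_vecY (k : ℕ) (M : ℤ) {q : ℤ} (hq : |q| ≤ 1) {u : Space}
    (hu : ‖u‖ = 1) :
    ∑ j ∈ Finset.Icc ((k : ℤ) - 1).natAbs (k + 1),
      (clebschGordan k (M - q) 1 q j M : ℂ) • vecY j k M u =
      sphHarm k (M - q) u • sphBasis q := by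
  by_cases hm : |M - q| ≤ k
  swap
  · have h0 : sphHarm k (M - q) u = 0 := by
      rw [sphHarm_eq _ _ _ hu, regSolid_eq_zero (not_le.1 hm), mul_zero]
    rw [h0, zero_smul]
    refine Finset.sum_eq_zero fun j _ => ?_
    rw [clebschGordan_eq_zero (Or.inl (not_le.1 hm))]; simp
  have hsq : ((Real.sqrt (cgF k (M - q)) : ℝ) : ℂ) ≠ 0 := by
    exact_mod_cast (Real.sqrt_pos.2 (cgF_pos hm)).ne'
  apply smul_right_injective _ hsq
  simp only
  have hF := congrArg Complex.ofReal (Real.mul_self_sqrt (cgF_nonneg k (M - q)))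
  -- the right-hand side as the sum over `s` that `sum_cgW` produces
  have hr : ((Real.sqrt (cgF k (M - q)) : ℝ) : ℂ) • sphHarm k (M - q) u • sphBasis q =
      ((-1) ^ M * ((Real.sqrt ((2 * k + 1) / (4 * Real.pi)) : ℝ) : ℂ)) •
      ∑ s ∈ Finset.Icc (-1 : ℤ) 1, ((-1) ^ s * regSolid k (M - s) u *
        ((if q = s then cgF k (M - q) else 0 : ℝ) : ℂ)) • sphBasis s := by
    rw [Finset.sum_eq_single_of_mem q (by rw [Finset.mem_Icc]; exact abs_le.1 hq)
      (fun s _ hs => by rw [if_neg (Ne.symm hs)]; simp), if_pos rfl, sphHarm_eq _ _ _ hu,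
      harmNorm_eq hm, neg_one_zpow_sub, smul_smul, smul_smul, ← hF]
    congr 1
    push_cast
    ring
  rw [hr, Finset.smul_sum]
  cases k with
  | zero =>
    rw [show Finset.Icc (((0 : ℕ) : ℤ) - 1).natAbs (0 + 1) = {1} by decide, Finset.sum_singleton,
      clebschGordan_smul_vecY (Or.inl rfl) hq hm hu]
    congr 1
    refine Finset.sum_congr rfl fun s hs => ?_
    obtain rfl : M = q := by
      rw [abs_le] at hm
      push_cast at hm
      omega
    by_cases hMs : M = s
    · subst hMs
      have h2 : Real.sqrt 2 * Real.sqrt 2 = 2 := by norm_num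
      have key : cgA 0 1 * cgF 1 M * (cgW 0 1 M M * cgW 0 1 M M) = cgF 0 (M - M) := by
        obtain ⟨f0, f1, f2⟩ := factZ_numerals
        have := abs_le.1 hq
        rw [cgW, cgP_succ]
        obtain rfl | rfl | rfl : M = -1 ∨ M = 0 ∨ M = 1 := by omega
        all_goals norm_num [cgA, cgF, f0, f1, f2]
        all_goals linear_combination h2 / 2
      rw [if_pos rfl, ← key]
    · rw [regSolid_eq_zero (abs_pos.2 (sub_ne_zero.2 hMs))]; simp
  | succ k =>
    rw [show (((k + 1 : ℕ) : ℤ) - 1).natAbs = k by omega,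
      show Finset.Icc k (k + 1 + 1) = {k, k + 1, k + 2} by ext; simp; omega,
      Finset.sum_insert (by simp), Finset.sum_insert (by simp), Finset.sum_singleton,
      clebschGordan_smul_vecY (Or.inr ⟨by omega, Or.inr rfl⟩) hq hm hu,
      clebschGordan_smul_vecY (Or.inr ⟨by omega, Or.inl rfl⟩) hq hm hu,
      clebschGordan_smul_vecY (Or.inl rfl) hq hm hu, ← smul_add, ← smul_add,
      ← Finset.sum_add_distrib, ← Finset.sum_add_distrib]
    congr 1
    refine Finset.sum_congr rfl fun s hs => ?_
    rw [← add_smul, ← add_smul, ← mul_add, ← mul_add, ← Complex.ofReal_add, ← Complex.ofReal_add]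
    by_cases hMs : |M - s| ≤ (k + 1 : ℕ)
    · rw [← sum_cgW hq (by rw [Finset.mem_Icc] at hs; rwa [abs_le]) hm hMs,
        add_assoc (_ * _ : ℝ)]
    · rw [regSolid_eq_zero (not_le.1 hMs)]; simp

/-! ### Products of a spherical harmonic with a component of the unit vector -/

/-- The symmetry under exchange of the two angular momenta: Racah's sum is read backwards. -/
theorem clebschGordan_swap (j₁ j₂ J : ℕ) (m₁ m₂ M : ℤ) :
    clebschGordan j₁ m₁ j₂ m₂ J M = (-1) ^ (j₁ + j₂ - J) * clebschGordan j₂ m₂ j₁ m₁ J M := by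
  rw [clebschGordan, clebschGordan]
  have hiff : (|m₁| ≤ j₁ ∧ |m₂| ≤ j₂ ∧ |M| ≤ J ∧ |(j₁ : ℤ) - j₂| ≤ J ∧ J ≤ j₁ + j₂ ∧ M = m₁ + m₂) ↔
      (|m₂| ≤ j₂ ∧ |m₁| ≤ j₁ ∧ |M| ≤ J ∧ |(j₂ : ℤ) - j₁| ≤ J ∧ J ≤ j₂ + j₁ ∧ M = m₂ + m₁) := by
    rw [abs_sub_comm (j₁ : ℤ), add_comm j₁, add_comm m₁]
    tauto
  by_cases h : |m₁| ≤ j₁ ∧ |m₂| ≤ j₂ ∧ |M| ≤ J ∧ |(j₁ : ℤ) - j₂| ≤ J ∧ J ≤ j₁ + j₂ ∧ M = m₁ + m₂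
  swap
  · rw [if_neg h, if_neg (fun h' => h (hiff.2 h')), mul_zero]
  rw [if_pos h, if_pos (hiff.1 h)]
  have hJ := h.2.2.2.2.1
  have e1 : (2 * J + 1) * factZ (J + j₁ - j₂) * factZ (J - j₁ + j₂) * factZ (j₁ + j₂ - J) /
        factZ (j₁ + j₂ + J + 1) = (2 * J + 1) * factZ (J + j₂ - j₁) * factZ (J - j₂ + j₁) *
        factZ (j₂ + j₁ - J) / factZ (j₂ + j₁ + J + 1) := by
    rw [show (J : ℤ) + j₁ - j₂ = J - j₂ + j₁ by ring, show (J : ℤ) - j₁ + j₂ = J + j₂ - j₁ by ring,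
      add_comm (j₁ : ℤ)]
    ring
  have e2 : factZ (J + M) * factZ (J - M) * factZ (j₁ - m₁) * factZ (j₁ + m₁) *
        factZ (j₂ - m₂) * factZ (j₂ + m₂) = factZ (J + M) * factZ (J - M) * factZ (j₂ - m₂) *
        factZ (j₂ + m₂) * factZ (j₁ - m₁) * factZ (j₁ + m₁) := by ring
  rw [e1, e2, mul_left_comm]
  congr 1
  rw [← Finset.sum_range_reflect, add_comm j₂ j₁, Finset.mul_sum]
  refine Finset.sum_congr rfl fun k hk => ?_
  rw [Finset.mem_range] at hk
  have hk' : k ≤ j₁ + j₂ - J := by omega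
  have hc : ((j₁ + j₂ - J + 1 - 1 - k : ℕ) : ℤ) = j₁ + j₂ - J - k := by
    rw [Nat.add_sub_cancel, Nat.cast_sub hk', Nat.cast_sub hJ]; push_cast; ring
  rw [hc, Nat.add_sub_cancel]
  have hp : (-1 : ℝ) ^ (j₁ + j₂ - J - k) = (-1) ^ (j₁ + j₂ - J) * (-1) ^ k := by
    have h1 : (-1 : ℝ) ^ (j₁ + j₂ - J) = (-1) ^ (j₁ + j₂ - J - k) * (-1) ^ k := by
      rw [← pow_add]; congr 1; omega
    rw [h1, mul_assoc, ← mul_pow]; simp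
  rw [hp, mul_assoc]
  congr 2
  rw [show (j₁ : ℤ) + j₂ - J - (j₁ + j₂ - J - k) = k by ring,
    show (j₁ : ℤ) - m₁ - (j₁ + j₂ - J - k) = J - j₂ - m₁ + k by ring,
    show (j₂ : ℤ) + m₂ - (j₁ + j₂ - J - k) = J - j₁ + m₂ + k by ring,
    show (J : ℤ) - j₂ + m₁ + (j₁ + j₂ - J - k) = j₁ + m₁ - k by ring,
    show (J : ℤ) - j₁ - m₂ + (j₁ + j₂ - J - k) = j₂ - m₂ - k by ring,
    add_comm (j₂ : ℤ) j₁]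
  ring

theorem sphComp_one (x : Space) : sphComp x 1 = -((Real.sqrt 2 : ℝ) : ℂ) * xiC x := by
  have h := sqrt_two_mul_self
  have h0 := sqrt_two_ne_zero
  simp [sphComp, xiC]
  field_simp
  rw [pow_two, h]; ring

theorem sphComp_neg_one (x : Space) : sphComp x (-1) = ((Real.sqrt 2 : ℝ) : ℂ) * etaC x := by
  have h := sqrt_two_mul_self
  have h0 := sqrt_two_ne_zero
  simp [sphComp, etaC]
  field_simp
  rw [pow_two, h]; ring

theorem sphComp_zero (x : Space) : sphComp x 0 = zC x := by
  simp [sphComp, zC]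

theorem sum_sphComp_smul_sphBasis (a : Space) :
    ∑ q ∈ Finset.Icc (-1 : ℤ) 1, ((-1) ^ q * sphComp a (-q)) • sphBasis q = toComplex a := by
  have h := sqrt_two_mul_self
  rw [sum_Icc_neg_one_one, sphBasis_one, sphBasis_zero, sphBasis_neg_one, toComplex_eq, neg_neg,
    neg_zero, sphComp_one, sphComp_zero, sphComp_neg_one]
  ext i
  simp
  linear_combination (xiC a * vecEta i + etaC a * vecXi i) * h

theorem sum_sphComp_mul_sphComp (a u : Space) :
    ∑ q ∈ Finset.Icc (-1 : ℤ) 1, (-1) ^ q * sphComp a (-q) * sphComp u q =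
      ((inner ℝ a u : ℝ) : ℂ) := by
  have h := sqrt_two_mul_self
  rw [sum_Icc_neg_one_one, neg_neg, neg_zero, sphComp_one, sphComp_zero, sphComp_neg_one,
    sphComp_one, sphComp_zero, sphComp_neg_one]
  simp
  linear_combination (xiC a * etaC u + etaC a * xiC u) * h + two_mul_inner a u / 2

theorem cgF_mul_cgP_succ {n : ℕ} {M q : ℤ} (hq : |q| ≤ 1) (hm : |M - q| ≤ n) :
    cgF (n + 1) M * cgP n (n + 1) M q = cgF n (M - q) * (if q = 1 then ((n : ℝ) + M + 1) * (n +
        M) / 2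
      else if q = 0 then ((n : ℝ) + 1 - M) * (n + 1 + M) else ((n : ℝ) - M + 1) * (n - M) / 2) := by
  rw [cgP_succ]
  have := abs_le.1 hq
  obtain rfl | rfl | rfl : q = -1 ∨ q = 0 ∨ q = 1 := by omega
  · have h := cgF_succ_sub_one hm
    rw [show M - -1 - 1 = M by ring] at h
    rw [h]; norm_num; ring
  · rw [sub_zero] at *
    rw [cgF_succ hm]; norm_num; ring
  · have h := cgF_succ_add_one hm
    rw [show M - 1 + 1 = M by ring] at h
    rw [h]; norm_num; ring

theorem cgF_mul_cgP_pred {n : ℕ} {M q : ℤ} (hq : |q| ≤ 1) (hM : |M| ≤ n) :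
    cgF n M * cgP (n + 1) n M q = cgF (n + 1) (M - q) * (if q = 0 then -1 else 1 / 2) := by
  rw [cgP_pred]
  have := abs_le.1 hq
  obtain rfl | rfl | rfl : q = -1 ∨ q = 0 ∨ q = 1 := by omega
  · rw [sub_neg_eq_add, cgF_succ_add_one hM]; norm_num; ring
  · rw [sub_zero, cgF_succ hM]; norm_num; ring
  · rw [cgF_succ_sub_one hM]; norm_num; ring

/-- The product of a solid harmonic with a component of the unit vector, in degrees `n + 1` and
`n - 1`; the coefficients are those of `cgF_mul_cgP_succ` and `cgF_mul_cgP_pred`. -/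
theorem sphComp_mul_regSolid (n : ℕ) (M : ℤ) {q : ℤ} (hq : |q| ≤ 1) {u : Space} (hu : ‖u‖ = 1) :
    (2 * (n : ℂ) + 1) * ((-1) ^ q * sphComp u q * regSolid n (M - q) u) =
      ((if q = 0 then 1 else Real.sqrt 2 : ℝ) : ℂ) *
      (((if q = 1 then ((n : ℝ) + M + 1) * (n + M) / 2
      else if q = 0 then ((n : ℝ) + 1 - M) * (n + 1 + M) else ((n : ℝ) - M + 1) *
          (n - M) / 2 : ℝ) : ℂ) *
          regSolid (n + 1) M u -
        ((if q = 0 then -1 else 1 / 2 : ℝ) : ℂ) * regSolidPred n M u) := by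
  have hQ := zC_sq_add u
  rw [hu, Complex.ofReal_one, one_pow] at hQ
  have := abs_le.1 hq
  simp only [regSolid, regSolidPred]
  obtain rfl | rfl | rfl : q = -1 ∨ q = 0 ∨ q = 1 := by omega
  · have h := eta_mul_solid (xiC u) (zC u) (etaC u) n (M + 1)
    rw [hQ, add_sub_cancel_right] at h
    rw [sphComp_neg_one, sub_neg_eq_add]
    norm_num at h ⊢
    linear_combination (-((Real.sqrt 2 : ℝ) : ℂ) / 2) * h
  · have h := z_mul_solid (xiC u) (zC u) (etaC u) n M
    rw [hQ] at h
    rw [sphComp_zero]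
    norm_num at h ⊢
    linear_combination h
  · have h := xi_mul_solid (xiC u) (zC u) (etaC u) n (M - 1)
    rw [hQ, sub_add_cancel] at h
    rw [sphComp_one]
    norm_num at h ⊢
    linear_combination (((Real.sqrt 2 : ℝ) : ℂ) / 2) * h

theorem clebschGordan_zero_succ (n : ℕ) :
    clebschGordan n 0 1 0 (n + 1) 0 = Real.sqrt (cgA n (n + 1)) * (n + 1) := by
  have hz : |(0 : ℤ)| ≤ n := by simp
  have h := clebschGordan_succ (k := n) (M := 0) (s := 0) (by simp) (by simp)
  have hp := Real.sqrt_pos.2 (cgF_pos hz)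
  rw [cgF_succ hz, sub_zero, cgW, cgP_succ] at h
  apply mul_right_cancel₀ hp.ne'
  rw [h, show ((n : ℝ) + 1 - ((0 : ℤ) : ℝ)) * (n + 1 + ((0 : ℤ) : ℝ)) = (n +
      1) ^ 2 by push_cast; ring,
    Real.sqrt_mul (by positivity), Real.sqrt_sq (by positivity)]
  simp
  ring

theorem clebschGordan_zero_pred (n : ℕ) :
    clebschGordan (n + 1) 0 1 0 n 0 = -(Real.sqrt (cgA (n + 1) n) * (n + 1)) := by
  have hz : |(0 : ℤ)| ≤ n := by simp
  have h := clebschGordan_pred (k := n) (M := 0) (s := 0) (by simp; omega) (by simp)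
  have hp := Real.sqrt_pos.2 (cgF_pos hz)
  have hn : (0 : ℝ) < n + 1 := by positivity
  rw [sub_zero, cgF_succ hz, cgW, cgP_pred,
    show ((n : ℝ) + 1 - ((0 : ℤ) : ℝ)) * (n + 1 + ((0 : ℤ) : ℝ)) = (n + 1) ^ 2 by push_cast; ring,
    Real.sqrt_mul (by positivity), Real.sqrt_sq (by positivity)] at h
  apply mul_right_cancel₀ (mul_pos hn hp).ne'
  rw [h]
  simp
  ring

/-- One term of the Clebsch-Gordan series of `sphComp_mul_sphHarm`, in terms of solid harmonics. -/
theorem clebschGordan_product_term {n J : ℕ} (hJ : J = n + 1 ∨ 1 ≤ n ∧ (J = n ∨ J + 1 = n))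
    {M q : ℤ} (hq : |q| ≤ 1) (hm : |M - q| ≤ n) {u : Space} (hu : ‖u‖ = 1) :
    ((Real.sqrt (cgF n (M - q)) : ℝ) : ℂ) *
      (((Real.sqrt ((2 * n + 1) / (2 * J + 1)) : ℝ) : ℂ) *
        (clebschGordan n (M - q) 1 q J M : ℂ) * sphHarm J M u) =
      (-1) ^ M * ((Real.sqrt ((2 * n + 1) / (4 * Real.pi)) : ℝ) : ℂ) *
        ((Real.sqrt (cgA n J) * (if q = 0 then 1 else Real.sqrt 2) * (cgF J M *
            cgP n J M q) : ℝ) : ℂ) *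
          regSolid J M u := by
  rw [sphHarm_eq _ _ _ hu]
  by_cases hM : |M| ≤ J
  · have h := congrArg Complex.ofReal (clebschGordan_mul_sqrt hJ hm hq)
    have hF := congrArg Complex.ofReal (Real.mul_self_sqrt (cgF_nonneg J M))
    have hs : Real.sqrt ((2 * n + 1) / (2 * J + 1)) * Real.sqrt ((2 * J + 1) / (4 * Real.pi)) =
        Real.sqrt ((2 * n + 1) / (4 * Real.pi)) := by
      have := Real.pi_pos
      rw [← Real.sqrt_mul (by positivity)]
      congr 1
      field_simp
    rw [← hs, harmNorm_eq hM]
    rw [cgW] at h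
    push_cast at h hF ⊢
    rw [← hF]
    linear_combination ((-1) ^ M * ((Real.sqrt ((2 * n + 1) / (2 * J + 1)) : ℝ) : ℂ) *
      ((Real.sqrt ((2 * J + 1) / (4 * Real.pi)) : ℝ) : ℂ) * (Real.sqrt (cgF J M) : ℂ) *
      regSolid J M u) * h
  · rw [regSolid_eq_zero (not_le.1 hM)]; simp

/-- The Clebsch-Gordan series for the product of `Y_n^{M-q}` with the component `u_q`, which is a
multiple of `Y_1^q`. The degree `k = n` drops out by parity. -/
theorem sphComp_mul_sphHarm (n : ℕ) (M : ℤ) {q : ℤ} (hq : |q| ≤ 1) {u : Space} (hu : ‖u‖ = 1) :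
    ∑ k ∈ (Finset.Icc (((n + 1 : ℕ) : ℤ) - 2).natAbs (n + 1)).filter
        (fun k : ℕ => (k : ℤ) ≠ ((n + 1 : ℕ) : ℤ) - 1),
      ((Real.sqrt ((2 * n + 1) / (2 * k + 1)) * clebschGordan 1 q n (M - q) k M *
        clebschGordan 1 0 n 0 k 0 : ℝ) : ℂ) * sphHarm k M u =
      sphComp u q * sphHarm n (M - q) u := by
  by_cases hm : |M - q| ≤ n
  swap
  · have h0 : sphHarm n (M - q) u = 0 := by
      rw [sphHarm_eq _ _ _ hu, regSolid_eq_zero (not_le.1 hm), mul_zero]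
    rw [h0, mul_zero]
    refine Finset.sum_eq_zero fun j _ => ?_
    rw [clebschGordan_swap 1 n j q, clebschGordan_eq_zero (Or.inl (not_le.1 hm))]; simp
  have hsq : ((Real.sqrt (cgF n (M - q)) : ℝ) : ℂ) ≠ 0 := by
    exact_mod_cast (Real.sqrt_pos.2 (cgF_pos hm)).ne'
  apply mul_left_cancel₀ hsq
  have hF := congrArg Complex.ofReal (Real.mul_self_sqrt (cgF_nonneg n (M - q)))
  have hn : (2 * (n : ℂ) + 1) ≠ 0 := by norm_cast
  have hrec := sphComp_mul_regSolid n M hq hu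
  have hsucc := congrArg Complex.ofReal (cgF_mul_cgP_succ hq hm)
  have hA := congrArg Complex.ofReal (Real.mul_self_sqrt (cgA_nonneg n (n + 1)))
  have hAv : cgA n (n + 1) * (n + 1) * (2 * n + 1) = 1 := by
    rw [cgA, if_pos rfl]; field_simp
  have hAv' := congrArg Complex.ofReal hAv
  have t1 := clebschGordan_product_term (Or.inl rfl) hq hm hu
  have hr : ((Real.sqrt (cgF n (M - q)) : ℝ) : ℂ) * (sphComp u q * sphHarm n (M - q) u) =
      (-1) ^ M * ((Real.sqrt ((2 * n + 1) / (4 * Real.pi)) : ℝ) : ℂ) * (cgF n (M - q) : ℂ) *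
        ((-1) ^ q * sphComp u q * regSolid n (M - q) u) := by
    rw [sphHarm_eq _ _ _ hu, harmNorm_eq hm, neg_one_zpow_sub, ← hF]
    push_cast
    ring
  rw [hr]
  apply mul_left_cancel₀ hn
  generalize (if q = 1 then ((n : ℝ) + M + 1) * (n + M) / 2
      else if q = 0 then ((n : ℝ) + 1 - M) * (n + 1 + M) else ((n : ℝ) - M + 1) * (n - M) / 2) = C
    at *
  generalize hw : ((if q = 0 then 1 else Real.sqrt 2 : ℝ)) = w at hrec t1
  rw [Complex.ofReal_mul] at hsucc
  cases n with
  | zero =>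
    rw [show (Finset.Icc (((0 + 1 : ℕ) : ℤ) - 2).natAbs (0 + 1)).filter
        (fun k : ℕ => (k : ℤ) ≠ ((0 + 1 : ℕ) : ℤ) - 1) = {1} by decide, Finset.sum_singleton,
      clebschGordan_swap 1 0 1 q, clebschGordan_swap 1 0 1 0, clebschGordan_zero_succ]
    simp only [regSolidPred, solidPred] at hrec
    push_cast at hrec hsucc hA hAv' t1 ⊢
    simp only [pow_zero, one_mul, mul_zero, zero_add, mul_one, sub_zero]
      at hrec hsucc hA hAv' t1 ⊢
    set S := ((Real.sqrt (1 / (4 * Real.pi)) : ℝ) : ℂ)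
    linear_combination (Real.sqrt (cgA 0 1) : ℂ) * t1 +
      (-1) ^ M * S * w * cgF 1 M * cgP 0 1 M q * regSolid 1 M u * (hA + hAv') +
      (-1) ^ M * S * w * regSolid 1 M u * hsucc - (-1) ^ M * S * cgF 0 (M - q) * hrec
  | succ n =>
    rw [show (Finset.Icc (((n + 1 + 1 : ℕ) : ℤ) - 2).natAbs (n + 1 + 1)).filter
        (fun k : ℕ => (k : ℤ) ≠ ((n + 1 + 1 : ℕ) : ℤ) - 1) = {n, n + 1 + 1} by
          ext k; simp only [Finset.mem_filter, Finset.mem_Icc, Finset.mem_insert,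
            Finset.mem_singleton]; omega,
      Finset.sum_insert (by rw [Finset.mem_singleton]; omega), Finset.sum_singleton,
      clebschGordan_swap 1 (n + 1) n q, clebschGordan_swap 1 (n + 1) (n + 1 + 1) q,
      clebschGordan_swap 1 (n + 1) n 0, clebschGordan_swap 1 (n + 1) (n + 1 + 1) 0,
      clebschGordan_zero_succ, clebschGordan_zero_pred,
      show 1 + (n + 1) - n = 2 by omega, show 1 + (n + 1) - (n + 1 + 1) = 0 by omega]
    have t2 := clebschGordan_product_term (n := n + 1) (J := n) (Or.inr ⟨by omega, Or.inr rfl⟩)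
      hq hm hu
    have hpred : (cgF n M : ℂ) * cgP (n + 1) n M q * regSolid n M u =
        cgF (n + 1) (M - q) * ((if q = 0 then -1 else 1 / 2 : ℝ) : ℂ) * regSolid n M u := by
      by_cases hM : |M| ≤ n
      · have h := congrArg Complex.ofReal (cgF_mul_cgP_pred hq hM)
        rw [Complex.ofReal_mul, Complex.ofReal_mul] at h
        rw [h]
      · rw [regSolid_eq_zero (not_le.1 hM)]; simp
    have hB := congrArg Complex.ofReal (Real.mul_self_sqrt (cgA_nonneg (n + 1) n))
    have hBv : cgA (n + 1) n * ((n + 1) * (2 * n + 3)) = 1 := by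
      rw [cgA_pred]; field_simp
    have hBv' := congrArg Complex.ofReal hBv
    simp only [regSolidPred, solidPred, ← regSolid.eq_1] at hrec
    rw [hw] at t2
    generalize (if q = 0 then -1 else 1 / 2 : ℝ) = d at *
    push_cast at hrec hsucc hA hAv' hB hBv' t1 t2 ⊢
    set S := ((Real.sqrt ((2 * ((n : ℝ) + 1) + 1) / (4 * Real.pi)) : ℝ) : ℂ)
    linear_combination (2 * ((n : ℂ) + 1) + 1) * ((Real.sqrt (cgA (n + 1) (n + 1 + 1)) : ℂ) *
        (n + 1 + 1)) * t1 - (2 * ((n : ℂ) + 1) + 1) * ((Real.sqrt (cgA (n + 1) n) : ℂ) * (n +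
            1)) * t2 +
      (-1) ^ M * S * w * cgF (n + 1 + 1) M * cgP (n + 1) (n + 1 + 1) M q * regSolid (n + 1 +
          1) M u *
        ((2 * ((n : ℂ) + 1) + 1) * (n + 1 + 1) * hA + hAv') +
      (-1) ^ M * S * w * regSolid (n + 1 + 1) M u * hsucc -
      (-1) ^ M * S * w * cgF n M * cgP (n + 1) n M q * regSolid n M u *
        ((2 * ((n : ℂ) + 1) + 1) * (n + 1) * hB + hBv') -
      (-1) ^ M * S * w * hpred - (-1) ^ M * S * cgF (n + 1) (M - q) * hrec

/-! ### The four series -/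

/-- The sum over `j` in the second series undoes the last coupling. -/
theorem sum_coeffK_smul_vecY (n k : ℕ) (μ q : ℤ) {s : ℤ} (hs : |s| ≤ 1) {u : Space} (hu : ‖u‖ = 1) :
    ∑ j ∈ Finset.Icc ((k : ℤ) - 1).natAbs (k + 1),
      ((coeffK k j (n + 1) s μ q : ℝ) : ℂ) • vecY j k (q + μ) u =
    ((Real.sqrt ((n + 1) * (2 * n + 3)) * (-1) ^ q * clebschGordan n (μ - s) 1 s (n +
        1) μ : ℝ) : ℂ) •
      (((Real.sqrt ((2 * n + 1) / (2 * k + 1)) * clebschGordan 1 q n (q + μ - s - q) k (q + μ - s) *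
        clebschGordan 1 0 n 0 k 0 : ℝ) : ℂ) * sphHarm k (q + μ - s) u) • sphBasis s := by
  rw [mul_smul, ← sum_clebschGordan_smul_vecY k (q + μ) hs hu, Finset.smul_sum, Finset.smul_sum]
  refine Finset.sum_congr rfl fun j _ => ?_
  have h : Real.sqrt (((n + 1 : ℕ) * (2 * (n + 1 : ℕ) + 1) * (2 * (n + 1 : ℕ) - 1) : ℝ) / (2 * k +
      1)) =
      Real.sqrt ((n + 1) * (2 * n + 3)) * Real.sqrt ((2 * n + 1) / (2 * k + 1)) := by
    rw [← Real.sqrt_mul (by positivity)]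
    congr 1
    push_cast
    ring
  rw [coeffK, h, Nat.add_sub_cancel, show q + μ - s - q = μ - s by ring, smul_smul, smul_smul]
  congr 1
  push_cast
  ring

/-- The coefficients `K` describe the multiplication of `W_{n+1}^μ` by `a · u`: with
`W_{n+1}^μ` written as a sum of products `Y_n^{μ-s} χ_{1,s}`, each `u_q Y_n^{μ-s}` is expanded in
spherical harmonics of degree `k` and the product with `χ_{1,s}` in coupled harmonics. -/
theorem sum_coeffK (n : ℕ) (μ : ℤ) (a : Space) {u : Space} (hu : ‖u‖ = 1) :
    ∑ q ∈ Finset.Icc (-1 : ℤ) 1, ∑ s ∈ Finset.Icc (-1 : ℤ) 1,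
      ∑ k ∈ (Finset.Icc (((n + 1 : ℕ) : ℤ) - 2).natAbs (n + 1)).filter
          (fun k : ℕ => (k : ℤ) ≠ ((n + 1 : ℕ) : ℤ) - 1),
        ∑ j ∈ Finset.Icc ((k : ℤ) - 1).natAbs (k + 1),
          (((coeffK k j (n + 1) s μ q : ℝ) : ℂ) * sphComp a (-q)) • vecY j k (q + μ) u =
      ((inner ℝ a u : ℝ) : ℂ) • cW (n + 1) μ u := by
  have hW : cW (n + 1) μ u = ((Real.sqrt ((n + 1) * (2 * n + 3)) : ℝ) : ℂ) • vecY (n + 1) n μ u :=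
      by
    have : ((Real.sqrt ((n + 1) * (2 * n + 3)) : ℝ) : ℂ) ≠ 0 := by
      exact_mod_cast (Real.sqrt_pos.2 (by positivity)).ne'
    rw [vecY_succ n μ hu, smul_smul, mul_one_div_cancel this, one_smul]
  rw [hW, ← sum_sphComp_mul_sphComp, vecY, Finset.sum_smul]
  refine Finset.sum_congr rfl fun q hq => ?_
  rw [Finset.mem_Icc, ← abs_le] at hq
  rw [Finset.smul_sum, Finset.smul_sum]
  refine Finset.sum_congr rfl fun s hs => ?_
  rw [Finset.mem_Icc, ← abs_le] at hs
  have h : ∀ k : ℕ, ∑ j ∈ Finset.Icc ((k : ℤ) - 1).natAbs (k + 1),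
          (((coeffK k j (n + 1) s μ q : ℝ) : ℂ) * sphComp a (-q)) • vecY j k (q + μ) u =
      ((sphComp a (-q) * ((Real.sqrt ((n + 1) * (2 * n + 3)) * (-1) ^ q *
        clebschGordan n (μ - s) 1 s (n + 1) μ : ℝ) : ℂ)) *
      (((Real.sqrt ((2 * n + 1) / (2 * k + 1)) * clebschGordan 1 q n (q + μ - s - q) k (q + μ - s) *
        clebschGordan 1 0 n 0 k 0 : ℝ) : ℂ) * sphHarm k (q + μ - s) u)) • sphBasis s := by
    intro k
    rw [mul_assoc, mul_smul, mul_smul, ← sum_coeffK_smul_vecY n k μ q hs hu, Finset.smul_sum]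
    refine Finset.sum_congr rfl fun j _ => ?_
    rw [smul_smul, mul_comm]
  rw [Finset.sum_congr rfl fun k _ => h k, ← Finset.sum_smul, ← Finset.mul_sum,
    sphComp_mul_sphHarm n (q + μ - s) hq hu, show q + μ - s - q = μ - s by ring, smul_smul,
        smul_smul]
  congr 1
  push_cast
  ring

theorem termK_succ (c : ℕ → ℤ → ℂ) {r : Space} (hr : r ≠ 0) (a : Space) (n : ℕ) :
    termK c r a (n + 1) = ∑ μ ∈ Finset.Icc (-((n + 1 : ℕ) : ℤ)) ((n + 1 : ℕ) : ℤ),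
      (2 * ((inner ℝ a r : ℝ) : ℂ) * (c (n + 1) μ * ((‖r‖ : ℝ) : ℂ) ^ n)) • cW (n +
          1) μ (unitVec r) := by
  rw [termK]
  refine Finset.sum_congr rfl fun μ _ => ?_
  have h : ((‖r‖ : ℝ) : ℂ) * ((inner ℝ a (unitVec r) : ℝ) : ℂ) = ((inner ℝ a r : ℝ) : ℂ) := by
    conv_rhs => rw [← norm_smul_unitVec hr, inner_smul_right]
    push_cast; rfl
  rw [show 2 * ((inner ℝ a r : ℝ) : ℂ) * (c (n + 1) μ * ((‖r‖ : ℝ) : ℂ) ^ n) =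
    c (n + 1) μ * (2 * ((‖r‖ : ℝ) : ℂ) ^ (n + 1)) * ((inner ℝ a (unitVec r) : ℝ) : ℂ) by
      rw [← h]; ring, mul_smul, ← sum_coeffK n μ a (norm_unitVec hr)]
  simp only [Finset.smul_sum, smul_smul, mul_assoc]

theorem termW_succ (c : ℕ → ℤ → ℂ) (r a : Space) (n : ℕ) :
    termW c r a (n + 1) = ∑ μ ∈ Finset.Icc (-((n + 1 : ℕ) : ℤ)) ((n + 1 : ℕ) : ℤ),
      (((‖r‖ ^ 2 + ‖a‖ ^ 2 : ℝ) : ℂ) * (c (n + 1) μ * ((‖r‖ : ℝ) : ℂ) ^ n)) •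
        cW (n + 1) μ (unitVec r) := by
  rw [termW]
  refine Finset.sum_congr rfl fun μ _ => ?_
  congr 1
  rw [Nat.add_sub_cancel]
  push_cast
  ring

theorem cW_sub_cV (l : ℕ) (m : ℤ) (u : Space) :
    cW l m u - cV l m u = ((2 * (l : ℂ) + 1) * sphHarm l m u) • toComplex u := by
  rw [cW, cV, vecW, vecV]; module

theorem norm_smul_toComplex_unitVec {x : Space} (hx : x ≠ 0) :
    ((‖x‖ : ℝ) : ℂ) • toComplex (unitVec x) = toComplex x := by
  conv_rhs => rw [← norm_smul_unitVec hx]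
  ext k
  simp [toComplex]

theorem toComplex_add (x y : Space) : toComplex (x + y) = toComplex x + toComplex y := by
  ext k; simp [toComplex]

theorem termWV_eq (c : ℕ → ℤ → ℂ) {r : Space} (hr : r ≠ 0) (n : ℕ) :
    termWV c r n = (∑ μ ∈ Finset.Icc (-(n : ℤ)) n,
      c n μ * ((‖r‖ : ℝ) : ℂ) ^ n * sphHarm n μ (unitVec r)) • toComplex r := by
  have hn : (2 * (n : ℂ) + 1) ≠ 0 := by norm_cast
  rw [termWV, Finset.sum_smul]
  refine Finset.sum_congr rfl fun μ _ => ?_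
  rw [cW_sub_cV, ← norm_smul_toComplex_unitVec hr, smul_smul, smul_smul]
  congr 1
  field_simp
  ring

theorem termY_eq (c : ℕ → ℤ → ℂ) {r : Space} (hr : r ≠ 0) (a : Space) (n : ℕ) :
    termY c r a n = (∑ μ ∈ Finset.Icc (-(n : ℤ)) n,
      c n μ * ((‖r‖ : ℝ) : ℂ) ^ n * sphHarm n μ (unitVec r)) • toComplex a := by
  rw [termY, Finset.sum_smul]
  refine Finset.sum_congr rfl fun μ _ => ?_
  rw [← sum_sphComp_smul_sphBasis a, Finset.smul_sum]
  refine Finset.sum_congr rfl fun q hq => ?_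
  rw [Finset.mem_Icc, ← abs_le] at hq
  have h := sum_clebschGordan_smul_vecY n (μ + q) hq (norm_unitVec hr)
  rw [add_sub_cancel_right] at h
  rw [smul_smul, mul_right_comm (c n μ * _) (sphHarm n μ (unitVec r)), mul_smul, ← h,
    Finset.smul_sum, add_comm q μ]
  refine Finset.sum_congr rfl fun j _ => ?_
  rw [smul_smul]
  congr 1
  ring

theorem hasSum_coeffH_cW {l : ℕ} {m : ℤ} (hm : |m| ≤ l) {r a : Space} (hr : r ≠ 0) (h : ‖r‖ < ‖a‖) :
    HasSum (fun n : ℕ => ∑ μ ∈ Finset.Icc (-((n + 1 : ℕ) : ℤ)) ((n + 1 : ℕ) : ℤ),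
      (coeffH l (n + 1) m μ a * ((‖r‖ : ℝ) : ℂ) ^ n) • cW (n + 1) μ (unitVec r))
      (kappa l m • gradIrreg l m (r + a)) := by
  have ha : a ≠ 0 := norm_pos_iff.1 ((norm_nonneg r).trans_lt h)
  refine ((hasSum_gradIrreg r a h hm).const_smul (kappa l m)).congr_fun fun n => ?_
  rw [Finset.smul_sum]
  exact Finset.sum_congr rfl fun μ hμ =>
    coeffH_smul_cW hm (abs_le.2 (Finset.mem_Icc.1 hμ)) ha hr

theorem hasSum_coeffH_sphHarm {l : ℕ} {m : ℤ} (hm : |m| ≤ l) {r a : Space} (hr : r ≠ 0)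
    (h : ‖r‖ < ‖a‖) :
    HasSum (fun n : ℕ => ∑ μ ∈ Finset.Icc (-(n : ℤ)) n,
      coeffH l n m μ a * ((‖r‖ : ℝ) : ℂ) ^ n * sphHarm n μ (unitVec r))
      (kappa l m * irregM l m (r + a)) := by
  have ha : a ≠ 0 := norm_pos_iff.1 ((norm_nonneg r).trans_lt h)
  refine ((hasSum_irregM r a h hm).mul_left (kappa l m)).congr_fun fun n => ?_
  rw [Finset.mul_sum]
  exact Finset.sum_congr rfl fun μ hμ =>
    coeffH_mul_sphHarm hm (abs_le.2 (Finset.mem_Icc.1 hμ)) ha hr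

theorem add_ne_zero_of_norm_lt {r a : Space} (h : ‖r‖ < ‖a‖) : r + a ≠ 0 := by
  intro h0
  rw [eq_neg_of_add_eq_zero_left h0, norm_neg] at h
  exact h.false

theorem expandsV_cV {l : ℕ} {m : ℤ} (hm : |m| ≤ l) {r a : Space} (hr : r ≠ 0) (h : ‖r‖ < ‖a‖) :
    ExpandsV (fun n μ => coeffH l n m μ a) r a
      ((((‖r + a‖ : ℝ) : ℂ) ^ (-(l : ℤ))) • cV l m (unitVec (r + a))) := by
  have hs := hasSum_coeffH_cW hm hr h
  have hW : HasSum (fun n => termW (fun n μ => coeffH l n m μ a) r a (n + 1))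
      (((‖r‖ ^ 2 + ‖a‖ ^ 2 : ℝ) : ℂ) • (kappa l m • gradIrreg l m (r + a))) := by
    refine (hs.const_smul _).congr_fun fun n => ?_
    rw [termW_succ, Finset.smul_sum]
    exact Finset.sum_congr rfl fun μ _ => mul_smul _ _ _
  have hK : HasSum (fun n => termK (fun n μ => coeffH l n m μ a) r a (n + 1))
      ((2 * ((inner ℝ a r : ℝ) : ℂ)) • (kappa l m • gradIrreg l m (r + a))) := by
    refine (hs.const_smul _).congr_fun fun n => ?_
    rw [termK_succ _ hr, Finset.smul_sum]
    exact Finset.sum_congr rfl fun μ _ => mul_smul _ _ _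
  refine ⟨hW.summable, hK.summable, ?_⟩
  -- the two factors add up to `‖r + a‖ ^ 2`
  rw [hW.tsum_eq, hK.tsum_eq, cV_eq_gradIrreg hm (add_ne_zero_of_norm_lt h), ← add_smul, smul_smul]
  congr 2
  have := congrArg Complex.ofReal (norm_add_sq_real r a)
  rw [real_inner_comm] at this
  push_cast at this ⊢
  rw [this]
  ring

/-- `W_l^m` differs from `V_l^m` by `(2 l + 1) Y_l^m` times the radial unit vector; after the
translation of `Y_l^m`, the radial vector `r + a` splits into the third and the fourth series. -/
theorem expandsW_cW {l : ℕ} {m : ℤ} (hm : |m| ≤ l) {r a : Space} (hr : r ≠ 0) (h : ‖r‖ < ‖a‖) :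
    ExpandsW l (fun n μ => coeffH l n m μ a) r a
      ((((‖r + a‖ : ℝ) : ℂ) ^ (-(l : ℤ))) • cW l m (unitVec (r + a))) := by
  have hx := add_ne_zero_of_norm_lt h
  obtain ⟨hW, hK, hV⟩ := expandsV_cV hm hr h
  have hs := hasSum_coeffH_sphHarm hm hr h
  have hr' : HasSum (fun n => termWV (fun n μ => coeffH l n m μ a) r n)
      ((kappa l m * irregM l m (r + a)) • toComplex r) := by
    simpa only [termWV_eq _ hr] using hs.smul_const (toComplex r)
  have ha' : HasSum (fun n => termY (fun n μ => coeffH l n m μ a) r a n)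
      ((kappa l m * irregM l m (r + a)) • toComplex a) := by
    simpa only [termY_eq _ hr] using hs.smul_const (toComplex a)
  refine ⟨hW, hK, hr'.summable, ha'.summable, ?_⟩
  rw [← hV, hr'.tsum_eq, ha'.tsum_eq, add_assoc, ← smul_add, ← smul_add, ← toComplex_add,
    ← norm_smul_toComplex_unitVec hx, ← sub_eq_iff_eq_add', ← smul_sub, cW_sub_cV, smul_smul,
    smul_smul, smul_smul]
  congr 1
  linear_combination (2 * (l : ℂ) + 1) * sphHarm_eq_irregM l m hx

section
variable (c₁ c₂ : ℕ → ℤ → ℂ) (α β : ℂ) (r a : Space) (n : ℕ)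

theorem termW_linear : termW (fun n μ => α * c₁ n μ + β * c₂ n μ) r a n =
    α • termW c₁ r a n + β • termW c₂ r a n := by
  simp only [termW, Finset.smul_sum, ← Finset.sum_add_distrib]
  refine Finset.sum_congr rfl fun μ _ => ?_
  module

theorem termK_linear : termK (fun n μ => α * c₁ n μ + β * c₂ n μ) r a n =
    α • termK c₁ r a n + β • termK c₂ r a n := by
  simp only [termK, Finset.smul_sum, ← Finset.sum_add_distrib]
  refine Finset.sum_congr rfl fun μ _ => Finset.sum_congr rfl fun q _ =>
    Finset.sum_congr rfl fun s _ => Finset.sum_congr rfl fun k _ =>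
    Finset.sum_congr rfl fun j _ => ?_
  module

theorem termWV_linear : termWV (fun n μ => α * c₁ n μ + β * c₂ n μ) r n =
    α • termWV c₁ r n + β • termWV c₂ r n := by
  simp only [termWV, Finset.smul_sum, ← Finset.sum_add_distrib]
  refine Finset.sum_congr rfl fun μ _ => ?_
  module

theorem termY_linear : termY (fun n μ => α * c₁ n μ + β * c₂ n μ) r a n =
    α • termY c₁ r a n + β • termY c₂ r a n := by
  simp only [termY, Finset.smul_sum, ← Finset.sum_add_distrib]
  refine Finset.sum_congr rfl fun μ _ => Finset.sum_congr rfl fun q _ =>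
    Finset.sum_congr rfl fun j _ => ?_
  module

end

section
variable {ι : Type*} {f g : ι → Fin 3 → ℂ}

theorem tsum_smul_add_smul (hf : Summable f) (hg : Summable g) (α β : ℂ) :
    ∑' i, (α • f i + β • g i) = α • ∑' i, f i + β • ∑' i, g i :=
  ((hf.hasSum.const_smul α).add (hg.hasSum.const_smul β)).tsum_eq

theorem summable_smul_add_smul (hf : Summable f) (hg : Summable g) (α β : ℂ) :
    Summable fun i => α • f i + β • g i :=
  (hf.const_smul α).add (hg.const_smul β)

end

section
variable {c₁ c₂ : ℕ → ℤ → ℂ} {r a : Space} {v₁ v₂ : Fin 3 → ℂ}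

theorem ExpandsV.linear (h₁ : ExpandsV c₁ r a v₁) (h₂ : ExpandsV c₂ r a v₂) (α β : ℂ) :
    ExpandsV (fun n μ => α * c₁ n μ + β * c₂ n μ) r a (α • v₁ + β • v₂) := by
  obtain ⟨a₁, b₁, rfl⟩ := h₁
  obtain ⟨a₂, b₂, rfl⟩ := h₂
  simp only [ExpandsV, termW_linear, termK_linear, tsum_smul_add_smul a₁ a₂,
    tsum_smul_add_smul b₁ b₂]
  exact ⟨summable_smul_add_smul a₁ a₂ α β, summable_smul_add_smul b₁ b₂ α β, by module⟩

theorem ExpandsW.linear {l : ℕ} (h₁ : ExpandsW l c₁ r a v₁) (h₂ : ExpandsW l c₂ r a v₂)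
    (α β : ℂ) :
    ExpandsW l (fun n μ => α * c₁ n μ + β * c₂ n μ) r a (α • v₁ + β • v₂) := by
  obtain ⟨a₁, b₁, d₁, e₁, rfl⟩ := h₁
  obtain ⟨a₂, b₂, d₂, e₂, rfl⟩ := h₂
  simp only [ExpandsW, termW_linear, termK_linear, termWV_linear, termY_linear,
    tsum_smul_add_smul a₁ a₂, tsum_smul_add_smul b₁ b₂, tsum_smul_add_smul d₁ d₂,
    tsum_smul_add_smul e₁ e₂]
  exact ⟨summable_smul_add_smul a₁ a₂ α β, summable_smul_add_smul b₁ b₂ α β,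
    summable_smul_add_smul d₁ d₂ α β, summable_smul_add_smul e₁ e₂ α β, by module⟩

end

section
variable {l : ℕ} {m : ℤ} {a : Space}

theorem coeffPos_eq : coeffPos l m a = fun n μ =>
    1 / ((Real.sqrt 2 : ℝ) : ℂ) * coeffH l n (-m) μ a +
      1 / ((Real.sqrt 2 : ℝ) : ℂ) * (-1) ^ m * coeffH l n m μ a := by
  ext n μ; rw [coeffPos]; ring

theorem coeffNeg_eq : coeffNeg l m a = fun n μ =>
    Complex.I / ((Real.sqrt 2 : ℝ) : ℂ) * coeffH l n m μ a +
      -(Complex.I / ((Real.sqrt 2 : ℝ) : ℂ) * (-1) ^ m) * coeffH l n (-m) μ a := by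
  ext n μ; rw [coeffNeg]; ring

variable {T : (Space → ℂ) → Space → Fin 3 → ℂ} {u : Space} (l)

theorem IsSurfLinear.smul_realSphHarm_pos (hT : IsSurfLinear T) (hu : ‖u‖ = 1) (hm : 0 < m)
    (p : ℂ) : p • T (realSphHarm l m) u =
      (1 / ((Real.sqrt 2 : ℝ) : ℂ)) • (p • T (sphHarm l (-m)) u) +
      (1 / ((Real.sqrt 2 : ℝ) : ℂ) * (-1) ^ m) • (p • T (sphHarm l m) u) := by
  rw [hT.realSphHarm_pos l hu hm]; module

theorem IsSurfLinear.smul_realSphHarm_neg (hT : IsSurfLinear T) (hu : ‖u‖ = 1) (hm : m < 0)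
    (p : ℂ) : p • T (realSphHarm l m) u =
      (Complex.I / ((Real.sqrt 2 : ℝ) : ℂ)) • (p • T (sphHarm l m) u) +
      (-(Complex.I / ((Real.sqrt 2 : ℝ) : ℂ) * (-1) ^ m)) • (p • T (sphHarm l (-m)) u) := by
  rw [hT.realSphHarm_neg l hu hm]; module

end

end

end VectorHarmonics

theorem mainTheorem4 :
    -- the coupled harmonics in terms of the complex harmonics `V`, `X`, `W`
    (∀ (k : ℕ) (M : ℤ) (u : Space), 1 ≤ k → ‖u‖ = 1 →
      vecY (k - 1) k M u =
        (1 / ((Real.sqrt (k * (2 * k - 1)) : ℝ) : ℂ)) • cV (k - 1) M u ∧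
      vecY k k M u =
        (-Complex.I / ((Real.sqrt (k * (k + 1)) : ℝ) : ℂ)) • cX k M u) ∧
    (∀ (k : ℕ) (M : ℤ) (u : Space), ‖u‖ = 1 →
      vecY (k + 1) k M u =
        (1 / ((Real.sqrt ((k + 1) * (2 * k + 3)) : ℝ) : ℂ)) • cW (k + 1) M u) ∧
    -- complex harmonics and coupled harmonics in terms of the real harmonics
    (∀ (k : ℕ) (M : ℤ) (u : Space), ‖u‖ = 1 →
      cW k M u = fromReal (fun M' => rW k M' u) M ∧
      cV k M u = fromReal (fun M' => rV k M' u) M) ∧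
    (∀ (k : ℕ) (M : ℤ) (u : Space), 1 ≤ k → ‖u‖ = 1 →
      vecY (k - 1) k M u =
        (1 / ((Real.sqrt (k * (2 * k - 1)) : ℝ) : ℂ)) •
          fromReal (fun M' => rV (k - 1) M' u) M ∧
      vecY k k M u =
        (-Complex.I / ((Real.sqrt (k * (k + 1)) : ℝ) : ℂ)) •
          fromReal (fun M' => rX k M' u) M) ∧
    (∀ (k : ℕ) (M : ℤ) (u : Space), ‖u‖ = 1 →
      vecY (k + 1) k M u =
        (1 / ((Real.sqrt ((k + 1) * (2 * k + 3)) : ℝ) : ℂ)) •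
          fromReal (fun M' => rW (k + 1) M' u) M) ∧
    -- the addition theorems
    (∀ (l : ℕ) (m : ℤ) (r a : Space), |m| ≤ l → r ≠ 0 → ‖r‖ < ‖a‖ →
      -- complex forms
      ExpandsV (fun n μ => coeffH l n m μ a) r a
        ((((‖r + a‖ : ℝ) : ℂ) ^ (-(l : ℤ))) • cV l m (unitVec (r + a))) ∧
      ExpandsW l (fun n μ => coeffH l n m μ a) r a
        ((((‖r + a‖ : ℝ) : ℂ) ^ (-(l : ℤ))) • cW l m (unitVec (r + a))) ∧
      -- real forms
      (0 < m →
        ExpandsV (coeffPos l m a) r a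
          ((((‖r + a‖ : ℝ) : ℂ) ^ (-(l : ℤ))) • rV l m (unitVec (r + a))) ∧
        ExpandsW l (coeffPos l m a) r a
          ((((‖r + a‖ : ℝ) : ℂ) ^ (-(l : ℤ))) • rW l m (unitVec (r + a)))) ∧
      (m < 0 →
        ExpandsV (coeffNeg l m a) r a
          ((((‖r + a‖ : ℝ) : ℂ) ^ (-(l : ℤ))) • rV l m (unitVec (r + a))) ∧
        ExpandsW l (coeffNeg l m a) r a
          ((((‖r + a‖ : ℝ) : ℂ) ^ (-(l : ℤ))) • rW l m (unitVec (r + a)))) ∧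
      (m = 0 →
        ExpandsV (fun n μ => coeffH l n 0 μ a) r a
          ((((‖r + a‖ : ℝ) : ℂ) ^ (-(l : ℤ))) • rV l 0 (unitVec (r + a))) ∧
        ExpandsW l (fun n μ => coeffH l n 0 μ a) r a
          ((((‖r + a‖ : ℝ) : ℂ) ^ (-(l : ℤ))) • rW l 0 (unitVec (r + a))))) := by
  have pred : ∀ (k : ℕ) (M : ℤ) (u : Space), 1 ≤ k → ‖u‖ = 1 → vecY (k - 1) k M u =
      (1 / ((Real.sqrt (k * (2 * k - 1)) : ℝ) : ℂ)) • cV (k - 1) M u := by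
    intro k M u hk hu
    obtain ⟨k, rfl⟩ := Nat.exists_eq_add_of_le' hk
    rw [Nat.add_sub_cancel, vecY_pred k M hu]
    congr 4
    push_cast
    ring_nf
  refine ⟨fun k M u hk hu => ⟨pred k M u hk hu, vecY_self hk M hu⟩,
      fun k M u hu => vecY_succ k M hu,
    fun k M u hu => ⟨(isSurfLinear_vecW k).eq_fromReal k hu M,
      (isSurfLinear_vecV k).eq_fromReal k hu M⟩,
    fun k M u hk hu => ⟨?_, ?_⟩, fun k M u hu => ?_, fun l m r a hm hr h => ?_⟩
  · rw [pred k M u hk hu]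
    exact congrArg _ ((isSurfLinear_vecV (k - 1)).eq_fromReal (k - 1) hu M)
  · rw [vecY_self hk M hu]
    exact congrArg _ (isSurfLinear_vecX.eq_fromReal k hu M)
  · rw [vecY_succ k M hu]
    exact congrArg _ ((isSurfLinear_vecW (k + 1)).eq_fromReal (k + 1) hu M)
  have hu := norm_unitVec (add_ne_zero_of_norm_lt h)
  have hm' : |-m| ≤ l := by rwa [abs_neg]
  have hV := expandsV_cV hm hr h
  have hW := expandsW_cW hm hr h
  have hV' := expandsV_cV hm' hr h
  have hW' := expandsW_cW hm' hr h
  refine ⟨hV, hW, fun h0 => ?_, fun h0 => ?_, ?_⟩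
  · rw [rV, rW, (isSurfLinear_vecV l).smul_realSphHarm_pos l hu h0,
      (isSurfLinear_vecW l).smul_realSphHarm_pos l hu h0, coeffPos_eq]
    exact ⟨hV'.linear hV _ _, hW'.linear hW _ _⟩
  · rw [rV, rW, (isSurfLinear_vecV l).smul_realSphHarm_neg l hu h0,
      (isSurfLinear_vecW l).smul_realSphHarm_neg l hu h0, coeffNeg_eq]
    exact ⟨hV.linear hV' _ _, hW.linear hW' _ _⟩
  · rintro rfl
    rw [rV, rW, realSphHarm_zero]
    exact ⟨hV, hW⟩
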